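/- Let $\mathbb H=\{z\in\mathbb C:\operatorname{Im}z>0\}$ and let $\gamma:[0,\infty)\to\overline{\mathbb H}$ be a continuous path with $\gamma(0)\in\mathbb R$. For $t\ge 0$ let $H_t$ be the unbounded connected component of $\mathbb H\setminus\gamma[0,t]$ and let $K_t$ be the closure of $\mathbb H\setminus H_t$. Let $g_t$ be the unique conformal map of $H_t=\mathbb H\setminus K_t$ onto $\mathbb H$ with $g_t(z)-z\to 0$ as $z\to\infty$; it has an expansion $$g_t(z)=z+\frac{a_1(K_t)}{z}+\frac{a_2(K_t)}{z^2}+\cdots$$ near $\infty$ with real coefficients, and $a_1(K_t)$ is called the capacity of $K_t$. Assume that 1. for all $0\le s<t$, $K_s$ is a proper subset of $K_t$; 2. the path reflects off its past instead of crossing it: for all $0\le s\le u$ and $\varepsilon>0$ there is a $\delta>0$ such that any two points $\gamma(v),\gamma(w)\in H_s$ with $|v-u|<\delta$, $|w-u|<\delta$ can be joined by a path in $H_s\cap B(\gamma(u),\varepsilon)$; 3. $\lim_{t\to\infty}a_1(K_t)=\infty$. Let $U_t=g_t(\gamma(t))$ be the image of the tip, that is, the limit of $g_t(z)$ as $z\to\gamma(t)$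 in $H_t$ on the side of $K_t$ into which the path continues: $z$ tends to $\gamma(t)$ through the sets, indexed by $\varepsilon\downarrow0$, of those points that can be joined inside $H_t\cap B(\gamma(t),\varepsilon)$ to points $\gamma(s)$ with $s>t$ arbitrarily close to $t$. Then for every $t\ge0$ the map $g_t$, the capacity $a_1(K_t)$ and the limit $U_t\in\mathbb R$ exist, and both $a_1(K_t)$ and $U_t$ are continuous in $t\in[0,\infty)$. Consequently $\gamma$ can be reparameterized by capacity: there is an increasing bijection $\varphi:[0,\infty)\to[0,\infty)$ such that the hulls $\hat K_t$ of the path $\gamma\circ\varphi$ satisfy $a_1(\hat K_t)=2t$ for all $t\ge0$. -/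

import Mathlib

open Set Filter Topology Bornology
open scoped NNReal

/-- The open upper half-plane, as a subset of `ℂ`. -/
def upperHalf : Set ℂ := {z | 0 < z.im}

/-! ### Normalized conformal maps and capacity -/

/-- `g` maps `ℍ \ K` conformally onto `ℍ`, with `g z - z → 0` as `z → ∞` in `ℍ \ K`
(the hydrodynamic normalization). -/
def IsHydrodynamicMap (K : Set ℂ) (g : ℂ → ℂ) : Prop :=
  DifferentiableOn ℂ g (upperHalf \ K) ∧ BijOn g (upperHalf \ K) upperHalf ∧
    Tendsto (fun z => g z - z) (cobounded ℂ ⊓ 𝓟 (upperHalf \ K)) (𝓝 0)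

/-- The map `g_K` of a hull `K`. For a hull it exists and is unique on `ℍ \ K`;
its values outside `ℍ \ K` carry no meaning and are never used. -/
noncomputable def hydroMap (K : Set ℂ) : ℂ → ℂ :=
  Classical.epsilon (IsHydrodynamicMap K)

/-- `g_K z = z + a 1 / z + a 2 / z ^ 2 + ⋯` for all large `z`, with real coefficients
(the number `a 0` is not used). -/
def HasExpansionAtInfinity (K : Set ℂ) (a : ℕ → ℝ) : Prop :=
  ∃ R : ℝ, ∀ z ∈ upperHalf \ K, R < ‖z‖ →
    HasSum (fun n : ℕ => (a (n + 1) : ℂ) / z ^ (n + 1)) (hydroMap K z - z)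

/-- `c` is the coefficient `a₁` in the expansion of `g_K` at infinity. -/
def HasHullCapacity (K : Set ℂ) (c : ℝ) : Prop :=
  ∃ a : ℕ → ℝ, HasExpansionAtInfinity K a ∧ a 1 = c

/-- The capacity `a₁(K)` of a hull `K`. -/
noncomputable def hullCapacity (K : Set ℂ) : ℝ :=
  Classical.epsilon (HasHullCapacity K)

/-! ### The growing hulls of a path -/

/-- `H_t`: the unbounded connected component of `ℍ \ γ[0,t]`. -/
def pathDomain (γ : ℝ≥0 → ℂ) (t : ℝ≥0) : Set ℂ :=
  {z | z ∈ upperHalf \ γ '' Iic t ∧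
    ¬ IsBounded (connectedComponentIn (upperHalf \ γ '' Iic t) z)}

/-- `K_t`: the closure of `ℍ \ H_t`. -/
def pathHull (γ : ℝ≥0 → ℂ) (t : ℝ≥0) : Set ℂ :=
  closure (upperHalf \ pathDomain γ t)

/-- The paths under consideration. (That every `K_t` is bounded need not be required, because
`γ[0,t]` is compact.) -/
structure IsGrowingPath (γ : ℝ≥0 → ℂ) : Prop where
  continuous : Continuous γ
  im_nonneg : ∀ t, 0 ≤ (γ t).im
  start_real : (γ 0).im = 0
  /-- For `s < t`, the hull `K_s` is a proper subset of `K_t`. -/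
  strictMono_hull : StrictMono (pathHull γ)
  /-- The path reflects off its past hulls, it does not cross them: near each time `u`, the part
  of the path that is visible in `H_s` stays on one side of `K_s`, i.e. its points can be joined
  to each other near `γ u` without leaving `H_s`. -/
  reflects : ∀ s u : ℝ≥0, s ≤ u → ∀ ε : ℝ, 0 < ε → ∃ δ : ℝ, 0 < δ ∧
    ∀ v w : ℝ≥0, dist v u < δ → dist w u < δ → γ v ∈ pathDomain γ s → γ w ∈ pathDomain γ s →
      JoinedIn (pathDomain γ s ∩ Metric.ball (γ u) ε) (γ v) (γ w)
  capacity_tendsto : Tendsto (fun t => hullCapacity (pathHull γ t)) atTop atTop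

/-! ### The image of the tip -/

/-- The points of `H_t` within distance `ε` of the tip `γ t` that lie on that side of `K_t`
into which the path continues: they can be joined inside `H_t ∩ B(γ t, ε)` to points `γ s`
with `s > t` arbitrarily close to `t`. -/
def tipNhd (γ : ℝ≥0 → ℂ) (t : ℝ≥0) (ε : ℝ) : Set ℂ :=
  {z | ∃ᶠ s in 𝓝[>] t, JoinedIn (pathDomain γ t ∩ Metric.ball (γ t) ε) (γ s) z}

/-- The filter of `z → γ t` in `H_t`, on the side of `K_t` into which the path continues. -/
def tipFilter (γ : ℝ≥0 → ℂ) (t : ℝ≥0) : Filter ℂ :=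
  ⨅ ε ∈ Ioi (0 : ℝ), 𝓟 (tipNhd γ t ε)

/-- The real number `u` is the boundary value `g_t(γ t)`: the limit of `g_t z` as `z` tends in
`H_t` to the tip `γ t`. -/
def HasTipValue (γ : ℝ≥0 → ℂ) (t : ℝ≥0) (u : ℝ) : Prop :=
  (tipFilter γ t).NeBot ∧
    Tendsto (hydroMap (pathHull γ t)) (tipFilter γ t) (𝓝 (u : ℂ))

/-- The driving function `U_t = g_t(γ t)`. -/
noncomputable def drivingFunction (γ : ℝ≥0 → ℂ) (t : ℝ≥0) : ℝ :=
  Classical.epsilon (HasTipValue γ t)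

open scoped ComplexConjugate

/-! ### Injective holomorphic maps -/

/-! Existence of `g_t`. The path is connected and starts on the real line, so the complement of
`H_t` in a large disc, symmetrized by conjugation and completed by a real segment, is connected
(`isPreconnected_symmHull_unboundedPart`). Under `z ↦ 1/z` the rest of the sphere becomes a domain
`D ∋ 0` in which all cycles have winding number zero about points off `D`. Dixon's proof of Cauchy's
theorem then gives primitives and square roots in `D`, and the extremal argument gives a Riemann map
`F`. Normalized by `F' 0 > 0`, it commutes with conjugation, and `c * (1 / F + F)` at `1/z`, minus a
real constant, is the normalized map (`exists_isHydro`). The symmetry makes the coefficients real.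

Continuity rests on two uniform estimates. First, by length and area, a connected set of small
diameter in `H_t` has a small image under `g_t`, with constants depending only on a bound for the
hull (`exists_small_image`). As the path reflects off its past, the points near the tip on the
correct side form a path-connected set, so their images are Cauchy and `U_t` exists. If moreover the
path moves little during `[s, t]`, all of its part visible in `H_s` is sent by `g_s` to within `η`
of `U_s`; hence `g_s(H_t)` contains every point of the half-plane farther than `η` from `U_s`
(`mem_image_of_lt_norm_sub`).

Second, a normalized map of a domain missing only points within `r` of a real `x` has capacity in
`[0, r²]` and sends points within `2r` of `x` to within `50r` of it (`IsHydro.capacity_le`,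
`IsHydro.norm_sub_le`). Applied to `g_t ∘ g_s⁻¹` with `r = η`, this bounds the change of capacity by
`η²` and that of `U` by `51η`. The estimates are uniform in the starting time, so they give
continuity from both sides.

Reparameterization. The capacity is `0` at time `0`, continuous, unbounded and strictly increasing:
equal capacities would force `g_s = g_t`, by a Hopf-type argument at infinity
(`eventually_eq_zero_of_im_nonneg`), and thus equal hulls. -/

theorem nhds_le_map_of_injOn {U : Set ℂ} {f : ℂ → ℂ} (hU : IsOpen U)
    (hf : DifferentiableOn ℂ f U) (hinj : InjOn f U) {z : ℂ} (hz : z ∈ U) :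
    𝓝 (f z) ≤ map f (𝓝 z) := by
  have han : AnalyticAt ℂ f z := hf.analyticAt (hU.mem_nhds hz)
  refine han.eventually_constant_or_nhds_le_map_nhds.resolve_left fun h => ?_
  have h2 : ∀ᶠ w in 𝓝[≠] z, f w = f z ∧ w ∈ U :=
    (h.and (hU.mem_nhds hz)).filter_mono nhdsWithin_le_nhds
  obtain ⟨w, ⟨hw, hwU⟩, hne⟩ := (h2.and self_mem_nhdsWithin).exists
  exact hne (hinj hwU hz hw)

theorem isOpen_image_of_injOn {U : Set ℂ} {f : ℂ → ℂ} (hU : IsOpen U)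
    (hf : DifferentiableOn ℂ f U) (hinj : InjOn f U) {V : Set ℂ} (hV : IsOpen V) (hVU : V ⊆ U) :
    IsOpen (f '' V) := by
  rw [isOpen_iff_mem_nhds]
  rintro _ ⟨z, hz, rfl⟩
  exact nhds_le_map_of_injOn hU hf hinj (hVU hz) (image_mem_map (hV.mem_nhds hz))

theorem continuousOn_invFunOn {U : Set ℂ} {f : ℂ → ℂ} (hU : IsOpen U)
    (hf : DifferentiableOn ℂ f U) (hinj : InjOn f U) :
    ContinuousOn (Function.invFunOn f U) (f '' U) := by
  rintro _ ⟨z, hz, rfl⟩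
  apply ContinuousAt.continuousWithinAt
  have h0 : Function.invFunOn f U (f z) = z := hinj.leftInvOn_invFunOn hz
  intro s hs
  rw [h0] at hs
  rw [mem_map]
  have : f '' (s ∩ U) ∈ 𝓝 (f z) := nhds_le_map_of_injOn hU hf hinj hz
    (image_mem_map (inter_mem hs (hU.mem_nhds hz)))
  filter_upwards [this]
  rintro _ ⟨w, ⟨hw, hwU⟩, rfl⟩
  rwa [mem_preimage, hinj.leftInvOn_invFunOn hwU]

/-- Where `f'` is nonzero this is the inverse function rule. Zeros of `f'` are isolated, as
otherwise `f` would be constant on a ball, so at them the continuous inverse has a removable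
singularity. That there are no such zeros follows afterwards from the chain rule. -/
theorem differentiableOn_invFunOn {U : Set ℂ} {f : ℂ → ℂ} (hU : IsOpen U)
    (hf : DifferentiableOn ℂ f U) (hinj : InjOn f U) :
    DifferentiableOn ℂ (Function.invFunOn f U) (f '' U) := by
  have hcont := continuousOn_invFunOn hU hf hinj
  have hopen : IsOpen (f '' U) := isOpen_image_of_injOn hU hf hinj hU subset_rfl
  have key : ∀ z ∈ U, deriv f z ≠ 0 → DifferentiableAt ℂ (Function.invFunOn f U) (f z) := by
    intro z hz hd
    have h0 : Function.invFunOn f U (f z) = z := hinj.leftInvOn_invFunOn hz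
    refine (HasDerivAt.of_local_left_inverse (f := f) (f' := deriv f z) ?_ ?_ hd ?_).differentiableAt
    · exact hcont.continuousAt (hopen.mem_nhds ⟨z, hz, rfl⟩)
    · rw [h0]; exact (hf.differentiableAt (hU.mem_nhds hz)).hasDerivAt
    · filter_upwards [hopen.mem_nhds ⟨z, hz, rfl⟩] with w hw
      exact Function.invFunOn_eq hw
  rintro _ ⟨z, hz, rfl⟩
  apply DifferentiableAt.differentiableWithinAt
  have hdan : AnalyticAt ℂ (deriv f) z := (hf.analyticAt (hU.mem_nhds hz)).deriv
  rcases hdan.eventually_eq_zero_or_eventually_ne_zero with h | h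
  · exfalso
    obtain ⟨r, hr, hball⟩ := Metric.eventually_nhds_iff_ball.1 (h.and (hU.mem_nhds hz))
    have hsub : Metric.ball z r ⊆ U := fun w hw => (hball w hw).2
    have hconst : ∀ w ∈ Metric.ball z r, f w = f z := by
      intro w hw
      refine (convex_ball z r).is_const_of_fderivWithin_eq_zero (𝕜 := ℂ) (hf.mono hsub) ?_ hw
        (Metric.mem_ball_self hr)
      intro x hx
      rw [fderivWithin_of_isOpen Metric.isOpen_ball hx]
      ext
      simpa using (hball x hx).1
    have hw : z + (r / 2 : ℝ) ∈ Metric.ball z r := by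
      rw [Metric.mem_ball, dist_eq_norm, add_sub_cancel_left, Complex.norm_real,
        Real.norm_eq_abs, abs_of_pos (by positivity)]
      linarith
    have := hinj (hsub hw) hz (hconst _ hw)
    have h3 : ((r / 2 : ℝ) : ℂ) = 0 := by simpa using this
    rw [Complex.ofReal_eq_zero] at h3
    linarith
  · refine (Complex.analyticAt_of_differentiable_on_punctured_nhds_of_continuousAt ?_
      (hcont.continuousAt (hopen.mem_nhds ⟨z, hz, rfl⟩))).differentiableAt
    have h1 : ∀ᶠ w in 𝓝 z, w ≠ z → deriv f w ≠ 0 := by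
      rwa [eventually_nhdsWithin_iff] at h
    have h2 := image_mem_map (m := f) (inter_mem h1 (hU.mem_nhds hz))
    have h3 := nhds_le_map_of_injOn hU hf hinj hz h2
    rw [eventually_nhdsWithin_iff]
    filter_upwards [h3]
    rintro _ ⟨w, ⟨hw, hwU⟩, rfl⟩ hne
    exact key w hwU (hw fun h => hne (by simp [h]))

theorem deriv_ne_zero_of_injOn {U : Set ℂ} {f : ℂ → ℂ} (hU : IsOpen U)
    (hf : DifferentiableOn ℂ f U) (hinj : InjOn f U) {z : ℂ} (hz : z ∈ U) : deriv f z ≠ 0 := by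
  intro h0
  have hopen : IsOpen (f '' U) := isOpen_image_of_injOn hU hf hinj hU subset_rfl
  have h1 := ((differentiableOn_invFunOn hU hf hinj).differentiableAt
    (hopen.mem_nhds ⟨z, hz, rfl⟩)).hasDerivAt
  have h2 := (hf.differentiableAt (hU.mem_nhds hz)).hasDerivAt
  have h3 := h1.comp z h2
  have h4 : HasDerivAt (Function.invFunOn f U ∘ f) 1 z := by
    refine (hasDerivAt_id z).congr_of_eventuallyEq ?_
    filter_upwards [hU.mem_nhds hz] with w hw
    exact hinj.leftInvOn_invFunOn hw
  have := h3.unique h4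
  rw [h0, mul_zero] at this
  exact zero_ne_one this

/-! ### A maximum principle -/

/-- If `Im F` were positive somewhere, `|exp(-iF)| = exp(Im F)` would attain its maximum over `U`
inside `C`. The set of maximum points is compact, and open by the local maximum principle, hence all
of `ℂ`, which is absurd. Neither boundary values nor connectedness of `U` are needed. -/
theorem im_nonpos_of_im_le_off_compact {U : Set ℂ} {F : ℂ → ℂ} (hU : IsOpen U)
    (hF : DifferentiableOn ℂ F U)
    (h : ∀ ε > 0, ∃ C ⊆ U, IsCompact C ∧ ∀ z ∈ U, z ∉ C → (F z).im ≤ ε) :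
    ∀ z ∈ U, (F z).im ≤ 0 := by
  intro z hz
  by_contra! hpos
  obtain ⟨C, hCU, hC, hoff⟩ := h ((F z).im / 2) (by positivity)
  have hzC : z ∈ C := by
    by_contra hzC
    linarith [hoff z hz hzC]
  set G : ℂ → ℂ := fun w => Complex.exp (-Complex.I * F w)
  have hG : DifferentiableOn ℂ G U := (hF.const_mul _).cexp
  have hnorm : ∀ w, ‖G w‖ = Real.exp (F w).im := by
    intro w
    simp [G, Complex.norm_exp]
  obtain ⟨m, hmC, hm⟩ := hC.exists_isMaxOn ⟨z, hzC⟩ (hG.continuousOn.mono hCU).norm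
  have hmz : (F z).im ≤ (F m).im := by
    have := hm hzC
    simpa [hnorm] using this
  have hmax : ∀ w ∈ U, ‖G w‖ ≤ ‖G m‖ := by
    intro w hw
    by_cases hwC : w ∈ C
    · exact hm hwC
    · rw [hnorm, hnorm, Real.exp_le_exp]
      linarith [hoff w hw hwC]
  set S : Set ℂ := {w ∈ C | ‖G w‖ = ‖G m‖}
  have hSC : IsCompact S := by
    have : S = C ∩ (fun w => ‖G w‖) ⁻¹' {‖G m‖} := rfl
    rw [this]
    exact hC.of_isClosed_subset ((hG.continuousOn.mono hCU).norm.preimage_isClosed_of_isClosed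
      hC.isClosed isClosed_singleton) inter_subset_left
  have hSO : IsOpen S := by
    rw [isOpen_iff_mem_nhds]
    rintro w ⟨hwC, hw⟩
    have hwU := hU.mem_nhds (hCU hwC)
    have h1 : IsLocalMax (norm ∘ G) w := by
      filter_upwards [hwU] with v hv
      simpa [hw] using hmax v hv
    have h2 := Complex.norm_eventually_eq_of_isLocalMax
      (by filter_upwards [hwU] with v hv using hG.differentiableAt (hU.mem_nhds hv)) h1
    filter_upwards [h2, hwU] with v hv hvU
    have hve : ‖G v‖ = ‖G m‖ := hv.trans hw
    refine ⟨?_, hve⟩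
    by_contra hvC
    have h3 := hoff v hvU hvC
    rw [hnorm, hnorm, Real.exp_eq_exp] at hve
    linarith
  have hSne : S.Nonempty := ⟨m, hmC, rfl⟩
  have := IsClopen.eq_univ ⟨hSC.isClosed, hSO⟩ hSne
  rw [this] at hSC
  exact noncompact_univ ℂ hSC

/-! ### Half-plane regions -/

theorem isOpen_upperHalf : IsOpen upperHalf := isOpen_lt continuous_const Complex.continuous_im

theorem convex_upperHalf : Convex ℝ upperHalf := convex_halfSpace_im_gt 0

/-- For `M > 0` the exponential maps a convex half-strip onto this region. -/
theorem isPreconnected_upperHalf_outside (x M : ℝ) (hM : 0 ≤ M) :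
    IsPreconnected {z : ℂ | 0 < z.im ∧ M < ‖z - x‖} := by
  rcases hM.eq_or_lt with rfl | hM
  · convert convex_upperHalf.isPreconnected using 1
    ext z
    simp only [upperHalf, mem_ofPred_eq, norm_pos_iff, sub_ne_zero, and_iff_left_iff_imp]
    rintro h rfl
    simp at h
  · have hconv : Convex ℝ {w : ℂ | Real.log M < w.re ∧ 0 < w.im ∧ w.im < Real.pi} :=
      (convex_halfSpace_re_gt _).inter ((convex_halfSpace_im_gt _).inter (convex_halfSpace_im_lt _))
    have := hconv.isPreconnected.image (fun w => (x : ℂ) + Complex.exp w) (by fun_prop)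
    convert this using 1
    ext z
    simp only [mem_ofPred_eq, mem_image]
    constructor
    · rintro ⟨h1, h2⟩
      have hne : z - x ≠ 0 := by
        intro h
        rw [h, norm_zero] at h2
        linarith
      refine ⟨Complex.log (z - x), ⟨?_, ?_, ?_⟩, ?_⟩
      · rw [Complex.log_re]; exact Real.log_lt_log hM h2
      · rw [Complex.log_im]
        have h3 : 0 ≤ Complex.arg (z - x) := by rw [Complex.arg_nonneg_iff]; simpa using h1.le
        refine lt_of_le_of_ne h3 fun h4 => ?_
        have := (Complex.arg_eq_zero_iff.1 h4.symm).2
        simp at this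
        linarith
      · rw [Complex.log_im]
        refine lt_of_le_of_ne (Complex.arg_le_pi _) fun h4 => ?_
        have := (Complex.arg_eq_pi_iff.1 h4).2
        simp at this
        linarith
      · rw [Complex.exp_log hne]; ring
    · rintro ⟨w, ⟨h1, h2, h3⟩, rfl⟩
      constructor
      · simp only [Complex.add_im, Complex.ofReal_im, zero_add, Complex.exp_im]
        exact mul_pos (Real.exp_pos _) (Real.sin_pos_of_pos_of_lt_pi h2 h3)
      · rw [add_sub_cancel_left, Complex.norm_exp]
        exact (Real.log_lt_iff_lt_exp hM).1 h1

/-! ### Hydrodynamically normalized maps -/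

/-- `g` maps the domain `Ω`, a half-plane minus a bounded set, conformally onto the half-plane,
with `g z - z → 0` at infinity. -/
structure IsHydro (Ω : Set ℂ) (g : ℂ → ℂ) : Prop where
  isOpen : IsOpen Ω
  subset : Ω ⊆ upperHalf
  far : ∃ R : ℝ, ∀ z ∈ upperHalf, R < ‖z‖ → z ∈ Ω
  diff : DifferentiableOn ℂ g Ω
  bij : BijOn g Ω upperHalf
  asymp : ∀ ε > 0, ∃ R : ℝ, ∀ z ∈ Ω, R < ‖z‖ → ‖g z - z‖ < ε

namespace IsHydro

variable {Ω : Set ℂ} {g : ℂ → ℂ}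

theorem inv_diff (h : IsHydro Ω g) :
    DifferentiableOn ℂ (Function.invFunOn g Ω) upperHalf := by
  have := differentiableOn_invFunOn h.isOpen h.diff h.bij.injOn
  rwa [h.bij.image_eq] at this

theorem inv_mem (h : IsHydro Ω g) {w : ℂ} (hw : w ∈ upperHalf) :
    Function.invFunOn g Ω w ∈ Ω :=
  Function.invFunOn_mem (by rw [← h.bij.image_eq] at hw; exact hw)

theorem apply_inv (h : IsHydro Ω g) {w : ℂ} (hw : w ∈ upperHalf) :
    g (Function.invFunOn g Ω w) = w :=
  Function.invFunOn_eq (by rw [← h.bij.image_eq] at hw; exact hw)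

theorem inv_apply (h : IsHydro Ω g) {z : ℂ} (hz : z ∈ Ω) :
    Function.invFunOn g Ω (g z) = z :=
  h.bij.injOn.leftInvOn_invFunOn hz

theorem im_pos (h : IsHydro Ω g) {z : ℂ} (hz : z ∈ Ω) : 0 < (g z).im := h.bij.mapsTo hz

theorem isOpen_image (h : IsHydro Ω g) {V : Set ℂ} (hV : IsOpen V) (hVΩ : V ⊆ Ω) :
    IsOpen (g '' V) :=
  isOpen_image_of_injOn h.isOpen h.diff h.bij.injOn hV hVΩ

/-- This replaces a maximum principle that would need boundary values. The preimage of the connected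
set `{Im w > 0, ‖w - x‖ > M}` is connected and reaches far out; if it also contained a point inside
the arc it would cross the arc, where `‖g - x‖ ≤ M`. -/
theorem norm_sub_le_of_norm_sub_le_on_arc (h : IsHydro Ω g) {x ρ M : ℝ} (hM : 0 ≤ M)
    (hΩ : ∀ z ∈ upperHalf, ‖z - x‖ = ρ → z ∈ Ω ∧ ‖g z - x‖ ≤ M) {z : ℂ} (hz : z ∈ Ω)
    (hzρ : ‖z - x‖ ≤ ρ) : ‖g z - x‖ ≤ M := by
  by_contra! hlt
  have hρ : ‖z - x‖ < ρ := by
    refine lt_of_le_of_ne hzρ fun he => ?_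
    linarith [(hΩ z (h.subset hz) he).2]
  set S : Set ℂ := {w : ℂ | 0 < w.im ∧ M < ‖w - x‖}
  have hS : IsPreconnected S := isPreconnected_upperHalf_outside x M hM
  have hk : IsPreconnected (Function.invFunOn g Ω '' S) :=
    hS.image _ (h.inv_diff.continuousOn.mono fun w hw => hw.1)
  obtain ⟨R, hR⟩ := h.asymp 1 one_pos
  obtain ⟨R', hR'⟩ := h.far
  set T : ℝ := |R| + |R'| + M + |ρ| + 2
  set z' : ℂ := x + T * Complex.I
  have hT : 0 < T := by positivity
  have hz'n : ‖z' - x‖ = T := by simp [z', abs_of_pos hT]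
  have him : z'.im = T := by simp [z']
  have hz'T : T ≤ ‖z'‖ := by
    have := Complex.abs_im_le_norm z'
    rwa [him, abs_of_pos hT] at this
  have hz'Ω : z' ∈ Ω := hR' z' (by rw [upperHalf, mem_ofPred_eq, him]; exact hT) (by
    have := le_abs_self R'; have := abs_nonneg R; have := abs_nonneg ρ; simp only [T] at hz'T; linarith)
  have hgz' : ‖g z' - z'‖ < 1 := hR z' hz'Ω (by
    have := le_abs_self R; have := abs_nonneg R'; have := abs_nonneg ρ; simp only [T] at hz'T; linarith)
  have hgz'M : M < ‖g z' - x‖ := by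
    have h1 : ‖z' - x‖ ≤ ‖g z' - x‖ + ‖g z' - z'‖ := by
      rw [show z' - (x : ℂ) = (g z' - x) - (g z' - z') by ring]
      exact norm_sub_le _ _
    have := abs_nonneg R; have := abs_nonneg R'; have := abs_nonneg ρ
    simp only [T] at hz'n
    linarith
  obtain ⟨v, ⟨w, hw, rfl⟩, hv⟩ := hk {v | ‖v - x‖ < ρ} {v | ρ < ‖v - x‖}
    (isOpen_lt (by fun_prop) (by fun_prop)) (isOpen_lt (by fun_prop) (by fun_prop))
    (by
      rintro _ ⟨w, hw, rfl⟩
      rcases lt_trichotomy ‖Function.invFunOn g Ω w - x‖ ρ with h1 | h1 | h1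
      · exact Or.inl h1
      · have := (hΩ _ (h.subset (h.inv_mem hw.1)) h1).2
        rw [h.apply_inv hw.1] at this
        exact absurd this (not_le.2 hw.2)
      · exact Or.inr h1)
    ⟨z, ⟨g z, ⟨h.im_pos hz, hlt⟩, h.inv_apply hz⟩, hρ⟩
    ⟨z', ⟨g z', ⟨h.im_pos hz'Ω, hgz'M⟩, h.inv_apply hz'Ω⟩, by
      rw [mem_ofPred_eq, hz'n]
      have := abs_nonneg R; have := abs_nonneg R'; have := le_abs_self ρ
      simp only [T]; linarith⟩
  have hv1 := hv.1
  have hv2 := hv.2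
  rw [mem_ofPred_eq] at hv1 hv2
  linarith

theorem exists_norm_le_add_one (h : IsHydro Ω g) :
    ∃ R₀ : ℝ, 0 ≤ R₀ ∧ ∀ R ≥ R₀, ∀ z ∈ Ω, ‖z‖ ≤ R → ‖g z‖ ≤ R + 1 := by
  obtain ⟨R, hR⟩ := h.asymp 1 one_pos
  obtain ⟨R', hR'⟩ := h.far
  have h1 := le_abs_self R; have h2 := abs_nonneg R; have h3 := le_abs_self R'
  have h4 := abs_nonneg R'
  refine ⟨|R| + |R'| + 1, by positivity, fun ρ hρ z hz hzρ => ?_⟩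
  have := h.norm_sub_le_of_norm_sub_le_on_arc (x := 0) (ρ := ρ) (M := ρ + 1) (by linarith)
    (fun z hz hzn => by
      rw [Complex.ofReal_zero, sub_zero] at hzn
      have hzΩ := hR' z hz (by linarith)
      refine ⟨hzΩ, ?_⟩
      have h5 := hR z hzΩ (by linarith)
      rw [Complex.ofReal_zero, sub_zero]
      calc ‖g z‖ = ‖z + (g z - z)‖ := by congr 1; ring
        _ ≤ ‖z‖ + ‖g z - z‖ := norm_add_le _ _
        _ ≤ ρ + 1 := by linarith) hz (by simpa using hzρ)
  simpa using this

/-- The maximum principle for `g - id`. Off a compact set `Im (g z - z)` is small for one of two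
reasons: `z` is large, or `Im (g z)` is small while `Im z > 0`. -/
theorem im_le (h : IsHydro Ω g) {z : ℂ} (hz : z ∈ Ω) : (g z).im ≤ z.im := by
  have := im_nonpos_of_im_le_off_compact (F := fun z => g z - z) h.isOpen
    (h.diff.sub differentiableOn_id) (fun ε hε => ?_) z hz
  · simpa using this
  obtain ⟨R₀, hR₀, hbd⟩ := h.exists_norm_le_add_one
  obtain ⟨R, hR⟩ := h.asymp ε hε
  set R' := max R R₀
  refine ⟨Function.invFunOn g Ω '' ({w | ε ≤ w.im} ∩ Metric.closedBall 0 (R' + 1)) ∩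
    Metric.closedBall 0 R', ?_, ?_, ?_⟩
  · rintro _ ⟨⟨w, hw, rfl⟩, -⟩
    exact h.inv_mem (lt_of_lt_of_le hε hw.1)
  · refine IsCompact.inter_right ?_ Metric.isClosed_closedBall
    refine IsCompact.image_of_continuousOn ?_ (h.inv_diff.continuousOn.mono fun w hw =>
      lt_of_lt_of_le hε hw.1)
    exact (isCompact_closedBall _ _).inter_left (isClosed_le continuous_const Complex.continuous_im)
  · intro v hv hvC
    rw [Complex.sub_im]
    by_cases hvR : ‖v‖ ≤ R'
    · have h1 : ¬ ε ≤ (g v).im := fun h1 => hvC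
        ⟨⟨g v, ⟨h1, by simpa using hbd R' (le_max_right _ _) v hv hvR⟩, h.inv_apply hv⟩,
          by simpa using hvR⟩
      have : 0 < v.im := h.subset hv
      linarith
    · have h1 := hR v hv (lt_of_le_of_lt (le_max_left _ _) (not_le.1 hvR))
      have h2 := Complex.abs_im_le_norm (g v - v)
      rw [Complex.sub_im] at h2
      linarith [le_abs_self ((g v).im - v.im)]

/-! ### Bounds when the missing set lies in a half-disc -/

/-- Comparison with the map `z + r² / (z - x)` of the half-disc complement: on the arc `‖z - x‖ = r`
and on the real line its imaginary part vanishes, while `Im g > 0`. -/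
theorem im_sub_le (h : IsHydro Ω g) {x r : ℝ} (hr : 0 < r)
    (hΩ : ∀ z ∈ upperHalf, r < ‖z - x‖ → z ∈ Ω) {z : ℂ} (hz : z ∈ upperHalf)
    (hzr : r < ‖z - x‖) : z.im - (g z).im ≤ r ^ 2 * z.im / ‖z - x‖ ^ 2 := by
  set U : Set ℂ := {z | 0 < z.im ∧ r < ‖z - x‖}
  have hUo : IsOpen U := isOpen_upperHalf.inter
    (isOpen_lt continuous_const (by fun_prop : Continuous fun z : ℂ => ‖z - (x : ℂ)‖))
  have hUΩ : U ⊆ Ω := fun z hz => hΩ z hz.1 hz.2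
  have hne : ∀ z ∈ U, z - x ≠ 0 := fun z hz h0 => by
    have := hz.2
    rw [h0, norm_zero] at this
    linarith
  have hinv : ∀ z : ℂ, ((r : ℂ) ^ 2 / (z - x)).im = - (r ^ 2 * z.im / ‖z - x‖ ^ 2) := by
    intro z
    rw [← Complex.ofReal_pow, div_eq_mul_inv, Complex.im_ofReal_mul, Complex.inv_im,
      Complex.normSq_eq_norm_sq]
    simp
    ring
  have hFim : ∀ z : ℂ, (z - g z + r ^ 2 / (z - x)).im =
      z.im - (g z).im - r ^ 2 * z.im / ‖z - x‖ ^ 2 := by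
    intro z
    rw [Complex.add_im, hinv, Complex.sub_im]
    ring
  have := im_nonpos_of_im_le_off_compact (F := fun z => z - g z + r ^ 2 / (z - x)) hUo
    ((differentiableOn_id.sub (h.diff.mono hUΩ)).add
      ((differentiableOn_const _).div (differentiableOn_id.sub_const _) hne))
    (fun ε hε => ?_) z ⟨hz, hzr⟩
  · rw [hFim] at this
    linarith
  obtain ⟨R, hR⟩ := h.asymp ε hε
  -- The last inequality keeps the set off the arc, where the comparison term cancels `v.im`; where
  -- it fails, the bound `ε` follows from `Im (g v) > 0`.
  refine ⟨{v | ε ≤ v.im ∧ r ≤ ‖v - x‖ ∧ ε ≤ v.im * (1 - r ^ 2 / ‖v - x‖ ^ 2)} ∩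
    Metric.closedBall 0 R, ?_, ?_, ?_⟩
  · rintro v ⟨⟨h1, h2, h3⟩, -⟩
    have hv : 0 < v.im := lt_of_lt_of_le hε h1
    refine ⟨hv, lt_of_le_of_ne h2 fun h4 => ?_⟩
    rw [← h4, div_self (by positivity)] at h3
    simp at h3
    linarith
  · refine (isCompact_closedBall _ _).inter_left ?_
    have hc : IsClosed {v : ℂ | ε ≤ v.im ∧ r ≤ ‖v - x‖} :=
      (isClosed_le continuous_const Complex.continuous_im).inter
        (isClosed_le continuous_const (by fun_prop : Continuous fun z : ℂ => ‖z - (x : ℂ)‖))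
    have hcont : ContinuousOn (fun v : ℂ => v.im * (1 - r ^ 2 / ‖v - x‖ ^ 2))
        {v : ℂ | ε ≤ v.im ∧ r ≤ ‖v - x‖} := by
      refine Complex.continuous_im.continuousOn.mul (continuousOn_const.sub
        (continuousOn_const.div (by fun_prop) fun v hv => ?_))
      have : 0 < ‖v - x‖ := lt_of_lt_of_le hr hv.2
      positivity
    convert hcont.preimage_isClosed_of_isClosed hc (isClosed_Ici (a := ε)) using 1
    ext v
    simp [and_assoc]
  · intro v hv hvC
    have hvpos : 0 < v.im := hv.1
    have hnpos : 0 < ‖v - x‖ := hr.trans hv.2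
    rw [hFim]
    have hterm : 0 ≤ r ^ 2 * v.im / ‖v - x‖ ^ 2 := by positivity
    by_cases hvR : ‖v‖ ≤ R
    · have hgim := h.im_pos (hUΩ hv)
      have h1 : ¬ (ε ≤ v.im ∧ r ≤ ‖v - x‖ ∧ ε ≤ v.im * (1 - r ^ 2 / ‖v - x‖ ^ 2)) :=
        fun h1 => hvC ⟨h1, by simpa using hvR⟩
      by_cases h2 : ε ≤ v.im
      · have h3 : ¬ ε ≤ v.im * (1 - r ^ 2 / ‖v - x‖ ^ 2) := fun h3 => h1 ⟨h2, hv.2.le, h3⟩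
        have h4 : v.im * (1 - r ^ 2 / ‖v - x‖ ^ 2) = v.im - r ^ 2 * v.im / ‖v - x‖ ^ 2 := by ring
        linarith
      · linarith
    · have h1 := hR v (hUΩ hv) (not_le.1 hvR)
      have h2 := Complex.abs_im_le_norm (g v - v)
      rw [Complex.sub_im] at h2
      linarith [neg_abs_le ((g v).im - v.im)]


/-- On the disc of radius `y / 2` about `z` the imaginary part of `z - g z` rises by at most `6 r² y
/ d²`. Borel–Carathéodory makes this a norm bound on radius `y / 4`, and Cauchy's estimate divides
by `y / 4`: the height `y` cancels, so the bound is uniform up to the real line. -/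
theorem norm_deriv_sub_le (h : IsHydro Ω g) {x r : ℝ} (hr : 0 < r)
    (hΩ : ∀ z ∈ upperHalf, r < ‖z - x‖ → z ∈ Ω) {z : ℂ} (hz : z ∈ upperHalf)
    (hzr : 2 * r ≤ ‖z - x‖) : ‖deriv (fun z => z - g z) z‖ ≤ 48 * r ^ 2 / ‖z - x‖ ^ 2 := by
  set d := ‖z - x‖
  set y := z.im
  have hy : 0 < y := hz
  have hyd : y ≤ d := by
    have := Complex.abs_im_le_norm (z - x)
    rw [Complex.sub_im, Complex.ofReal_im, sub_zero, abs_of_pos hy] at this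
    exact this
  have hd : 0 < d := hy.trans_le hyd
  have hball : ∀ ζ ∈ Metric.ball (0 : ℂ) (y / 2), z + ζ ∈ upperHalf ∧ d / 2 < ‖z + ζ - x‖ ∧
      (z + ζ).im ≤ 3 * y / 2 := by
    intro ζ hζ
    rw [mem_ball_zero_iff] at hζ
    have h1 := (Complex.abs_im_le_norm ζ).trans_lt hζ
    rw [abs_lt] at h1
    refine ⟨?_, ?_, ?_⟩
    · change 0 < (z + ζ).im
      rw [Complex.add_im]; linarith [h1.1]
    · have : d ≤ ‖z + ζ - x‖ + ‖ζ‖ := by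
        have := norm_sub_le (z + ζ - x) ζ
        rwa [show z + ζ - x - ζ = z - x by ring] at this
      linarith
    · rw [Complex.add_im]; linarith [h1.2]
  have hmem : ∀ ζ ∈ Metric.ball (0 : ℂ) (y / 2), z + ζ ∈ Ω := fun ζ hζ =>
    hΩ _ (hball ζ hζ).1 (by linarith [(hball ζ hζ).2.1])
  set F : ℂ → ℂ := fun ζ => -Complex.I * ((z + ζ - g (z + ζ)) - (z - g z))
  have hFd : DifferentiableOn ℂ F (Metric.ball 0 (y / 2)) := by
    intro ζ hζ
    have h1 := h.diff.differentiableAt (h.isOpen.mem_nhds (hmem ζ hζ))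
    have h2 : DifferentiableAt ℂ (fun ζ => g (z + ζ)) ζ :=
      h1.comp ζ ((differentiableAt_const z).add differentiableAt_id)
    exact ((((((differentiableAt_const z).add differentiableAt_id).sub h2).sub_const _).const_mul
      _)).differentiableWithinAt
  have hFre : MapsTo F (Metric.ball 0 (y / 2)) {w | w.re ≤ 6 * r ^ 2 * y / d ^ 2} := by
    intro ζ hζ
    obtain ⟨h1, h2, h3⟩ := hball ζ hζ
    have h4 := h.im_sub_le hr hΩ h1 (by linarith)
    have h5 := h.im_le (hΩ z hz (by linarith))
    have h6 : r ^ 2 * (z + ζ).im / ‖z + ζ - x‖ ^ 2 ≤ r ^ 2 * (3 * y / 2) / (d / 2) ^ 2 := by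
      have : 0 < (z + ζ).im := h1
      gcongr
    have h7 : r ^ 2 * (3 * y / 2) / (d / 2) ^ 2 = 6 * r ^ 2 * y / d ^ 2 := by
      field_simp; ring
    have h8 : (F ζ).re = ((z + ζ).im - (g (z + ζ)).im) - (z.im - (g z).im) := by
      simp [F]
    rw [mem_ofPred_eq, h8]
    linarith
  have hM : 0 < 6 * r ^ 2 * y / d ^ 2 := by positivity
  have hsphere : ∀ ζ ∈ Metric.sphere (0 : ℂ) (y / 4), ‖F ζ‖ ≤ 12 * r ^ 2 * y / d ^ 2 := by
    intro ζ hζ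
    rw [mem_sphere_zero_iff_norm] at hζ
    have := Complex.borelCaratheodory_zero hM hFd hFre (by positivity : 0 < y / 2) (z := ζ)
      (by rw [mem_ball_zero_iff, hζ]; linarith) (by simp [F])
    rw [hζ] at this
    refine this.trans_eq ?_
    field_simp
    ring
  have hderiv := Complex.norm_deriv_le_of_forall_mem_sphere_norm_le (by positivity : 0 < y / 4)
    (DifferentiableOn.diffContOnCl (by
      rw [closure_ball _ (by positivity)]
      exact hFd.mono (Metric.closedBall_subset_ball (by linarith)))) hsphere
  have hFz : deriv F 0 = -Complex.I * deriv (fun z => z - g z) z := by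
    have h1 : DifferentiableAt ℂ (fun z => z - g z) z := differentiableAt_id.sub
      (h.diff.differentiableAt (h.isOpen.mem_nhds (hΩ z hz (by linarith))))
    have h2 : HasDerivAt (fun ζ : ℂ => z + ζ) 1 0 := (hasDerivAt_id (0 : ℂ)).const_add z
    have h3 : HasDerivAt (fun z => z - g z) (deriv (fun z => z - g z) z) (z + 0) := by
      rw [add_zero]; exact h1.hasDerivAt
    have h4 := ((HasDerivAt.comp 0 h3 h2).sub_const (z - g z)).const_mul (-Complex.I)
    rw [mul_one] at h4
    exact h4.deriv
  rw [hFz, norm_mul] at hderiv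
  simp only [norm_neg, Complex.norm_I, one_mul] at hderiv
  refine hderiv.trans_eq ?_
  field_simp
  ring

/-- Integrate the derivative bound up the vertical ray from `z`, at whose end `g z - z` vanishes.
Since `‖z + iτ - x‖² ≥ (d + τ)² / 2`, the integral is at most `96 r² / d ≤ 48 r`. -/
theorem norm_sub_self_le (h : IsHydro Ω g) {x r : ℝ} (hr : 0 < r)
    (hΩ : ∀ z ∈ upperHalf, r < ‖z - x‖ → z ∈ Ω) {z : ℂ} (hz : z ∈ upperHalf)
    (hzr : 2 * r ≤ ‖z - x‖) : ‖g z - z‖ ≤ 48 * r := by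
  set d := ‖z - x‖
  have hd : 0 < d := by linarith
  have hzim : 0 < z.im := hz
  have hline : ∀ τ : ℝ, 0 ≤ τ → z + τ * Complex.I ∈ upperHalf ∧
      (d + τ) ^ 2 / 2 ≤ ‖z + τ * Complex.I - x‖ ^ 2 ∧ 2 * r ≤ ‖z + τ * Complex.I - x‖ := by
    intro τ hτ
    have him : (z + τ * Complex.I).im = z.im + τ := by simp
    have hnorm : d ^ 2 + τ ^ 2 ≤ ‖z + τ * Complex.I - x‖ ^ 2 := by
      simp only [d]
      rw [← Complex.normSq_eq_norm_sq, ← Complex.normSq_eq_norm_sq, Complex.normSq_apply,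
        Complex.normSq_apply]
      simp
      nlinarith
    refine ⟨?_, ?_, ?_⟩
    · change 0 < (z + τ * Complex.I).im
      rw [him]; linarith
    · nlinarith [sq_nonneg (d - τ)]
    · refine hzr.trans (abs_le_of_sq_le_sq' ?_ (norm_nonneg _)).2
      nlinarith [sq_nonneg τ]
  have hbound : ∀ T : ℝ, 0 ≤ T →
      ‖(z + T * Complex.I - g (z + T * Complex.I)) - (z - g z)‖ ≤ 48 * r := by
    intro T hT
    have hder : ∀ τ : ℝ, 0 ≤ τ → HasDerivAt
        (fun τ : ℝ => (z + τ * Complex.I - g (z + τ * Complex.I)) - (z - g z))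
        (deriv (fun z => z - g z) (z + τ * Complex.I) * Complex.I) τ := by
      intro τ hτ
      have h1 : DifferentiableAt ℂ (fun z => z - g z) (z + τ * Complex.I) := differentiableAt_id.sub
        (h.diff.differentiableAt (h.isOpen.mem_nhds
          (hΩ _ (hline τ hτ).1 (by linarith [(hline τ hτ).2.2]))))
      have h2 : HasDerivAt (fun τ : ℝ => z + τ * Complex.I) Complex.I τ := by
        simpa using ((Complex.ofRealCLM.hasDerivAt (x := τ)).mul_const Complex.I).const_add z
      exact (h1.hasDerivAt.comp τ h2).sub_const _
    have hB : ∀ τ : ℝ, 0 ≤ τ → HasDerivAt (fun τ : ℝ => 96 * r ^ 2 * (1 / d - (d + τ)⁻¹))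
        (96 * r ^ 2 / (d + τ) ^ 2) τ := by
      intro τ hτ
      have h1 : HasDerivAt (fun τ : ℝ => d + τ) 1 τ := (hasDerivAt_id τ).const_add d
      have h2 := ((h1.inv (by positivity)).const_sub (1 / d)).const_mul (96 * r ^ 2)
      exact h2.congr_deriv (by ring)
    have := image_norm_le_of_norm_deriv_right_le_deriv_boundary' (a := 0) (b := T)
      (f := fun τ : ℝ => (z + τ * Complex.I - g (z + τ * Complex.I)) - (z - g z))
      (f' := fun τ => deriv (fun z => z - g z) (z + τ * Complex.I) * Complex.I)
      (B := fun τ : ℝ => 96 * r ^ 2 * (1 / d - (d + τ)⁻¹))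
      (B' := fun τ => 96 * r ^ 2 / (d + τ) ^ 2)
      (fun τ hτ => (hder τ hτ.1).continuousAt.continuousWithinAt)
      (fun τ hτ => (hder τ hτ.1).hasDerivWithinAt) (by simp)
      (fun τ hτ => (hB τ hτ.1).continuousAt.continuousWithinAt)
      (fun τ hτ => (hB τ hτ.1).hasDerivWithinAt)
      (fun τ hτ => by
        obtain ⟨h1, h2, h3⟩ := hline τ hτ.1
        rw [norm_mul, Complex.norm_I, mul_one]
        refine (h.norm_deriv_sub_le hr hΩ h1 h3).trans ?_
        have h4 : 0 < d + τ := by linarith [hτ.1]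
        calc 48 * r ^ 2 / ‖z + τ * Complex.I - x‖ ^ 2 ≤ 48 * r ^ 2 / ((d + τ) ^ 2 / 2) := by gcongr
          _ = 96 * r ^ 2 / (d + τ) ^ 2 := by field_simp; ring)
      (right_mem_Icc.2 hT)
    refine this.trans ?_
    have h5 : 0 ≤ (d + T)⁻¹ := by positivity
    calc 96 * r ^ 2 * (1 / d - (d + T)⁻¹) ≤ 96 * r ^ 2 * (1 / d) := by gcongr; linarith
      _ ≤ 96 * r ^ 2 * (1 / (2 * r)) := by gcongr
      _ = 48 * r := by field_simp; ring
  refine le_of_forall_pos_le_add fun ε hε => ?_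
  obtain ⟨R, hR⟩ := h.asymp ε hε
  set T := |R| + 1
  have hT : 0 ≤ T := by positivity
  obtain ⟨h1, h2, h3⟩ := hline T hT
  have h4 := hR (z + T * Complex.I) (hΩ _ h1 (by linarith)) (by
    have := Complex.abs_im_le_norm (z + T * Complex.I)
    have h5 : (z + T * Complex.I).im = z.im + T := by simp
    rw [h5] at this
    linarith [le_abs_self R, le_abs_self (z.im + T)])
  calc ‖g z - z‖ = ‖((z + T * Complex.I - g (z + T * Complex.I)) - (z - g z)) +
        (g (z + T * Complex.I) - (z + T * Complex.I))‖ := by congr 1; ring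
    _ ≤ 48 * r + ε := (norm_add_le _ _).trans (add_le_add (hbound T hT) h4.le)

/-- On the arc of radius `2r` the distance to `x` is at most `48r + 2r`, and this bound passes
inside the arc. -/
theorem norm_sub_le (h : IsHydro Ω g) {x r : ℝ} (hr : 0 < r)
    (hΩ : ∀ z ∈ upperHalf, r < ‖z - x‖ → z ∈ Ω) {z : ℂ} (hz : z ∈ Ω)
    (hzr : ‖z - x‖ ≤ 2 * r) : ‖g z - x‖ ≤ 50 * r := by
  refine h.norm_sub_le_of_norm_sub_le_on_arc (by positivity) (fun v hv hvn => ?_) hz hzr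
  refine ⟨hΩ v hv (by linarith), ?_⟩
  have := h.norm_sub_self_le hr hΩ hv hvn.ge
  calc ‖g v - x‖ = ‖(g v - v) + (v - x)‖ := by congr 1; ring
    _ ≤ 48 * r + 2 * r := (norm_add_le _ _).trans (add_le_add this hvn.le)
    _ = 50 * r := by ring

/-- Every `r > 0` is admissible when nothing is missing. Uniqueness of normalized maps follows by
composition with an inverse. -/
theorem eq_self (h : IsHydro upperHalf g) {z : ℂ} (hz : z ∈ upperHalf) : g z = z := by
  have hzim : 0 < z.im := hz
  have hnorm : z.im ≤ ‖z - (0 : ℝ)‖ := by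
    have := Complex.abs_im_le_norm z
    simp only [Complex.ofReal_zero, sub_zero]
    exact (le_abs_self _).trans this
  have : ‖g z - z‖ ≤ 0 := by
    refine le_of_forall_pos_le_add fun ε hε => ?_
    have hr : 0 < min (z.im / 2) (ε / 48) := by positivity
    have := h.norm_sub_self_le (x := 0) hr (fun z hz _ => hz) hz
      (by linarith [min_le_left (z.im / 2) (ε / 48)])
    linarith [min_le_right (z.im / 2) (ε / 48)]
  exact sub_eq_zero.1 (norm_le_zero_iff.1 this)

/-! ### Comparison of two normalized maps -/

theorem comp_inv {Ω' : Set ℂ} {g' : ℂ → ℂ} (h : IsHydro Ω g) (h' : IsHydro Ω' g')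
    (hsub : Ω' ⊆ Ω) : IsHydro (g '' Ω') (g' ∘ Function.invFunOn g Ω) := by
  obtain ⟨R₀, hR₀, hbd⟩ := h.exists_norm_le_add_one
  have hlarge : ∀ R : ℝ, ∀ z ∈ Ω, max R R₀ + 1 < ‖g z‖ → R < ‖z‖ := by
    intro R z hz hlt
    by_contra! hle
    linarith [hbd (max R R₀) (le_max_right _ _) z hz (hle.trans (le_max_left _ _))]
  refine ⟨h.isOpen_image h'.isOpen hsub, ?_, ?_, ?_, ⟨?_, ?_, ?_⟩, ?_⟩
  · rintro _ ⟨z, hz, rfl⟩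
    exact h.im_pos (hsub hz)
  · obtain ⟨R, hR⟩ := h'.far
    refine ⟨max R R₀ + 1, fun w hw hwR => ⟨Function.invFunOn g Ω w, ?_, h.apply_inv hw⟩⟩
    refine hR _ (h.subset (h.inv_mem hw)) (hlarge R _ (h.inv_mem hw) ?_)
    rwa [h.apply_inv hw]
  · refine h'.diff.comp (h.inv_diff.mono ?_) ?_
    · rintro _ ⟨z, hz, rfl⟩
      exact h.im_pos (hsub hz)
    · rintro _ ⟨z, hz, rfl⟩
      rwa [h.inv_apply (hsub hz)]
  · rintro _ ⟨z, hz, rfl⟩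
    rw [Function.comp_apply, h.inv_apply (hsub hz)]
    exact h'.im_pos hz
  · rintro _ ⟨z, hz, rfl⟩ _ ⟨v, hv, rfl⟩ heq
    rw [Function.comp_apply, Function.comp_apply, h.inv_apply (hsub hz), h.inv_apply (hsub hv)] at heq
    rw [h'.bij.injOn hz hv heq]
  · intro w hw
    obtain ⟨z, hz, rfl⟩ := h'.bij.surjOn hw
    exact ⟨g z, ⟨z, hz, rfl⟩, by rw [Function.comp_apply, h.inv_apply (hsub hz)]⟩
  · intro ε hε
    obtain ⟨R, hR⟩ := h.asymp (ε / 2) (by positivity)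
    obtain ⟨R', hR'⟩ := h'.asymp (ε / 2) (by positivity)
    refine ⟨max (max R R') R₀ + 1, ?_⟩
    rintro _ ⟨z, hz, rfl⟩ hlt
    have hlt' := hlarge _ z (hsub hz) hlt
    have h1 := hR z (hsub hz) ((le_max_left _ _).trans_lt hlt')
    have h2 := hR' z hz ((le_max_right _ _).trans_lt hlt')
    rw [Function.comp_apply, h.inv_apply (hsub hz)]
    calc ‖g' z - g z‖ = ‖(g' z - z) - (g z - z)‖ := by congr 1; ring
      _ ≤ ‖g' z - z‖ + ‖g z - z‖ := _root_.norm_sub_le _ _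
      _ < ε := by linarith

theorem eqOn {g' : ℂ → ℂ} (h : IsHydro Ω g) (h' : IsHydro Ω g') : EqOn g g' Ω := by
  have hc := h.comp_inv h' subset_rfl
  rw [h.bij.image_eq] at hc
  intro z hz
  have := hc.eq_self (h.im_pos hz)
  rw [Function.comp_apply, h.inv_apply hz] at this
  exact this.symm

/-- If the image of the smaller domain only misses points near `x`, the capacities are close. -/
theorem capacity_le {Ω' : Set ℂ} {g' : ℂ → ℂ} (h : IsHydro Ω g) (h' : IsHydro Ω' g')
    (hsub : Ω' ⊆ Ω) {c c' : ℝ}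
    (hc : Tendsto (fun y : ℝ => y * (y - (g (y * Complex.I)).im)) atTop (𝓝 c))
    (hc' : Tendsto (fun y : ℝ => y * (y - (g' (y * Complex.I)).im)) atTop (𝓝 c')) {x r : ℝ}
    (hr : 0 < r) (hΩ : ∀ w ∈ upperHalf, r < ‖w - x‖ → w ∈ g '' Ω') :
    c ≤ c' ∧ c' ≤ c + r ^ 2 := by
  have hcomp := h.comp_inv h' hsub
  have hdiff : Tendsto (fun y : ℝ => y * ((g (y * Complex.I)).im - (g' (y * Complex.I)).im)) atTop
      (𝓝 (c' - c)) := by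
    refine (hc'.sub hc).congr fun y => ?_
    ring
  -- Since `Im g(iy) ~ y`, the half-disc bound at `w = g(iy)`, multiplied by `y`, is at most `r² y /
  -- Im w`, which tends to `r²`.
  have hquot : Tendsto (fun y : ℝ => (g (y * Complex.I)).im / y) atTop (𝓝 1) := by
    have h1 : Tendsto (fun y : ℝ => 1 - y * (y - (g (y * Complex.I)).im) * (y⁻¹ * y⁻¹)) atTop
        (𝓝 (1 - c * (0 * 0))) :=
      tendsto_const_nhds.sub (hc.mul (tendsto_inv_atTop_zero.mul tendsto_inv_atTop_zero))
    rw [mul_zero, mul_zero, sub_zero] at h1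
    refine h1.congr' ?_
    filter_upwards [eventually_gt_atTop 0] with y hy
    field_simp
    ring
  have hmem : ∀ᶠ y : ℝ in atTop, (y : ℂ) * Complex.I ∈ Ω' ∧ 0 < y := by
    obtain ⟨R, hR⟩ := h'.far
    filter_upwards [eventually_gt_atTop R, eventually_gt_atTop 0] with y hy hy0
    refine ⟨hR _ ?_ ?_, hy0⟩
    · change 0 < ((y : ℂ) * Complex.I).im
      simpa using hy0
    · simpa [abs_of_pos hy0] using hy
  have him : ∀ᶠ y : ℝ in atTop, r < (g (y * Complex.I)).im := by
    have h2 : Tendsto (fun y : ℝ => (g (y * Complex.I)).im / y * y) atTop atTop :=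
      hquot.pos_mul_atTop one_pos tendsto_id
    filter_upwards [h2.eventually_gt_atTop r, eventually_gt_atTop 0] with y hy hy0
    rwa [div_mul_cancel₀ _ hy0.ne'] at hy
  constructor
  · refine sub_nonneg.1 (ge_of_tendsto hdiff ?_)
    filter_upwards [hmem] with y hy
    have := hcomp.im_le ⟨_, hy.1, rfl⟩
    rw [Function.comp_apply, h.inv_apply (hsub hy.1)] at this
    exact mul_nonneg hy.2.le (by linarith)
  · have hlim : Tendsto (fun y : ℝ => r ^ 2 * ((g (y * Complex.I)).im / y)⁻¹) atTop
        (𝓝 (r ^ 2 * 1⁻¹)) := (hquot.inv₀ one_ne_zero).const_mul _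
    rw [inv_one, mul_one] at hlim
    have := le_of_tendsto_of_tendsto hdiff hlim ?_
    · linarith
    filter_upwards [hmem, him] with y hy hyr
    set w := g (y * Complex.I)
    have hwpos : 0 < w.im := hr.trans hyr
    have hwx : w.im ≤ ‖w - x‖ := by
      have := Complex.abs_im_le_norm (w - x)
      rw [Complex.sub_im, Complex.ofReal_im, sub_zero] at this
      exact (le_abs_self _).trans this
    have h3 := hcomp.im_sub_le hr hΩ hwpos (hyr.trans_le hwx)
    rw [Function.comp_apply, h.inv_apply (hsub hy.1)] at h3
    have h4 : r ^ 2 * w.im / ‖w - x‖ ^ 2 ≤ r ^ 2 * w.im / w.im ^ 2 := by gcongr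
    have h5 := mul_le_mul_of_nonneg_left (h3.trans h4) hy.2.le
    refine h5.trans_eq ?_
    have := hy.2
    field_simp

end IsHydro

/-! ### The length-area estimate -/

open MeasureTheory in
-- In polar coordinates this is the integral of `2πr / (r² + ε²)`. The area grows like `log (1/ε)`;
-- so do radial lengths in the same metric, and therefore length squared outgrows area.
theorem lintegral_ball_inv_sq_add_sq_le (p : ℂ) {ε R : ℝ} (hε : 0 < ε) (hR : 0 < R) :
    ∫⁻ z in Metric.ball p R, ENNReal.ofReal (1 / (‖z - p‖ ^ 2 + ε ^ 2)) ≤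
      ENNReal.ofReal (Real.pi * Real.log ((R ^ 2 + ε ^ 2) / ε ^ 2)) := by
  set G : ℝ → ENNReal := (Iio R).indicator fun r => ENNReal.ofReal (1 / (r ^ 2 + ε ^ 2))
  have h1 : ∫⁻ z in Metric.ball p R, ENNReal.ofReal (1 / (‖z - p‖ ^ 2 + ε ^ 2)) =
      ∫⁻ z : ℂ, G ‖z - p‖ := by
    rw [← lintegral_indicator Metric.isOpen_ball.measurableSet]
    congr 1
    ext z
    by_cases hz : z ∈ Metric.ball p R
    · have hz' : ‖z - p‖ ∈ Iio R := by rwa [mem_Iio, ← dist_eq_norm]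
      simp only [G]
      rw [indicator_of_mem hz, indicator_of_mem hz']
    · have hz' : ‖z - p‖ ∉ Iio R := by rwa [mem_Iio, ← dist_eq_norm]
      simp only [G]
      rw [indicator_of_notMem hz, indicator_of_notMem hz']
  have h2 : ∫⁻ z : ℂ, G ‖z - p‖ = ∫⁻ z : ℂ, G ‖z‖ :=
    lintegral_sub_right_eq_self (fun z : ℂ => G ‖z‖) p
  have h3 : ∫⁻ z : ℂ, G ‖z‖ =
      ∫⁻ q : ℝ × ℝ in Ioi 0 ×ˢ Ioo (-Real.pi) Real.pi, ENNReal.ofReal q.1 * G q.1 := by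
    rw [← Complex.lintegral_comp_polarCoord_symm, polarCoord_target]
    refine setLIntegral_congr_fun (measurableSet_Ioi.prod measurableSet_Ioo) fun q hq => ?_
    have : 0 < q.1 := hq.1
    simp only [Complex.norm_polarCoord_symm, abs_of_pos this, smul_eq_mul]
  have h4 : ∫⁻ q : ℝ × ℝ in Ioi 0 ×ˢ Ioo (-Real.pi) Real.pi, ENNReal.ofReal q.1 * G q.1 ≤
      (∫⁻ r : ℝ in Ioi 0, ENNReal.ofReal r * G r) * ENNReal.ofReal (2 * Real.pi) := by
    rw [Measure.volume_eq_prod, ← Measure.prod_restrict]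
    refine (lintegral_prod_le _).trans ?_
    have hm : Measurable fun r : ℝ => ENNReal.ofReal r * G r :=
      ENNReal.measurable_ofReal.mul (Measurable.indicator (by fun_prop) measurableSet_Iio)
    simp only [lintegral_const, Measure.restrict_apply, MeasurableSet.univ, univ_inter,
      Real.volume_Ioo]
    rw [lintegral_mul_const _ hm]
    gcongr
    linarith
  have h5 : ∫⁻ r : ℝ in Ioi 0, ENNReal.ofReal r * G r =
      ENNReal.ofReal (Real.log ((R ^ 2 + ε ^ 2) / ε ^ 2) / 2) := by
    have h6 : ∫⁻ r : ℝ in Ioi 0, ENNReal.ofReal r * G r =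
        ∫⁻ r : ℝ in Ioc 0 R, ENNReal.ofReal (r / (r ^ 2 + ε ^ 2)) := by
      rw [← restrict_Ioo_eq_restrict_Ioc, ← Ioi_inter_Iio, inter_comm,
        ← Measure.restrict_restrict measurableSet_Iio,
        ← lintegral_indicator measurableSet_Iio]
      refine setLIntegral_congr_fun measurableSet_Ioi fun r hr => ?_
      have hr0 : (0 : ℝ) < r := hr
      by_cases hrR : r ∈ Iio R
      · simp only [G]
        rw [indicator_of_mem hrR, indicator_of_mem hrR, ← ENNReal.ofReal_mul hr0.le]
        congr 1
        ring
      · simp only [G]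
        rw [indicator_of_notMem hrR, indicator_of_notMem hrR, mul_zero]
    have hcont : Continuous fun r : ℝ => r / (r ^ 2 + ε ^ 2) :=
      continuous_id.div (by fun_prop) fun r => by positivity
    rw [h6, ← ofReal_integral_eq_lintegral_ofReal
      ((hcont.intervalIntegrable 0 R).1)]
    · rw [← intervalIntegral.integral_of_le hR.le]
      congr 1
      have hd : ∀ r ∈ uIcc 0 R, HasDerivAt (fun r : ℝ => Real.log (r ^ 2 + ε ^ 2) / 2)
          (r / (r ^ 2 + ε ^ 2)) r := by
        intro r _
        have h7 : HasDerivAt (fun r : ℝ => r ^ 2 + ε ^ 2) (2 * r) r := by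
          simpa using (hasDerivAt_pow 2 r).add_const (ε ^ 2)
        refine ((h7.log (by positivity)).div_const 2).congr_deriv ?_
        ring
      rw [intervalIntegral.integral_eq_sub_of_hasDerivAt hd (hcont.intervalIntegrable 0 R),
        Real.log_div (by positivity) (by positivity)]
      simp
      ring
    · filter_upwards [ae_restrict_mem measurableSet_Ioc] with r hr
      have := hr.1
      positivity
  rw [h1, h2, h3]
  refine h4.trans_eq ?_
  rw [h5, ← ENNReal.ofReal_mul']
  · congr 1; ring
  · positivity

theorem det_toSpanSingleton_restrictScalars (a : ℂ) :
    ((ContinuousLinearMap.toSpanSingleton ℂ a).restrictScalars ℝ).det = ‖a‖ ^ 2 := by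
  rw [← Complex.normSq_eq_norm_sq, ← Algebra.norm_complex_apply, Algebra.norm_apply]
  change LinearMap.det _ = _
  congr 1
  ext
  simp [mul_comm]

/-- One-dimensional length estimate along a straight segment. -/
theorem sq_le_mul_integral_sq {f : ℂ → ℂ} {w₀ e p : ℂ} {L l ε : ℝ} (hε : 0 < ε) (hL : 0 < L)
    (hl : 0 ≤ l) (he : ‖e‖ = 1)
    (hf : ∀ τ ∈ Icc 0 l, DifferentiableAt ℂ f (w₀ + τ * e))
    (hint : ContinuousOn (fun τ : ℝ => ‖deriv f (w₀ + τ * e)‖ ^ 2 /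
      (‖f (w₀ + τ * e) - p‖ ^ 2 + ε ^ 2)) (Icc 0 l))
    (hlog : L ≤ Real.log (‖f (w₀ + l * e) - p‖ ^ 2 + ε ^ 2) / 2 -
      Real.log (‖f w₀ - p‖ ^ 2 + ε ^ 2) / 2) :
    L ^ 2 ≤ l * ∫ τ in (0 : ℝ)..l, ‖deriv f (w₀ + τ * e)‖ ^ 2 /
      (‖f (w₀ + τ * e) - p‖ ^ 2 + ε ^ 2) := by
  have hlpos : 0 < l := by
    refine lt_of_le_of_ne hl fun h0 => ?_
    rw [← h0] at hlog
    simp at hlog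
    linarith
  set S : ℝ → ℝ := fun τ => ‖deriv f (w₀ + τ * e)‖ ^ 2 / (‖f (w₀ + τ * e) - p‖ ^ 2 + ε ^ 2)
  set φ : ℝ → ℝ := fun τ => Real.log (‖f (w₀ + τ * e) - p‖ ^ 2 + ε ^ 2) / 2
  -- The inequality `AB/D ≤ lam/2 + S/(2 lam)` stands in for Cauchy–Schwarz; with `lam = L / l`
  -- integration gives `L ≤ L/2 + l ∫S / (2L)`.
  set lam : ℝ := L / l
  have hlam : 0 < lam := by positivity
  have hder : ∀ τ ∈ Icc 0 l, ∃ φ', HasDerivAt φ φ' τ ∧ φ' ≤ lam / 2 + S τ / (2 * lam) := by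
    intro τ hτ
    have h1 : HasDerivAt (fun τ : ℝ => w₀ + τ * e) e τ := by
      simpa using ((Complex.ofRealCLM.hasDerivAt (x := τ)).mul_const e).const_add w₀
    have h2 := (((hf τ hτ).hasDerivAt.comp τ h1).sub_const p).norm_sq
    have h3 := ((h2.add_const (ε ^ 2)).log (by positivity)).div_const 2
    refine ⟨_, h3, ?_⟩
    set D := ‖f (w₀ + τ * e) - p‖ ^ 2 + ε ^ 2
    have hD : 0 < D := by positivity
    have h4 : inner ℝ (f (w₀ + τ * e) - p) (deriv f (w₀ + τ * e) * e) ≤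
        ‖f (w₀ + τ * e) - p‖ * ‖deriv f (w₀ + τ * e)‖ := by
      refine (real_inner_le_norm _ _).trans_eq ?_
      rw [norm_mul, he, mul_one]
    set A := ‖f (w₀ + τ * e) - p‖
    set B := ‖deriv f (w₀ + τ * e)‖
    have hA : A ^ 2 ≤ D := by simp only [D]; nlinarith [sq_nonneg ε]
    have h5 : A * B / D ≤ lam / 2 + S τ / (2 * lam) := by
      have hS : S τ = B ^ 2 / D := rfl
      rw [hS, div_le_iff₀ hD]
      have h6 : (lam / 2 + B ^ 2 / D / (2 * lam)) * D = (lam ^ 2 * D + B ^ 2) / (2 * lam) := by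
        field_simp
      rw [h6, le_div_iff₀ (by positivity)]
      nlinarith [sq_nonneg (lam * A - B), sq_nonneg lam, mul_le_mul_of_nonneg_left hA (sq_nonneg lam)]
    refine le_trans ?_ h5
    change 2 * inner ℝ (f (w₀ + τ * e) - p) (deriv f (w₀ + τ * e) * e) / D / 2 ≤ _
    rw [mul_div_assoc, mul_div_cancel_left₀ _ (two_ne_zero)]
    gcongr
  choose! φ' hφ' hφle using hder
  have hSint : IntervalIntegrable S MeasureTheory.volume 0 l :=
    ContinuousOn.intervalIntegrable (by rwa [uIcc_of_le hl])
  have hmain : φ l - φ 0 ≤ ∫ τ in (0 : ℝ)..l, (lam / 2 + S τ / (2 * lam)) := by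
    refine intervalIntegral.sub_le_integral_of_hasDeriv_right_of_le hl
      (g' := φ') ?_ ?_ ?_ ?_
    · exact fun τ hτ => (hφ' τ hτ).continuousAt.continuousWithinAt
    · exact fun τ hτ => (hφ' τ (Ioo_subset_Icc_self hτ)).hasDerivWithinAt
    · refine ContinuousOn.integrableOn_Icc ?_
      exact continuousOn_const.add (hint.div_const _)
    · exact fun τ hτ => hφle τ (Ioo_subset_Icc_self hτ)
  rw [intervalIntegral.integral_add (by simp) (hSint.div_const _),
    intervalIntegral.integral_const, intervalIntegral.integral_div] at hmain
  have hφ0 : φ 0 = Real.log (‖f w₀ - p‖ ^ 2 + ε ^ 2) / 2 := by simp [φ]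
  rw [hφ0] at hmain
  have h7 := hlog.trans hmain
  rw [smul_eq_mul, sub_zero] at h7
  have h8 : l * (lam / 2) = L / 2 := by simp only [lam]; field_simp
  have h9 : ∀ I : ℝ, I / (2 * lam) = l * I / (2 * L) := by intro I; simp only [lam]; field_simp
  rw [h8, h9] at h7
  have h10 : L / 2 ≤ l * (∫ τ in (0 : ℝ)..l, S τ) / (2 * L) := by linarith
  rw [le_div_iff₀ (by positivity)] at h10
  nlinarith

open MeasureTheory in
-- From a point of `W` a vertical segment runs up to the top of the box, or a horizontal one to its
-- right side, and the logarithmic potential gains at least `L` along it. So each such line carries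
-- at least `L² / (2M)` of the pulled-back area. As `W` is connected, every coordinate between those
-- of `a` and `b` is met; Fubini and injectivity of `f` then compare the total with the area of a
-- ball.
theorem length_area_estimate {f : ℂ → ℂ} (hf : DifferentiableOn ℂ f upperHalf)
    (hinj : InjOn f upperHalf) {p : ℂ} {ε M R L : ℝ} (hε : 0 < ε) (hM : 0 < M) (hR : 0 < R)
    (hL : 0 < L) (hbd : ∀ w ∈ upperHalf, |w.re| ≤ M → w.im ≤ M → ‖f w - p‖ < R)
    {W : Set ℂ} (hW : IsPreconnected W) (hWH : ∀ w ∈ W, 0 < w.im ∧ w.im < M ∧ |w.re| < M)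
    (hWL : ∀ w ∈ W, ∀ v ∈ upperHalf, |v.re| ≤ M → v.im ≤ M → (v.re = M ∨ v.im = M) →
      L ≤ Real.log (‖f v - p‖ ^ 2 + ε ^ 2) / 2 - Real.log (‖f w - p‖ ^ 2 + ε ^ 2) / 2)
    {a b : ℂ} (ha : a ∈ W) (hb : b ∈ W) :
    |a.re - b.re| * (L ^ 2 / (2 * M)) ≤ Real.pi * Real.log ((R ^ 2 + ε ^ 2) / ε ^ 2) ∧
      |a.im - b.im| * (L ^ 2 / (2 * M)) ≤ Real.pi * Real.log ((R ^ 2 + ε ^ 2) / ε ^ 2) := by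
  set Q : Set ℂ := {w | |w.re| ≤ M ∧ 0 < w.im ∧ w.im ≤ M}
  have hQH : Q ⊆ upperHalf := fun w hw => hw.2.1
  have hQm : MeasurableSet Q :=
    (isClosed_le (by fun_prop : Continuous fun w : ℂ => |w.re|) continuous_const).measurableSet.inter
      ((isOpen_lt continuous_const Complex.continuous_im).measurableSet.inter
        (isClosed_le Complex.continuous_im continuous_const).measurableSet)
  have hda : ∀ w ∈ upperHalf, DifferentiableAt ℂ f w := fun w hw =>
    hf.differentiableAt (isOpen_upperHalf.mem_nhds hw)
  set σ : ℂ → ℝ := fun w => ‖deriv f w‖ ^ 2 / (‖f w - p‖ ^ 2 + ε ^ 2)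
  have hσ0 : ∀ w, 0 ≤ σ w := fun w => by positivity
  have hσ : ContinuousOn σ upperHalf := by
    refine ContinuousOn.div ?_ ?_ fun w _ => by positivity
    · exact ((hf.deriv isOpen_upperHalf).continuousOn.norm).pow 2
    · exact ((hf.continuousOn.sub continuousOn_const).norm.pow 2).add continuousOn_const
  set S : ℂ → ENNReal := Q.indicator fun w => ENNReal.ofReal (σ w)
  have hSm : Measurable S := by
    classical
    have : S = Q.piecewise (fun w => ENNReal.ofReal (σ w)) (fun _ => 0) := by
      ext w
      by_cases hw : w ∈ Q <;> simp [S, hw]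
    rw [this]
    exact ContinuousOn.measurable_piecewise
      (ENNReal.continuous_ofReal.comp_continuousOn (hσ.mono hQH)) continuousOn_const hQm
  have hE : ∫⁻ w, S w ≤ ENNReal.ofReal (Real.pi * Real.log ((R ^ 2 + ε ^ 2) / ε ^ 2)) := by
    refine le_trans (le_of_eq ?_) ((lintegral_mono_set (μ := volume) (s := f '' Q) ?_).trans
      (lintegral_ball_inv_sq_add_sq_le p hε hR))
    · rw [lintegral_indicator hQm, lintegral_image_eq_lintegral_abs_det_fderiv_mul volume hQm
        (f' := fun w => (ContinuousLinearMap.toSpanSingleton ℂ (deriv f w)).restrictScalars ℝ)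
        (fun w hw => ((hda w (hQH hw)).hasDerivAt.hasFDerivAt.restrictScalars ℝ).hasFDerivWithinAt)
        (hinj.mono hQH)]
      refine setLIntegral_congr_fun hQm fun w _ => ?_
      simp only [det_toSpanSingleton_restrictScalars]
      rw [abs_of_nonneg (by positivity), ← ENNReal.ofReal_mul (by positivity)]
      congr 1
      simp only [σ]
      ring
    · rintro _ ⟨w, hw, rfl⟩
      rw [Metric.mem_ball, dist_eq_norm]
      exact hbd w (hQH hw) hw.1 hw.2.2
  have hline : ∀ v ∈ W, ∀ e : ℂ, ∀ l : ℝ, ‖e‖ = 1 → 0 ≤ l → l ≤ 2 * M →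
      (∀ τ ∈ Icc 0 l, v + τ * e ∈ Q) → ((v + l * e).re = M ∨ (v + l * e).im = M) →
      ENNReal.ofReal (L ^ 2 / (2 * M)) ≤ ∫⁻ τ : ℝ, S (v + τ * e) := by
    intro v hv e l he hl hlM hQl hend
    have hcont : ContinuousOn (fun τ : ℝ => σ (v + τ * e)) (Icc 0 l) :=
      hσ.comp (by fun_prop) fun τ hτ => hQH (hQl τ hτ)
    have hlend := hQl l (right_mem_Icc.2 hl)
    have h1 := sq_le_mul_integral_sq (f := f) (w₀ := v) (e := e) (p := p) hε hL hl he
      (fun τ hτ => hda _ (hQH (hQl τ hτ))) hcont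
      (hWL v hv _ (hQH hlend) hlend.1 hlend.2.2 hend)
    have h2 : 0 ≤ ∫ τ in (0 : ℝ)..l, σ (v + τ * e) :=
      intervalIntegral.integral_nonneg hl fun τ _ => hσ0 _
    have h3 : L ^ 2 / (2 * M) ≤ ∫ τ in (0 : ℝ)..l, σ (v + τ * e) := by
      rw [div_le_iff₀ (by positivity), mul_comm]
      exact h1.trans (mul_le_mul_of_nonneg_right hlM h2)
    refine (ENNReal.ofReal_le_ofReal h3).trans ?_
    rw [intervalIntegral.integral_of_le hl, ofReal_integral_eq_lintegral_ofReal
      (hcont.integrableOn_Icc.mono_set Ioc_subset_Icc_self)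
      (Eventually.of_forall fun τ => hσ0 _)]
    refine le_trans (le_of_eq ?_) (setLIntegral_le_lintegral (Ioc 0 l) _)
    refine setLIntegral_congr_fun measurableSet_Ioc fun τ hτ => ?_
    simp only [S]
    rw [indicator_of_mem (hQl τ (Ioc_subset_Icc_self hτ))]
  have hA0 : 0 ≤ Real.pi * Real.log ((R ^ 2 + ε ^ 2) / ε ^ 2) := by
    refine mul_nonneg Real.pi_pos.le (Real.log_nonneg ?_)
    rw [le_div_iff₀ (by positivity)]
    nlinarith [sq_nonneg R]
  have hfub : ∫⁻ w, S w = ∫⁻ x : ℝ, ∫⁻ y : ℝ, S ⟨x, y⟩ := by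
    rw [← (Complex.volume_preserving_equiv_real_prod.symm).lintegral_comp_emb
      Complex.measurableEquivRealProd.symm.measurableEmbedding, Measure.volume_eq_prod,
      lintegral_prod (fun q => S (Complex.measurableEquivRealProd.symm q)) (hSm.comp Complex.measurableEquivRealProd.symm.measurable).aemeasurable]
    rfl
  have hfub' : ∫⁻ w, S w = ∫⁻ y : ℝ, ∫⁻ x : ℝ, S ⟨x, y⟩ := by
    rw [← (Complex.volume_preserving_equiv_real_prod.symm).lintegral_comp_emb
      Complex.measurableEquivRealProd.symm.measurableEmbedding, Measure.volume_eq_prod,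
      lintegral_prod_symm (fun q => S (Complex.measurableEquivRealProd.symm q)) (hSm.comp Complex.measurableEquivRealProd.symm.measurable).aemeasurable]
    rfl
  have hfin : ∀ (u v : ℝ) (Φ : ℝ → ENNReal),
      (∀ x ∈ uIcc u v, ENNReal.ofReal (L ^ 2 / (2 * M)) ≤ Φ x) → ∫⁻ x, Φ x = ∫⁻ w, S w →
      |u - v| * (L ^ 2 / (2 * M)) ≤ Real.pi * Real.log ((R ^ 2 + ε ^ 2) / ε ^ 2) := by
    intro u v Φ hΦ hΦS
    rw [← ENNReal.ofReal_le_ofReal_iff hA0]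
    refine le_trans ?_ hE
    rw [← hΦS]
    refine le_trans ?_ (setLIntegral_le_lintegral (uIcc u v) _)
    refine le_trans ?_ (setLIntegral_mono' measurableSet_uIcc hΦ)
    rw [setLIntegral_const, Real.volume_interval, mul_comm, ENNReal.ofReal_mul (by positivity),
      abs_sub_comm]
  constructor
  · refine hfin a.re b.re _ (fun x hx => ?_) hfub.symm
    have hconn := hW.image Complex.re Complex.continuous_re.continuousOn
    obtain ⟨v, hv, rfl⟩ := hconn.ordConnected.uIcc_subset ⟨a, ha, rfl⟩ ⟨b, hb, rfl⟩ hx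
    obtain ⟨h1, h2, h3⟩ := hWH v hv
    refine (hline v hv Complex.I (M - v.im) Complex.norm_I (by linarith) (by linarith)
      (fun τ hτ => ?_) (Or.inr (by simp))).trans_eq ?_
    · obtain ⟨h4, h5⟩ := hτ
      refine ⟨by simpa using h3.le, ?_, ?_⟩
      · simp; linarith
      · simp; linarith
    · rw [← lintegral_add_left_eq_self (fun y : ℝ => S ⟨v.re, y⟩) v.im]
      congr 1
      ext τ
      congr 1
      apply Complex.ext <;> simp
  · refine hfin a.im b.im _ (fun y hy => ?_) hfub'.symm
    have hconn := hW.image Complex.im Complex.continuous_im.continuousOn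
    obtain ⟨v, hv, rfl⟩ := hconn.ordConnected.uIcc_subset ⟨a, ha, rfl⟩ ⟨b, hb, rfl⟩ hy
    obtain ⟨h1, h2, h3⟩ := hWH v hv
    have h3' := abs_lt.1 h3
    refine (hline v hv 1 (M - v.re) norm_one (by linarith) (by linarith)
      (fun τ hτ => ?_) (Or.inl (by simp))).trans_eq ?_
    · obtain ⟨h4, h5⟩ := hτ
      refine ⟨?_, ?_, ?_⟩
      · rw [abs_le]; constructor <;> simp <;> linarith
      · simp; linarith
      · simp; linarith
    · rw [← lintegral_add_left_eq_self (fun x : ℝ => S ⟨x, v.im⟩) v.re]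
      congr 1
      ext τ
      congr 1
      apply Complex.ext <;> simp

/-- Small connected sets near a point have small images, uniformly over all normalized maps
with given bounds. -/
theorem exists_small_image (r η : ℝ) (hr : 1 ≤ r) (hη : 0 < η) :
    ∃ ε > 0, ∀ (Ω : Set ℂ) (g : ℂ → ℂ) (p : ℂ), IsHydro Ω g →
      (∀ z ∈ upperHalf, r < ‖z‖ → z ∈ Ω) → ‖p‖ ≤ r →
      ∀ V ⊆ Ω ∩ Metric.ball p ε, IsPreconnected V → ∀ a ∈ V, ∀ b ∈ V, ‖g a - g b‖ ≤ η := by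
  -- `M` exceeds `‖g z‖` for `z` within `1` of `p`, and `R` exceeds `‖f w - p‖` on the box of size
  -- `M`, where `f` is the inverse of `g`; both depend on `r` alone.
  set M : ℝ := 50 * r + 1
  set R : ℝ := 400 * r
  have hM : 0 < M := by positivity
  -- Here `x = log (1/ε)`: the area bound is linear in `x`, while the potential gains at least `x -
  -- 1` between the image of `V` and the sides of the box.
  have hlim : Tendsto (fun x : ℝ => 4 * M * (Real.pi * (Real.log (2 * R ^ 2) + 2 * x)) /
      (x - 1) ^ 2) atTop (𝓝 0) := by
    have h1 : (fun x : ℝ => 4 * M * (Real.pi * (Real.log (2 * R ^ 2) + 2 * x))) =O[atTop]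
        (fun x : ℝ => x) := by
      refine Asymptotics.IsBigO.const_mul_left (Asymptotics.IsBigO.const_mul_left ?_ _) _
      exact (Asymptotics.isLittleO_const_id_atTop _).isBigO.add
        ((Asymptotics.isBigO_refl _ _).const_mul_left 2)
    have h2 : (fun x : ℝ => x) =o[atTop] (fun x : ℝ => (x - 1) ^ 2) := by
      have h3 : (fun x : ℝ => x) =o[atTop] (fun x : ℝ => x ^ 2) := by
        simpa using Asymptotics.isLittleO_pow_pow_atTop_of_lt (𝕜 := ℝ) (one_lt_two)
      have h4 : (fun x : ℝ => x) =O[atTop] (fun x : ℝ => x - 1) := by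
        refine Asymptotics.IsBigO.of_bound 2 ?_
        filter_upwards [eventually_ge_atTop 2] with x hx
        rw [Real.norm_eq_abs, Real.norm_eq_abs, abs_of_nonneg (by linarith),
          abs_of_nonneg (by linarith)]
        linarith
      exact h3.trans_isBigO (h4.pow 2)
    exact (h1.trans_isLittleO h2).tendsto_div_nhds_zero
  obtain ⟨x, hx, hx2⟩ := ((hlim.eventually (gt_mem_nhds hη)).and (eventually_gt_atTop 2)).exists
  have hεx : 0 < Real.exp (-x) := Real.exp_pos _
  have hε1 : Real.exp (-x) < 1 := by rw [Real.exp_lt_one_iff]; linarith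
  refine ⟨Real.exp (-x), hεx, fun Ω g p h hΩ hp V hV hVc a ha b hb => ?_⟩
  have hr0 : 0 < r := by linarith
  have hΩ' : ∀ z ∈ upperHalf, r < ‖z - (0 : ℝ)‖ → z ∈ Ω := by simpa using hΩ
  have hsmall : ∀ z ∈ Ω, ‖z‖ ≤ 2 * r → ‖g z‖ ≤ 50 * r := by
    intro z hz hzr
    simpa using h.norm_sub_le hr0 hΩ' hz (by simpa using hzr)
  have hnear : ∀ z ∈ Ω, ‖z - p‖ < 1 → ‖g z‖ < M := by
    intro z hz hzp
    have : ‖z‖ ≤ ‖z - p‖ + ‖p‖ := by simpa using norm_add_le (z - p) p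
    have := hsmall z hz (by linarith)
    simp only [M]; linarith
  set f := Function.invFunOn g Ω
  have hfbd : ∀ w ∈ upperHalf, |w.re| ≤ M → w.im ≤ M → ‖f w - p‖ < R := by
    intro w hw hre him
    have hwn : ‖w‖ ≤ 2 * M := by
      have := Complex.norm_le_abs_re_add_abs_im w
      have hwim : 0 < w.im := hw
      rw [abs_of_pos hwim] at this
      linarith
    have hfΩ : f w ∈ Ω := h.inv_mem hw
    have hfw : ‖f w‖ ≤ 148 * r + 2 := by
      by_cases h2 : ‖f w‖ ≤ 2 * r
      · linarith
      · have h3 := h.norm_sub_self_le hr0 hΩ' (h.subset hfΩ) (by simpa using (not_le.1 h2).le)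
        rw [h.apply_inv hw] at h3
        have h4 : ‖f w‖ ≤ ‖w‖ + ‖w - f w‖ := by
          simpa using norm_sub_le w (w - f w)
        simp only [M] at hwn
        linarith
    have h5 := norm_sub_le (f w) p
    simp only [R]
    linarith
  have hfar : ∀ w ∈ upperHalf, M ≤ ‖w‖ → 1 ≤ ‖f w - p‖ := by
    intro w hw hwM
    by_contra! hlt
    have := hnear (f w) (h.inv_mem hw) hlt
    rw [h.apply_inv hw] at this
    linarith
  have hball : ∀ z ∈ V, ‖z - p‖ < Real.exp (-x) := fun z hz => by
    have := (hV hz).2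
    rwa [Metric.mem_ball, dist_eq_norm] at this
  have key := length_area_estimate (L := x - 1) h.inv_diff
    (fun u hu v hv huv => by
      have := congrArg g huv
      rwa [h.apply_inv hu, h.apply_inv hv] at this) hεx hM (by positivity : 0 < R)
    (by linarith) hfbd
    (hVc.image g (h.diff.continuousOn.mono fun z hz => (hV hz).1))
    (by
      rintro _ ⟨z, hz, rfl⟩
      have h1 := hnear z (hV hz).1 ((hball z hz).trans hε1)
      have h2 := h.im_pos (hV hz).1
      exact ⟨h2, ((le_abs_self _).trans (Complex.abs_im_le_norm _)).trans_lt h1,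
        (Complex.abs_re_le_norm _).trans_lt h1⟩)
    (by
      rintro _ ⟨z, hz, rfl⟩ v hv _ _ hvM
      have h1 : 1 ≤ ‖f v - p‖ := by
        refine hfar v hv ?_
        rcases hvM with h2 | h2
        · rw [← h2]; exact (le_abs_self _).trans (Complex.abs_re_le_norm _)
        · rw [← h2]; exact (le_abs_self _).trans (Complex.abs_im_le_norm _)
      rw [h.inv_apply (hV hz).1]
      have h3 : 0 ≤ Real.log (‖f v - p‖ ^ 2 + Real.exp (-x) ^ 2) :=
        Real.log_nonneg (by nlinarith [sq_nonneg (Real.exp (-x))])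
      have h4 : Real.log (‖z - p‖ ^ 2 + Real.exp (-x) ^ 2) ≤ Real.log (2 * Real.exp (-x) ^ 2) := by
        apply Real.log_le_log (by positivity)
        nlinarith [hball z hz, norm_nonneg (z - p)]
      rw [Real.log_mul (by norm_num) (by positivity), Real.log_pow, Real.log_exp] at h4
      have h5 : Real.log 2 ≤ 1 := by linarith [Real.log_two_lt_d9]
      push_cast at h4
      linarith)
    ⟨a, ha, rfl⟩ ⟨b, hb, rfl⟩
  have hA : Real.log ((R ^ 2 + Real.exp (-x) ^ 2) / Real.exp (-x) ^ 2) ≤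
      Real.log (2 * R ^ 2) + 2 * x := by
    rw [Real.log_div (by positivity) (by positivity), Real.log_pow, Real.log_exp]
    have : Real.log (R ^ 2 + Real.exp (-x) ^ 2) ≤ Real.log (2 * R ^ 2) := by
      apply Real.log_le_log (by positivity)
      have : 1 ≤ R := by simp only [R]; linarith
      nlinarith
    push_cast
    linarith
  have hA' := mul_le_mul_of_nonneg_left hA Real.pi_pos.le
  set A := Real.pi * (Real.log (2 * R ^ 2) + 2 * x)
  have hx1 : 0 < x - 1 := by linarith
  have h1 := key.1.trans hA'
  have h2 := key.2.trans hA'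
  rw [← mul_div_assoc, div_le_iff₀ (by positivity), ← le_div_iff₀ (by positivity)] at h1 h2
  have h3 := Complex.norm_le_abs_re_add_abs_im (g a - g b)
  rw [Complex.sub_re, Complex.sub_im] at h3
  have h4 : A * (2 * M) / (x - 1) ^ 2 + A * (2 * M) / (x - 1) ^ 2 = 4 * M * A / (x - 1) ^ 2 := by
    ring
  linarith

/-! ### Integration chains and the homological Cauchy theorem -/

open MeasureTheory in
-- Differentiation under the integral; Cauchy's estimate on discs of radius `r / 2` turns a bound
-- for `G` into the dominating bound for its derivative.
theorem differentiableOn_intervalIntegral {U : Set ℂ} (hU : IsOpen U) {G : ℂ → ℝ → ℂ}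
    (hG : ContinuousOn (fun q : ℂ × ℝ => G q.1 q.2) (U ×ˢ Icc 0 1))
    (hd : ∀ t ∈ Icc (0 : ℝ) 1, DifferentiableOn ℂ (fun z => G z t) U) :
    DifferentiableOn ℂ (fun z => ∫ t in (0 : ℝ)..1, G z t) U := by
  intro z₀ hz₀
  obtain ⟨r, hr, hball⟩ := Metric.nhds_basis_closedBall.mem_iff.1 (hU.mem_nhds hz₀)
  have hbound : ∃ B, ∀ q ∈ Metric.closedBall z₀ r ×ˢ Icc (0 : ℝ) 1, ‖G q.1 q.2‖ ≤ B :=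
    ((isCompact_closedBall z₀ r).prod isCompact_Icc).exists_bound_of_continuousOn
      (hG.mono (prod_mono hball subset_rfl))
  obtain ⟨B, hB⟩ := hbound
  have hslice : ∀ z ∈ U, ContinuousOn (G z) (Icc 0 1) := fun z hz =>
    hG.comp (f := fun t : ℝ => (z, t)) (by fun_prop) fun t ht => ⟨hz, ht⟩
  have hI : uIoc (0 : ℝ) 1 ⊆ Icc 0 1 := by
    rw [uIoc_of_le zero_le_one]; exact Ioc_subset_Icc_self
  have hmeas : ∀ z ∈ U, AEStronglyMeasurable (G z) (volume.restrict (uIoc (0 : ℝ) 1)) := fun z hz =>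
    ((hslice z hz).mono hI).aestronglyMeasurable measurableSet_uIoc
  have hdat : ∀ t ∈ Icc (0 : ℝ) 1, ∀ z ∈ U, HasDerivAt (fun z => G z t)
      (deriv (fun z => G z t) z) z := fun t ht z hz =>
    ((hd t ht).differentiableAt (hU.mem_nhds hz)).hasDerivAt
  refine DifferentiableAt.differentiableWithinAt (HasDerivAt.differentiableAt
    (intervalIntegral.hasDerivAt_integral_of_dominated_loc_of_deriv_le
    (F' := fun z t => deriv (fun z => G z t) z) (bound := fun _ => B / (r / 2))
    (Metric.ball_mem_nhds z₀ (half_pos hr)) ?_ ?_ ?_ ?_ ?_ ?_).2)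
  · filter_upwards [hU.mem_nhds hz₀] with z hz using hmeas z hz
  · exact ContinuousOn.intervalIntegrable (by rw [uIcc_of_le zero_le_one]; exact hslice z₀ hz₀)
  -- Measurability of the derivative in `t`: it is a limit of difference quotients along a sequence
  -- tending to `z₀`.
  · set u : ℕ → ℂ := fun n => z₀ + ((r / (n + 2) : ℝ) : ℂ)
    have hupos : ∀ n : ℕ, 0 < r / ((n : ℝ) + 2) := fun n => by positivity
    have hu0 : Tendsto (fun n : ℕ => r / ((n : ℝ) + 2)) atTop (𝓝 0) :=
      tendsto_const_nhds.div_atTop (tendsto_atTop_add_const_right _ _ tendsto_natCast_atTop_atTop)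
    have hu : Tendsto u atTop (𝓝[≠] z₀) := by
      refine tendsto_nhdsWithin_of_tendsto_nhds_of_eventually_within _ ?_ ?_
      · have := (Complex.continuous_ofReal.tendsto 0).comp hu0
        simpa [u] using (tendsto_const_nhds (x := z₀)).add this
      · refine Eventually.of_forall fun n => ?_
        rw [mem_compl_iff, mem_singleton_iff, add_eq_left, Complex.ofReal_eq_zero]
        exact (hupos n).ne'
    have huU : ∀ n, u n ∈ U := fun n => hball (by
      rw [Metric.mem_closedBall, dist_eq_norm, add_sub_cancel_left, Complex.norm_real,
        Real.norm_eq_abs, abs_of_pos (hupos n)]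
      exact div_le_self hr.le (by linarith [(n.cast_nonneg : (0 : ℝ) ≤ n)]))
    refine aestronglyMeasurable_of_tendsto_ae atTop (f := fun n t =>
      slope (fun z => G z t) z₀ (u n)) (fun n => ?_) ?_
    · exact ((hmeas _ (huU n)).sub (hmeas _ hz₀)).const_smul ((u n - z₀)⁻¹)
    · filter_upwards [ae_restrict_mem measurableSet_uIoc] with t ht
      exact (hasDerivAt_iff_tendsto_slope.1 (hdat t (hI ht) z₀ hz₀)).comp hu
  · refine Eventually.of_forall fun t ht z hz => ?_
    rw [Metric.mem_ball] at hz
    have hsub : Metric.closedBall z (r / 2) ⊆ Metric.closedBall z₀ r :=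
      Metric.closedBall_subset_closedBall' (by linarith)
    refine Complex.norm_deriv_le_of_forall_mem_sphere_norm_le (half_pos hr)
      (DifferentiableOn.diffContOnCl ?_) fun w hw =>
        hB (w, t) ⟨hsub (Metric.sphere_subset_closedBall hw), hI ht⟩
    rw [closure_ball _ (half_pos hr).ne']
    exact (hd t (hI ht)).mono (hsub.trans hball)
  · exact intervalIntegrable_const
  · refine Eventually.of_forall fun t ht z hz => hdat t (hI ht) z (hball ?_)
    exact (Metric.ball_subset_closedBall.trans (Metric.closedBall_subset_closedBall (by linarith))) hz

/-- `J` is integration along a chain supported in the compact set `K`; for functions with a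
primitive `F` the integral is the boundary term `δ F`. -/
structure IsIntegralChain (K : Set ℂ) (δ : (ℂ → ℂ) → ℂ) (J : (ℂ → ℂ) → ℂ) : Prop where
  compact : IsCompact K
  congr : ∀ f g, EqOn f g K → J f = J g
  linear : ∀ f g, ∀ c : ℂ, ContinuousOn f K → ContinuousOn g K →
    J (fun z => f z + c * g z) = J f + c * J g
  bound : ∃ C, 0 ≤ C ∧ ∀ f B, 0 ≤ B → (∀ z ∈ K, ‖f z‖ ≤ B) → ‖J f‖ ≤ C * B
  ftc : ∀ F f, (∀ z ∈ K, HasDerivAt F (f z) z) → ContinuousOn f K → J f = δ F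
  param : ∀ (U : Set ℂ) (G : ℂ → ℂ → ℂ), IsOpen U →
    ContinuousOn (fun q : ℂ × ℂ => G q.1 q.2) (U ×ˢ K) →
    (∀ w ∈ K, DifferentiableOn ℂ (fun z => G z w) U) → DifferentiableOn ℂ (fun z => J (G z)) U

theorem IsIntegralChain.add_mul {K K' : Set ℂ} {δ δ' J J' : (ℂ → ℂ) → ℂ} (h : IsIntegralChain K δ J)
    (h' : IsIntegralChain K' δ' J') (c : ℂ) :
    IsIntegralChain (K ∪ K') (fun F => δ F + c * δ' F) (fun f => J f + c * J' f) where
  compact := h.compact.union h'.compact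
  congr f g hfg := by
    rw [h.congr f g (hfg.mono subset_union_left), h'.congr f g (hfg.mono subset_union_right)]
  linear f g a hf hg := by
    rw [h.linear f g a (hf.mono subset_union_left) (hg.mono subset_union_left),
      h'.linear f g a (hf.mono subset_union_right) (hg.mono subset_union_right)]
    ring
  bound := by
    obtain ⟨C, hC, hb⟩ := h.bound
    obtain ⟨C', hC', hb'⟩ := h'.bound
    refine ⟨C + ‖c‖ * C', by positivity, fun f B hB hf => ?_⟩
    have h1 := hb f B hB fun z hz => hf z (Or.inl hz)
    have h2 := hb' f B hB fun z hz => hf z (Or.inr hz)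
    calc ‖J f + c * J' f‖ ≤ ‖J f‖ + ‖c * J' f‖ := norm_add_le _ _
      _ ≤ C * B + ‖c‖ * (C' * B) := by rw [norm_mul]; gcongr
      _ = (C + ‖c‖ * C') * B := by ring
  ftc F f hF hf := by
    rw [h.ftc F f (fun z hz => hF z (Or.inl hz)) (hf.mono subset_union_left),
      h'.ftc F f (fun z hz => hF z (Or.inr hz)) (hf.mono subset_union_right)]
  param U G hU hG hd :=
    (h.param U G hU (hG.mono (prod_mono subset_rfl subset_union_left))
      fun w hw => hd w (Or.inl hw)).add
    ((h'.param U G hU (hG.mono (prod_mono subset_rfl subset_union_right))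
      fun w hw => hd w (Or.inr hw)).const_mul c)

theorem isIntegralChain_segment (b c : ℂ) : IsIntegralChain (segment ℝ b c) (fun F => F c - F b)
    (fun f => ∫ t in (0 : ℝ)..1, f (b + t * (c - b)) * (c - b)) := by
  have hmem : ∀ t ∈ Icc (0 : ℝ) 1, b + t * (c - b) ∈ segment ℝ b c := fun t ht => by
    rw [segment_eq_image']
    exact ⟨t, ht, by simp⟩
  have huIcc : uIcc (0 : ℝ) 1 = Icc 0 1 := uIcc_of_le zero_le_one
  have hcont : ∀ f, ContinuousOn f (segment ℝ b c) →
      ContinuousOn (fun t : ℝ => f (b + t * (c - b)) * (c - b)) (uIcc 0 1) := fun f hf =>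
    (hf.comp (f := fun t : ℝ => b + t * (c - b)) (by fun_prop)
      (by rw [huIcc]; exact hmem)).mul continuousOn_const
  constructor
  · rw [segment_eq_image']
    exact isCompact_Icc.image (by fun_prop)
  · intro f g hfg
    refine intervalIntegral.integral_congr fun t ht => ?_
    rw [huIcc] at ht
    simp only [hfg (hmem t ht)]
  · intro f g a hf hg
    rw [← intervalIntegral.integral_const_mul, ← intervalIntegral.integral_add
      (hcont f hf).intervalIntegrable ((hcont g hg).intervalIntegrable.const_mul a)]
    congr 1
    ext t
    ring
  · refine ⟨‖c - b‖, norm_nonneg _, fun f B hB hf => ?_⟩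
    have := intervalIntegral.norm_integral_le_of_norm_le_const (a := (0 : ℝ)) (b := 1)
      (f := fun t : ℝ => f (b + t * (c - b)) * (c - b)) (C := ‖c - b‖ * B) (fun t ht => by
        rw [norm_mul, mul_comm]
        rw [uIoc_of_le zero_le_one] at ht
        gcongr
        exact hf _ (hmem t (Ioc_subset_Icc_self ht)))
    simpa using this
  · intro F f hF hf
    rw [intervalIntegral.integral_eq_sub_of_hasDerivAt (f := fun t : ℝ => F (b + t * (c - b)))
      (fun t ht => ?_) (hcont f hf).intervalIntegrable]
    · simp
    · rw [huIcc] at ht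
      have h1 : HasDerivAt (fun t : ℝ => b + t * (c - b)) (c - b) t := by
        simpa using ((Complex.ofRealCLM.hasDerivAt (x := t)).mul_const (c - b)).const_add b
      exact (hF _ (hmem t ht)).comp t h1
  · intro U G hU hG hd
    refine differentiableOn_intervalIntegral hU (G := fun z t => G z (b + t * (c - b)) * (c - b))
      ?_ fun t ht => (hd _ (hmem t ht)).mul_const _
    refine ContinuousOn.mul ?_ continuousOn_const
    exact hG.comp (f := fun q : ℂ × ℝ => (q.1, b + q.2 * (c - b))) (by fun_prop)
      fun q hq => ⟨hq.1, hmem q.2 hq.2⟩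

/-- Being joined by a chain is an equivalence relation that holds locally, by segments. No path
between the two points has to be chosen. -/
theorem exists_isIntegralChain_of_isPreconnected {D : Set ℂ} (hD : IsOpen D) (hc : IsPreconnected D)
    {a b : ℂ} (ha : a ∈ D) (hb : b ∈ D) :
    ∃ K ⊆ D, ∃ J, IsIntegralChain K (fun F => F b - F a) J := by
  refine hc.induction₂ (fun a b => ∃ K ⊆ D, ∃ J, IsIntegralChain K (fun F => F b - F a) J) ?_ ?_ ?_ ha hb
  · intro x hx
    obtain ⟨r, hr, hball⟩ := Metric.isOpen_iff.1 hD x hx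
    filter_upwards [nhdsWithin_le_nhds (Metric.ball_mem_nhds x hr)] with y hy
    exact ⟨segment ℝ x y, ((convex_ball x r).segment_subset (Metric.mem_ball_self hr) hy).trans hball,
      _, isIntegralChain_segment x y⟩
  · rintro x y z _ _ _ ⟨K, hK, J, hJ⟩ ⟨K', hK', J', hJ'⟩
    refine ⟨K ∪ K', union_subset hK hK', fun f => J f + 1 * J' f, ?_⟩
    convert hJ.add_mul hJ' 1 using 2
    ring
  · rintro x y _ _ ⟨K, hK, J, hJ⟩
    -- Reversal of the chain, written as a sum: `J - 2J = -J`.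
    refine ⟨K ∪ K, union_subset hK hK, fun f => J f + -2 * J f, ?_⟩
    convert hJ.add_mul hJ (-2) using 2
    ring

/-- Joint continuity on the diagonal is strict differentiability together with continuity of the
derivative. -/
theorem continuousOn_dslope_prod {D : Set ℂ} (hD : IsOpen D) {h : ℂ → ℂ}
    (hh : DifferentiableOn ℂ h D) :
    ContinuousOn (fun q : ℂ × ℂ => dslope h q.1 q.2) (D ×ˢ D) := by
  rintro ⟨a, b⟩ ⟨ha, hb⟩
  apply ContinuousAt.continuousWithinAt
  change a ∈ D at ha
  change b ∈ D at hb
  by_cases hab : a = b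
  · subst hab
    rw [ContinuousAt]
    simp only [dslope_same]
    have hs : HasStrictDerivAt h (deriv h a) a :=
      (hh.analyticAt (hD.mem_nhds ha)).hasStrictDerivAt
    have hdc : ContinuousAt (deriv h) a :=
      (hh.deriv hD).continuousOn.continuousAt (hD.mem_nhds ha)
    rw [Metric.tendsto_nhds]
    intro ε hε
    have h1 := hs.isLittleO.bound (half_pos hε)
    have h2 : ∀ᶠ q : ℂ × ℂ in 𝓝 (a, a), dist (deriv h q.1) (deriv h a) < ε :=
      (hdc.comp (f := Prod.fst) (x := (a, a)) continuousAt_fst).eventually (Metric.ball_mem_nhds _ hε)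
    filter_upwards [h1, h2] with q hq1 hq2
    by_cases hq : q.2 = q.1
    · rw [hq, dslope_same]; exact hq2
    · rw [dslope_of_ne _ hq, slope_def_field, dist_eq_norm]
      have hne : q.2 - q.1 ≠ 0 := sub_ne_zero.2 hq
      have h3 : (h q.2 - h q.1) / (q.2 - q.1) - deriv h a =
          -(h q.1 - h q.2 - (q.1 - q.2) • deriv h a) / (q.2 - q.1) := by
        rw [smul_eq_mul]
        field_simp
        ring
      rw [h3, norm_div, norm_neg, div_lt_iff₀ (norm_pos_iff.2 hne)]
      rw [norm_sub_rev q.1 q.2] at hq1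
      have h4 : 0 < ‖q.2 - q.1‖ := norm_pos_iff.2 hne
      have h5 : ‖h q.1 - h q.2 - (q.1 - q.2) • deriv h a‖ ≤ ε / 2 * ‖q.2 - q.1‖ := by
        simpa using hq1
      nlinarith
  · have hopen : IsOpen {q : ℂ × ℂ | q.2 ≠ q.1} := isOpen_ne_fun continuous_snd continuous_fst
    have hev : (fun q : ℂ × ℂ => dslope h q.1 q.2) =ᶠ[𝓝 (a, b)]
        fun q => (h q.2 - h q.1) / (q.2 - q.1) := by
      filter_upwards [hopen.mem_nhds (show (a, b) ∈ {q : ℂ × ℂ | q.2 ≠ q.1} from Ne.symm hab)]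
        with q hq
      rw [dslope_of_ne _ hq, slope_def_field]
    refine ContinuousAt.congr ?_ hev.symm
    have hca : ContinuousAt h a := hh.continuousOn.continuousAt (hD.mem_nhds ha)
    have hcb : ContinuousAt h b := hh.continuousOn.continuousAt (hD.mem_nhds hb)
    refine ContinuousAt.div ((hcb.comp (f := Prod.snd) (x := (a, b)) continuousAt_snd).sub
      (hca.comp (f := Prod.fst) (x := (a, b)) continuousAt_fst))
      (continuousAt_snd.sub continuousAt_fst) ?_
    exact sub_ne_zero.2 (Ne.symm hab)

theorem dslope_symm (h : ℂ → ℂ) (a b : ℂ) : dslope h a b = dslope h b a := by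
  by_cases hab : b = a
  · rw [hab]
  · rw [dslope_of_ne _ hab, dslope_of_ne _ (Ne.symm hab), slope_comm]

namespace IsIntegralChain

variable {K : Set ℂ} {J : (ℂ → ℂ) → ℂ}

theorem inv_sub_continuousOn {z : ℂ} (hz : z ∉ K) : ContinuousOn (fun w => (w - z)⁻¹) K :=
  ContinuousOn.inv₀ (by fun_prop) fun w hw h0 => hz (by rwa [sub_eq_zero.1 h0] at hw)

/-- The winding number of a cycle is locally constant off its support. -/
theorem eventually_winding_eq (hJ : IsIntegralChain K (fun _ => 0) J) {z : ℂ} (hz : z ∉ K) :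
    ∀ᶠ z' in 𝓝 z, z' ∉ K ∧ J (fun w => (w - z')⁻¹) = J (fun w => (w - z)⁻¹) := by
  obtain ⟨r, hr, hball⟩ := Metric.isOpen_iff.1 hJ.compact.isClosed.isOpen_compl z hz
  filter_upwards [Metric.ball_mem_nhds z hr] with z' hz'
  have hz'K : z' ∉ K := hball hz'
  refine ⟨hz'K, ?_⟩
  have h1 := hJ.linear _ _ (-1) (inv_sub_continuousOn hz'K) (inv_sub_continuousOn hz)
  -- On `K` the quotient `(w - z') / (w - z)` is within distance `1` of `1`, because `z'` is nearer
  -- to `z` than `K` is. Its logarithm is thus a primitive of the difference of the two kernels.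
  have h2 := hJ.ftc (fun w => Complex.log ((w - z') / (w - z)))
    (fun w => (w - z')⁻¹ + (-1) * (w - z)⁻¹) (fun w hw => ?_)
    ((inv_sub_continuousOn hz'K).add (continuousOn_const.mul (inv_sub_continuousOn hz)))
  · rw [h2] at h1
    linear_combination -h1
  · have hwz : w - z ≠ 0 := fun h0 => hz (by rwa [sub_eq_zero.1 h0] at hw)
    have hwz' : w - z' ≠ 0 := fun h0 => hz'K (by rwa [sub_eq_zero.1 h0] at hw)
    have hfar : r ≤ ‖w - z‖ := by
      by_contra! hlt
      exact hball (by rwa [Metric.mem_ball, dist_eq_norm]) hw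
    have h3 : HasDerivAt (fun w => (w - z') / (w - z))
        ((1 * (w - z) - (w - z') * 1) / (w - z) ^ 2) w :=
      ((hasDerivAt_id w).sub_const z').div ((hasDerivAt_id w).sub_const z) hwz
    refine (h3.clog ?_).congr_deriv ?_
    · have h4 : (w - z') / (w - z) = 1 + (z - z') / (w - z) := by field_simp; ring
      rw [h4]
      refine Complex.mem_slitPlane_of_norm_lt_one ?_
      rw [norm_div, div_lt_one (norm_pos_iff.2 hwz), norm_sub_rev, ← dist_eq_norm]
      exact (Metric.mem_ball.1 hz').trans_le hfar
    · field_simp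
      ring

theorem eventually_winding_eq_zero (hJ : IsIntegralChain K (fun _ => 0) J) :
    ∀ᶠ z in cobounded ℂ, z ∉ K ∧ J (fun w => (w - z)⁻¹) = 0 := by
  obtain ⟨R, hR⟩ := hJ.compact.isBounded.exists_norm_le
  filter_upwards [eventually_cobounded_le_norm (max R 0 + 1)] with z hz
  have hzR : R < ‖z‖ := by linarith [le_max_left R 0]
  have hz0 : z ≠ 0 := by
    rintro rfl
    rw [norm_zero] at hz
    linarith [le_max_right R 0]
  have hzK : z ∉ K := fun h => by linarith [hR z h]
  refine ⟨hzK, hJ.ftc (fun w => Complex.log (1 + -w / z)) _ (fun w hw => ?_)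
    (inv_sub_continuousOn hzK)⟩
  have hwz : w - z ≠ 0 := fun h0 => hzK (by rwa [sub_eq_zero.1 h0] at hw)
  have h3 : HasDerivAt (fun w : ℂ => 1 + -w / z) (-1 / z) w :=
    ((hasDerivAt_id w).neg.div_const z).const_add 1
  have hne : 1 + -w / z ≠ 0 := by
    have : 1 + -w / z = -(w - z) / z := by field_simp; ring
    rw [this]
    exact div_ne_zero (neg_ne_zero.2 hwz) hz0
  refine (h3.clog (Complex.mem_slitPlane_of_norm_lt_one ?_)).congr_deriv ?_
  · rw [norm_div, norm_neg, div_lt_one (norm_pos_iff.2 hz0)]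
    linarith [hR w hw]
  · have : 1 + -w / z = -(w - z) / z := by field_simp; ring
    rw [this]
    field_simp

/-- **Cauchy's theorem**, homology version, proved as by Dixon. -/
theorem eq_zero_of_winding_eq_zero (hJ : IsIntegralChain K (fun _ => 0) J) {D : Set ℂ} (hD : IsOpen D)
    (hKD : K ⊆ D) (hw : ∀ z ∉ D, J (fun w => (w - z)⁻¹) = 0) {h : ℂ → ℂ}
    (hh : DifferentiableOn ℂ h D) : J h = 0 := by
  classical
  -- Dixon's gluing: `J (dslope h z)` on `D` and the Cauchy integral of `h` on `D'` agree on the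
  -- overlap, where the winding number is zero. Together they form an entire function tending to `0`
  -- at infinity, so both vanish by Liouville.
  set D' : Set ℂ := {z | z ∉ K ∧ J (fun w => (w - z)⁻¹) = 0}
  have hD' : IsOpen D' := by
    rw [isOpen_iff_mem_nhds]
    rintro z ⟨hz, hz0⟩
    filter_upwards [hJ.eventually_winding_eq hz] with z' hz'
    exact ⟨hz'.1, hz'.2.trans hz0⟩
  have hcov : ∀ z, z ∈ D ∨ z ∈ D' := fun z => by
    by_cases hz : z ∈ D
    · exact Or.inl hz
    · exact Or.inr ⟨fun hzK => hz (hKD hzK), hw z hz⟩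
  have hfar : ∀ᶠ z in cobounded ℂ, z ∈ D' := hJ.eventually_winding_eq_zero
  have key : ∀ h : ℂ → ℂ, DifferentiableOn ℂ h D → ∀ z ∈ D', J (fun w => h w * (w - z)⁻¹) = 0 := by
    intro h hh
    have hhK : ContinuousOn h K := hh.continuousOn.mono hKD
    set F1 : ℂ → ℂ := fun z => J (dslope h z)
    set F2 : ℂ → ℂ := fun z => J (fun w => h w * (w - z)⁻¹)
    have hF1 : DifferentiableOn ℂ F1 D := by
      refine hJ.param D (dslope h) hD ((continuousOn_dslope_prod hD hh).mono
        (prod_mono subset_rfl hKD)) fun w hw => ?_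
      have := (Complex.differentiableOn_dslope (hD.mem_nhds (hKD hw))).2 hh
      refine this.congr fun z _ => dslope_symm _ _ _
    have hF2 : DifferentiableOn ℂ F2 D' := by
      refine hJ.param D' (fun z w => h w * (w - z)⁻¹) hD' ?_ fun w hw => ?_
      · refine ContinuousOn.mul (hhK.comp continuousOn_snd fun q hq => hq.2)
          (ContinuousOn.inv₀ (by fun_prop) fun q hq h0 => hq.1.1 ?_)
        rw [← sub_eq_zero.1 h0]
        exact hq.2
      · refine DifferentiableOn.const_mul (DifferentiableOn.inv (by fun_prop) fun z hz h0 => hz.1 ?_) _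
        rw [← sub_eq_zero.1 h0]
        exact hw
    have heq : ∀ z ∈ D, z ∈ D' → F1 z = F2 z := by
      intro z hz hz'
      have hi := inv_sub_continuousOn hz'.1
      have h1 := hJ.linear (fun w => h w * (w - z)⁻¹) (fun w => (w - z)⁻¹) (-h z) (hhK.mul hi) hi
      rw [hz'.2, mul_zero, add_zero] at h1
      refine (hJ.congr _ _ fun w hw => ?_).trans h1
      have hne : w ≠ z := fun h0 => hz'.1 (h0 ▸ hw)
      rw [dslope_of_ne _ hne, slope_def_field]
      ring
    set F : ℂ → ℂ := fun z => if z ∈ D' then F2 z else F1 z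
    have hFD : ∀ z ∈ D, F z = F1 z := by
      intro z hz
      by_cases hz' : z ∈ D'
      · simp only [F, hz', if_true, heq z hz hz']
      · simp only [F, hz', if_false]
    have hFD' : ∀ z ∈ D', F z = F2 z := fun z hz => by simp only [F, hz, if_true]
    have hFdiff : Differentiable ℂ F := by
      intro z
      rcases hcov z with hz | hz
      · refine (hF1.differentiableAt (hD.mem_nhds hz)).congr_of_eventuallyEq ?_
        filter_upwards [hD.mem_nhds hz] with v hv using hFD v hv
      · refine (hF2.differentiableAt (hD'.mem_nhds hz)).congr_of_eventuallyEq ?_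
        filter_upwards [hD'.mem_nhds hz] with v hv using hFD' v hv
    have hlim : Tendsto F (cocompact ℂ) (𝓝 0) := by
      rw [← Metric.cobounded_eq_cocompact]
      obtain ⟨C, hC, hb⟩ := hJ.bound
      obtain ⟨R, hR⟩ := hJ.compact.isBounded.exists_norm_le
      obtain ⟨B, hB⟩ := hJ.compact.exists_bound_of_continuousOn hhK
      have hB' : ∀ w ∈ K, ‖h w‖ ≤ |B| := fun w hw => (hB w hw).trans (le_abs_self B)
      have hlim1 : Tendsto (fun z : ℂ => C * (|B| * (‖z‖ - R)⁻¹)) (cobounded ℂ)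
          (𝓝 (C * (|B| * 0))) :=
        ((tendsto_inv_atTop_zero.comp (tendsto_atTop_add_const_right _ (-R)
          tendsto_norm_cobounded_atTop)).const_mul _).const_mul _
      rw [mul_zero, mul_zero] at hlim1
      refine squeeze_zero_norm' ?_ hlim1
      filter_upwards [hfar, eventually_cobounded_le_norm (R + 1)] with z hz hzR
      rw [hFD' z hz]
      refine hb _ _ (mul_nonneg (abs_nonneg _) (inv_nonneg.2 (by linarith))) fun w hw => ?_
      rw [norm_mul, norm_inv]
      have h1 : ‖z‖ - R ≤ ‖w - z‖ := by
        have := norm_sub_norm_le z w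
        rw [norm_sub_rev] at this
        linarith [hR w hw]
      have h2 : 0 < ‖z‖ - R := by linarith
      gcongr
      exact hB' w hw
    intro z hz
    rw [← hFdiff.apply_eq_of_tendsto_cocompact z hlim, hFD' z hz]
  -- The Cauchy integral at `z` of `h w * (w - z)` is `J h` itself.
  obtain ⟨z, hz⟩ := hfar.exists
  have := key (fun w => h w * (w - z)) (hh.mul (by fun_prop)) z hz
  rw [← this]
  refine hJ.congr _ _ fun w hw => ?_
  have hne : w - z ≠ 0 := fun h0 => hz.1 (by rwa [sub_eq_zero.1 h0] at hw)
  field_simp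

end IsIntegralChain

/-- Winding numbers of all cycles in `D` vanish off `D`. -/
def NoWinding (D : Set ℂ) : Prop :=
  ∀ K ⊆ D, ∀ J, IsIntegralChain K (fun _ => 0) J → ∀ z ∉ D, J (fun w => (w - z)⁻¹) = 0

/-- Integrate `h` along a chosen chain from a base point. For nearby `z` and `z'`, the chain to `z`,
the segment to `z'` and the reversed chain to `z'` form a cycle, so the integral changes as a local
primitive does. -/
theorem NoWinding.exists_primitive {D : Set ℂ} (hn : NoWinding D) (hD : IsOpen D)
    (hc : IsPreconnected D) {h : ℂ → ℂ} (hh : DifferentiableOn ℂ h D) :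
    ∃ F : ℂ → ℂ, ∀ z ∈ D, HasDerivAt F (h z) z := by
  rcases D.eq_empty_or_nonempty with rfl | ⟨a, ha⟩
  · exact ⟨0, fun z hz => hz.elim⟩
  choose! K hK J hJ using fun b hb => exists_isIntegralChain_of_isPreconnected hD hc ha (b := b) hb
  refine ⟨fun z => J z h, fun z hz => ?_⟩
  obtain ⟨r, hr, hball⟩ := Metric.isOpen_iff.1 hD z hz
  obtain ⟨Φ, hΦ⟩ := (hh.mono hball).isExactOn_ball
  have hloc : ∀ z' ∈ Metric.ball z r, J z' h = J z h + (Φ z' - Φ z) := by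
    intro z' hz'
    have hseg : segment ℝ z z' ⊆ Metric.ball z r :=
      (convex_ball z r).segment_subset (Metric.mem_ball_self hr) hz'
    have h1 := (hJ z hz).add_mul (isIntegralChain_segment z z') 1
    have h2 := h1.add_mul (hJ z' (hball hz')) (-1)
    have h3 : IsIntegralChain (K z ∪ segment ℝ z z' ∪ K z') (fun _ => 0) (fun f => J z f +
        1 * (∫ t in (0 : ℝ)..1, f (z + t * (z' - z)) * (z' - z)) + -1 * J z' f) := by
      convert h2 using 2
      ring
    have hsub : K z ∪ segment ℝ z z' ∪ K z' ⊆ D :=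
      union_subset (union_subset (hK z hz) (hseg.trans hball)) (hK z' (hball hz'))
    have h4 := h3.eq_zero_of_winding_eq_zero hD hsub (hn _ hsub _ h3) hh
    have h5 := (isIntegralChain_segment z z').ftc Φ h (fun w hw => hΦ w (hseg hw))
      (hh.continuousOn.mono (hseg.trans hball))
    rw [h5] at h4
    linear_combination -h4
  refine (((hΦ z (Metric.mem_ball_self hr)).sub_const (Φ z)).const_add
    (J z h)).congr_of_eventuallyEq ?_
  filter_upwards [Metric.ball_mem_nhds z hr] with z' hz' using hloc z' hz'

/-- If `F` is a primitive of `h' / h`, then `h exp(-F)` is a constant `c²`, and `c exp(F / 2)` is a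
square root. -/
theorem NoWinding.exists_sqrt {D : Set ℂ} (hn : NoWinding D) (hD : IsOpen D)
    (hc : IsPreconnected D) {h : ℂ → ℂ} (hh : DifferentiableOn ℂ h D) (h0 : ∀ z ∈ D, h z ≠ 0) :
    ∃ s : ℂ → ℂ, DifferentiableOn ℂ s D ∧ ∀ z ∈ D, s z ^ 2 = h z := by
  rcases D.eq_empty_or_nonempty with rfl | ⟨a, ha⟩
  · exact ⟨0, by simp, fun z hz => hz.elim⟩
  obtain ⟨F, hF⟩ := hn.exists_primitive hD hc ((hh.deriv hD).div hh h0)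
  have hconst : ∀ z ∈ D, h z * Complex.exp (-F z) = h a * Complex.exp (-F a) := by
    intro z hz
    refine hD.is_const_of_deriv_eq_zero (𝕜 := ℂ) hc (f := fun z => h z * Complex.exp (-F z))
      ?_ ?_ hz ha
    · exact hh.mul fun z hz => (hF z hz).differentiableAt.neg.cexp.differentiableWithinAt
    · intro z hz
      have h1 := (hh.differentiableAt (hD.mem_nhds hz)).hasDerivAt.mul (hF z hz).neg.cexp
      have h2 : deriv h z * Complex.exp (-F z) +
          h z * (Complex.exp (-F z) * -(deriv h z / h z)) = 0 := by
        have := h0 z hz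
        field_simp
        ring
      exact (h1.congr_deriv h2).deriv
  obtain ⟨c, hcsq⟩ : ∃ c : ℂ, c ^ 2 = h a * Complex.exp (-F a) :=
    IsAlgClosed.exists_pow_nat_eq _ two_pos
  refine ⟨fun z => c * Complex.exp (F z / 2), ?_, fun z hz => ?_⟩
  · exact fun z hz => (((hF z hz).differentiableAt.div_const 2).cexp.const_mul
      c).differentiableWithinAt
  · rw [mul_pow, hcsq, ← hconst z hz, ← Complex.exp_nat_mul, mul_assoc, ← Complex.exp_add]
    have : -F z + ((2 : ℕ) : ℂ) * (F z / 2) = 0 := by push_cast; ring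
    rw [this, Complex.exp_zero, mul_one]

/-! ### The Riemann mapping theorem -/


/-- The disc automorphism sending `w` to `0`. -/
noncomputable def discShift (w ζ : ℂ) : ℂ := (ζ - w) / (1 - conj w * ζ)

theorem one_sub_conj_mul_ne_zero {w ζ : ℂ} (hw : ‖w‖ < 1) (hζ : ‖ζ‖ < 1) : 1 - conj w * ζ ≠ 0 := by
  intro h
  have h1 : ‖conj w * ζ‖ = 1 := by rw [← sub_eq_zero.1 h, norm_one]
  rw [norm_mul, Complex.norm_conj] at h1
  nlinarith [norm_nonneg w, norm_nonneg ζ]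

theorem norm_discShift_lt_one {w ζ : ℂ} (hw : ‖w‖ < 1) (hζ : ‖ζ‖ < 1) : ‖discShift w ζ‖ < 1 := by
  have hne := one_sub_conj_mul_ne_zero hw hζ
  rw [discShift, norm_div, div_lt_one (norm_pos_iff.2 hne)]
  refine lt_of_pow_lt_pow_left₀ 2 (norm_nonneg _) ?_
  have h1 : ‖1 - conj w * ζ‖ ^ 2 - ‖ζ - w‖ ^ 2 = (1 - ‖w‖ ^ 2) * (1 - ‖ζ‖ ^ 2) := by
    simp only [← Complex.normSq_eq_norm_sq, Complex.normSq_apply]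
    simp
    ring
  have h2 : 0 < (1 - ‖w‖ ^ 2) * (1 - ‖ζ‖ ^ 2) := by
    apply mul_pos <;> nlinarith [norm_nonneg w, norm_nonneg ζ]
  linarith

theorem injOn_discShift {w : ℂ} (hw : ‖w‖ < 1) : InjOn (discShift w) (Metric.ball 0 1) := by
  intro ζ hζ ξ hξ h
  rw [mem_ball_zero_iff] at hζ hξ
  rw [discShift, discShift, div_eq_div_iff (one_sub_conj_mul_ne_zero hw hζ)
    (one_sub_conj_mul_ne_zero hw hξ)] at h
  have h1 : (ζ - ξ) * (1 - conj w * w) = 0 := by linear_combination h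
  exact sub_eq_zero.1 ((mul_eq_zero.1 h1).resolve_right (one_sub_conj_mul_ne_zero hw hw))

theorem hasDerivAt_discShift {w ζ : ℂ} (hw : ‖w‖ < 1) (hζ : ‖ζ‖ < 1) :
    HasDerivAt (discShift w) ((1 - conj w * w) / (1 - conj w * ζ) ^ 2) ζ := by
  have h1 : HasDerivAt (fun ζ => 1 - conj w * ζ) (-(conj w * 1)) ζ :=
    ((hasDerivAt_id ζ).const_mul (conj w)).const_sub 1
  refine (((hasDerivAt_id ζ).sub_const w).div h1 (one_sub_conj_mul_ne_zero hw hζ)).congr_deriv ?_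
  simp only [id]
  congr 1
  ring

theorem norm_one_sub_conj_mul_self {w : ℂ} (hw : ‖w‖ < 1) : ‖1 - conj w * w‖ = 1 - ‖w‖ ^ 2 := by
  have h1 : conj w * w = ((‖w‖ ^ 2 : ℝ) : ℂ) := by
    rw [mul_comm, Complex.mul_conj, Complex.normSq_eq_norm_sq]
  rw [h1, ← Complex.ofReal_one, ← Complex.ofReal_sub, Complex.norm_real, Real.norm_eq_abs,
    abs_of_pos]
  nlinarith [norm_nonneg w]

theorem differentiableOn_discShift_comp {D : Set ℂ} {f : ℂ → ℂ} {w : ℂ} (hw : ‖w‖ < 1)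
    (hf : DifferentiableOn ℂ f D) (hm : ∀ z ∈ D, ‖f z‖ < 1) :
    DifferentiableOn ℂ (fun z => discShift w (f z)) D := fun z hz =>
  (hasDerivAt_discShift hw (hm z hz)).differentiableAt.comp_differentiableWithinAt z (hf z hz)

/-- Every zero-free holomorphic function on `D` has a holomorphic square root. -/
def HasSqrts (D : Set ℂ) : Prop :=
  ∀ h : ℂ → ℂ, DifferentiableOn ℂ h D → (∀ z ∈ D, h z ≠ 0) →
    ∃ s : ℂ → ℂ, DifferentiableOn ℂ s D ∧ ∀ z ∈ D, s z ^ 2 = h z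

/-- The competitors in the extremal problem for the Riemann map. -/
structure IsDiscEmbedding (D : Set ℂ) (a : ℂ) (f : ℂ → ℂ) : Prop where
  diff : DifferentiableOn ℂ f D
  maps : ∀ z ∈ D, ‖f z‖ ≤ 1
  inj : InjOn f D
  zero : f a = 0

/-- The non-strict bound in the definition survives limits; the open mapping theorem recovers the
strict one. -/
theorem IsDiscEmbedding.norm_lt_one {D : Set ℂ} {a : ℂ} {f : ℂ → ℂ} (h : IsDiscEmbedding D a f)
    (hD : IsOpen D) {z : ℂ} (hz : z ∈ D) : ‖f z‖ < 1 := by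
  have h1 : f '' D ⊆ interior (Metric.closedBall 0 1) :=
    interior_maximal (by rintro _ ⟨z, hz, rfl⟩; simpa using h.maps z hz)
      (isOpen_image_of_injOn hD h.diff h.inj hD subset_rfl)
  rw [interior_closedBall _ one_ne_zero] at h1
  simpa using h1 ⟨z, hz, rfl⟩

/-- A square root `s` of `z - p` is injective and never takes both a value and its negative. So its
image misses a disc about `-s a`, and inversion about `-s a` makes it bounded. -/
theorem exists_isDiscEmbedding {D : Set ℂ} {a p : ℂ} (hD : IsOpen D) (hs : HasSqrts D)
    (ha : a ∈ D) (hp : p ∉ D) : ∃ f, IsDiscEmbedding D a f := by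
  obtain ⟨s, hsd, hsq⟩ := hs (fun z => z - p) (by fun_prop)
    (fun z hz h0 => hp (by rwa [← sub_eq_zero.1 h0]))
  have hinj : InjOn s D := by
    intro z hz w hw h
    have := hsq z hz
    rw [h, hsq w hw] at this
    exact (sub_left_injective this).symm
  obtain ⟨ρ, hρ, hball⟩ := Metric.isOpen_iff.1 (isOpen_image_of_injOn hD hsd hinj hD subset_rfl)
    (s a) ⟨a, ha, rfl⟩
  have hfar : ∀ z ∈ D, ρ ≤ ‖s z + s a‖ := by
    intro z hz
    by_contra! hlt
    obtain ⟨w, hw, hwz⟩ := hball (show -s z ∈ Metric.ball (s a) ρ by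
      rwa [Metric.mem_ball, dist_eq_norm, show -s z - s a = -(s z + s a) by ring, norm_neg])
    have hzw : w = z := by
      have h1 := hsq w hw
      rw [hwz, neg_sq, hsq z hz] at h1
      exact (sub_left_injective h1).symm
    rw [hzw] at hwz
    have h2 : s z = 0 := by linear_combination (1 / 2 : ℂ) * hwz
    have h3 := hsq z hz
    rw [h2] at h3
    apply hp
    have : z = p := by linear_combination -h3
    rwa [← this]
  have hne : ∀ z ∈ D, s z + s a ≠ 0 := fun z hz h0 => by
    have := hfar z hz
    rw [h0, norm_zero] at this
    linarith
  set f1 : ℂ → ℂ := fun z => ((ρ / 3 : ℝ) : ℂ) / (s z + s a)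
  have hf1 : ∀ z ∈ D, ‖f1 z‖ ≤ 1 / 3 := by
    intro z hz
    simp only [f1]
    rw [norm_div, Complex.norm_real, Real.norm_eq_abs, abs_of_pos (by positivity),
      div_le_iff₀ (norm_pos_iff.2 (hne z hz))]
    linarith [hfar z hz]
  refine ⟨fun z => f1 z - f1 a, ?_, ?_, ?_, ?_⟩
  · exact ((differentiableOn_const _).div (hsd.add_const _) hne).sub_const _
  · intro z hz
    linarith [norm_sub_le (f1 z) (f1 a), hf1 z hz, hf1 a ha]
  · intro z hz w hw h
    have h1 : f1 z = f1 w := by linear_combination h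
    have hρ0 : ((ρ / 3 : ℝ) : ℂ) ≠ 0 := by
      rw [Complex.ofReal_ne_zero]; positivity
    have h2 : s z + s a = s w + s a := by
      simp only [f1] at h1
      rw [div_eq_div_iff (hne z hz) (hne w hw)] at h1
      exact (mul_left_cancel₀ hρ0 h1).symm
    exact hinj hz hw (add_right_cancel h2)
  · simp

/-- Uniformly bounded holomorphic functions are equicontinuous. -/
theorem dist_le_of_norm_le_one {f : ℂ → ℂ} {z₀ z : ℂ} {r : ℝ}
    (hf : DifferentiableOn ℂ f (Metric.ball z₀ r)) (hm : ∀ w ∈ Metric.ball z₀ r, ‖f w‖ ≤ 1)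
    (hz : z ∈ Metric.ball z₀ r) : dist (f z) (f z₀) ≤ 3 / r * dist z z₀ := by
  have hr : 0 < r := dist_nonneg.trans_lt hz
  refine Complex.dist_le_div_mul_dist_of_mapsTo_ball hf (fun w hw => ?_) hz
  rw [Metric.mem_closedBall, dist_eq_norm]
  linarith [norm_sub_le (f w) (f z₀), hm w hw, hm z₀ (Metric.mem_ball_self hr)]

/-- **Montel's theorem** along an ultrafilter. -/
theorem exists_tendstoLocallyUniformlyOn {D : Set ℂ} (hD : IsOpen D) {ι : Type*} (𝒰 : Ultrafilter ι)
    {f : ι → ℂ → ℂ} (hf : ∀ n, DifferentiableOn ℂ (f n) D) (hm : ∀ n, ∀ z ∈ D, ‖f n z‖ ≤ 1) :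
    ∃ g : ℂ → ℂ, TendstoLocallyUniformlyOn f g 𝒰 D := by
  have hex : ∀ z ∈ D, ∃ y, Tendsto (fun n => f n z) 𝒰 (𝓝 y) := by
    intro z hz
    obtain ⟨y, -, hy⟩ := (isCompact_closedBall (0 : ℂ) 1).ultrafilter_le_nhds
      (𝒰.map fun n => f n z) (by
        rw [le_principal_iff]
        exact Eventually.of_forall (f := (𝒰 : Filter ι)) fun n => by simpa using hm n z hz)
    exact ⟨y, hy⟩
  choose! g hg using hex
  refine ⟨g, Metric.tendstoLocallyUniformlyOn_iff.2 fun ε hε z₀ hz₀ => ?_⟩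
  obtain ⟨r, hr, hball⟩ := Metric.isOpen_iff.1 hD z₀ hz₀
  set ρ : ℝ := min r (r * ε / 12)
  have hρ : 0 < ρ := by positivity
  have hequi : ∀ n, ∀ z ∈ Metric.ball z₀ ρ, dist (f n z) (f n z₀) ≤ ε / 4 := by
    intro n z hz
    have hz' : z ∈ Metric.ball z₀ r := Metric.ball_subset_ball (min_le_left _ _) hz
    have h1 := dist_le_of_norm_le_one ((hf n).mono hball) (fun w hw => hm n w (hball hw)) hz'
    have h2 : dist z z₀ ≤ r * ε / 12 := (Metric.mem_ball.1 hz).le.trans (min_le_right _ _)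
    calc dist (f n z) (f n z₀) ≤ 3 / r * (r * ε / 12) := h1.trans (by gcongr)
      _ = ε / 4 := by field_simp; ring
  refine ⟨Metric.ball z₀ ρ, mem_nhdsWithin_of_mem_nhds (Metric.ball_mem_nhds z₀ hρ), ?_⟩
  filter_upwards [(hg z₀ hz₀).eventually (Metric.ball_mem_nhds _ (by positivity : 0 < ε / 4))]
    with n hn z hz
  have hzD : z ∈ D := hball (Metric.ball_subset_ball (min_le_left _ _) hz)
  have h1 : dist (g z) (g z₀) ≤ ε / 4 :=
    le_of_tendsto ((hg z hzD).dist (hg z₀ hz₀)) (Eventually.of_forall fun n => hequi n z hz)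
  have h2 := hequi n z hz
  have h3 : dist (f n z₀) (g z₀) < ε / 4 := hn
  calc dist (g z) (f n z) ≤ dist (g z) (g z₀) + dist (g z₀) (f n z₀) + dist (f n z₀) (f n z) :=
        dist_triangle4 _ _ _ _
    _ < ε := by rw [dist_comm (g z₀), dist_comm (f n z₀) (f n z)]; linarith

/-- **Hurwitz's theorem** on limits of injective functions. -/
theorem injOn_of_tendstoLocallyUniformlyOn {D : Set ℂ} (hD : IsOpen D) (hc : IsPreconnected D)
    {ι : Type*} {l : Filter ι} [l.NeBot] {f : ι → ℂ → ℂ} {g : ℂ → ℂ}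
    (hf : ∀ n, DifferentiableOn ℂ (f n) D) (hinj : ∀ n, InjOn (f n) D)
    (hfg : TendstoLocallyUniformlyOn f g l D) {a : ℂ} (ha : a ∈ D) (hga : deriv g a ≠ 0) :
    InjOn g D := by
  have hg : DifferentiableOn ℂ g D := hfg.differentiableOn (Eventually.of_forall hf) hD
  have hgan : AnalyticOnNhd ℂ g D := hg.analyticOnNhd hD
  intro z₁ h₁ z₂ h₂ heq
  by_contra hne
  have hev : ∀ᶠ z in 𝓝[≠] z₁, g z ≠ g z₁ := by
    by_contra hfr
    rw [not_eventually] at hfr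
    have hfr' : ∃ᶠ z in 𝓝[≠] z₁, g z = (fun _ => g z₁) z := hfr.mono fun z hz => not_not.1 hz
    have h3 := hgan.eqOn_of_preconnected_of_frequently_eq
      (analyticOnNhd_const (v := g z₁)) hc h₁ hfr'
    have h4 : g =ᶠ[𝓝 a] fun _ => g z₁ := by
      filter_upwards [hD.mem_nhds ha] with z hz using h3 hz
    exact hga (by rw [h4.deriv_eq]; simp)
  rw [eventually_nhdsWithin_iff] at hev
  obtain ⟨r, hr, hball⟩ := Metric.nhds_basis_closedBall.mem_iff.1
    (inter_mem (hD.mem_nhds h₁) (inter_mem hev (isOpen_ne.mem_nhds hne)))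
  have hsub : Metric.closedBall z₁ r ⊆ D := fun z hz => (hball hz).1
  have hz₂ : z₂ ∉ Metric.closedBall z₁ r := fun hz => (hball hz).2.2 rfl
  obtain ⟨m, hm, hmle⟩ : ∃ m > 0, ∀ z ∈ Metric.sphere z₁ r, m ≤ ‖g z - g z₁‖ := by
    have hne : (Metric.sphere z₁ r).Nonempty := NormedSpace.sphere_nonempty.2 hr.le
    obtain ⟨w, hw, hmin⟩ := (isCompact_sphere z₁ r).exists_isMinOn hne
      ((hg.continuousOn.mono (Metric.sphere_subset_closedBall.trans hsub)).sub
        (continuousOn_const (c := g z₁))).norm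
    refine ⟨‖g w - g z₁‖, norm_pos_iff.2 (sub_ne_zero.2 ?_), fun z hz => hmin hz⟩
    exact (hball (Metric.sphere_subset_closedBall hw)).2.1 (Metric.ne_of_mem_sphere hw hr.ne')
  have hunif := (tendstoLocallyUniformlyOn_iff_forall_isCompact hD).1 hfg
    (Metric.closedBall z₁ r ∪ {z₂}) (union_subset hsub (singleton_subset_iff.2 h₂))
    ((isCompact_closedBall _ _).union isCompact_singleton)
  obtain ⟨n, hn⟩ := (Metric.tendstoUniformlyOn_iff.1 hunif (m / 8) (by positivity)).exists
  have hz₁n := hn z₁ (Or.inl (Metric.mem_closedBall_self hr.le))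
  have hz₂n := hn z₂ (Or.inr rfl)
  rw [dist_eq_norm] at hz₁n hz₂n
  have hsphere : ∀ z ∈ Metric.sphere z₁ r, m / 2 ≤ ‖f n z - f n z₁‖ := by
    intro z hz
    have h5 := hn z (Or.inl (Metric.sphere_subset_closedBall hz))
    rw [dist_eq_norm] at h5
    have h6 := hmle z hz
    have h7 : ‖g z - g z₁‖ ≤ ‖g z - f n z‖ + ‖f n z - f n z₁‖ + ‖g z₁ - f n z₁‖ := by
      have : g z - g z₁ = (g z - f n z) + (f n z - f n z₁) - (g z₁ - f n z₁) := by ring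
      rw [this]
      exact (norm_sub_le _ _).trans (by gcongr; exact norm_add_le _ _)
    linarith
  have hcl : DiffContOnCl ℂ (f n) (Metric.ball z₁ r) := DifferentiableOn.diffContOnCl (by
    rw [closure_ball _ hr.ne']; exact (hf n).mono hsub)
  -- Quantitative open mapping: `f n z₂` is within `m / 4` of `f n z₁`, so it is also a value of `f
  -- n` on the closed disc about `z₁`, which excludes `z₂`.
  have himg := hcl.ball_subset_image_closedBall hr hsphere (by
    have : ∀ᶠ z in 𝓝[≠] z₁, f n z ≠ f n z₁ := by
      filter_upwards [self_mem_nhdsWithin, nhdsWithin_le_nhds (hD.mem_nhds h₁)] with z hz hzD h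
      exact hz (hinj n hzD h₁ h)
    exact this.frequently.filter_mono nhdsWithin_le_nhds)
  obtain ⟨w, hw, hwz⟩ := himg (show f n z₂ ∈ Metric.ball (f n z₁) (m / 2 / 2) by
    rw [Metric.mem_ball, dist_eq_norm]
    have : f n z₂ - f n z₁ = (g z₁ - f n z₁) - (g z₂ - f n z₂) := by rw [heq]; ring
    rw [this]
    linarith [norm_sub_le (g z₁ - f n z₁) (g z₂ - f n z₂)])
  have := hinj n (hsub hw) h₂ hwz
  exact hz₂ (this ▸ hw)

/-- The Koebe square-root trick. -/
theorem IsDiscEmbedding.exists_norm_deriv_lt {D : Set ℂ} {a : ℂ} {f : ℂ → ℂ}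
    (h : IsDiscEmbedding D a f) (hD : IsOpen D) (hs : HasSqrts D) (ha : a ∈ D) {w : ℂ}
    (hw : ‖w‖ < 1) (hwf : ∀ z ∈ D, f z ≠ w) :
    ∃ f', IsDiscEmbedding D a f' ∧ ‖deriv f a‖ < ‖deriv f' a‖ := by
  have hf1 : ∀ z ∈ D, ‖f z‖ < 1 := fun z hz => h.norm_lt_one hD hz
  have hw0 : w ≠ 0 := fun h0 => hwf a ha (by rw [h.zero, h0])
  obtain ⟨s, hsd, hsq⟩ := hs (fun z => discShift w (f z))
    (differentiableOn_discShift_comp hw h.diff hf1)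
    (fun z hz => div_ne_zero (sub_ne_zero.2 (hwf z hz)) (one_sub_conj_mul_ne_zero hw (hf1 z hz)))
  have hs1 : ∀ z ∈ D, ‖s z‖ < 1 := by
    intro z hz
    have h1 := norm_discShift_lt_one hw (hf1 z hz)
    rw [← hsq z hz, norm_pow] at h1
    nlinarith [norm_nonneg (s z)]
  have hb1 := hs1 a ha
  have hbsq : s a ^ 2 = -w := by
    rw [hsq a ha, h.zero, discShift]
    simp
  have hbn : ‖s a‖ ^ 2 = ‖w‖ := by rw [← norm_pow, hbsq, norm_neg]
  have hb0 : s a ≠ 0 := fun h0 => by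
    rw [h0] at hbsq
    apply hw0
    simpa using hbsq.symm
  refine ⟨fun z => discShift (s a) (s z), ⟨differentiableOn_discShift_comp hb1 hsd hs1,
    fun z hz => (norm_discShift_lt_one hb1 (hs1 z hz)).le, ?_, by simp [discShift]⟩, ?_⟩
  · intro z hz v hv hzv
    have h1 := injOn_discShift hb1 (by simpa using hs1 z hz) (by simpa using hs1 v hv) hzv
    have h2 : discShift w (f z) = discShift w (f v) := by rw [← hsq z hz, ← hsq v hv, h1]
    exact h.inj hz hv (injOn_discShift hw (by simpa using hf1 z hz) (by simpa using hf1 v hv) h2)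
  · have hfa := (h.diff.differentiableAt (hD.mem_nhds ha)).hasDerivAt
    have hsa := (hsd.differentiableAt (hD.mem_nhds ha)).hasDerivAt
    -- With `b = ‖s a‖`, so `b² = ‖w‖`, this identity shows that the derivative at `a` grows by the
    -- factor `(1 + b²) / (2b) > 1`.
    have h1 : 2 * s a * deriv s a = (1 - conj w * w) * deriv f a := by
      have e1 : HasDerivAt (fun z => s z ^ 2) (2 * s a * deriv s a) a := by
        simpa using hsa.fun_pow 2
      have e2 := (hasDerivAt_discShift hw (hf1 a ha)).comp a hfa
      have e3 : (fun z => s z ^ 2) =ᶠ[𝓝 a] (discShift w ∘ f) := by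
        filter_upwards [hD.mem_nhds ha] with z hz using hsq z hz
      have e4 := e1.unique (e2.congr_of_eventuallyEq e3)
      rw [e4, h.zero]
      simp
    have h2 := (hasDerivAt_discShift hb1 (hs1 a ha)).comp a hsa
    have h3 : deriv (fun z => discShift (s a) (s z)) a = deriv s a / (1 - conj (s a) * s a) := by
      have hne := one_sub_conj_mul_ne_zero hb1 hb1
      rw [show (fun z => discShift (s a) (s z)) = discShift (s a) ∘ s from rfl, h2.deriv]
      field_simp
    have h4 := congrArg norm h1
    rw [norm_mul, norm_mul, norm_mul, norm_one_sub_conj_mul_self hw, Complex.norm_ofNat] at h4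
    have hfa0 : 0 < ‖deriv f a‖ := norm_pos_iff.2 (deriv_ne_zero_of_injOn hD h.diff h.inj ha)
    rw [h3, norm_div, norm_one_sub_conj_mul_self hb1]
    set b := ‖s a‖
    have hbpos : 0 < b := norm_pos_iff.2 hb0
    have h5 : 0 < 1 - b ^ 2 := by nlinarith
    rw [lt_div_iff₀ h5, ← hbn] at *
    have h6 : 2 * b * (‖deriv f a‖ * (1 - b ^ 2)) < 2 * b * ‖deriv s a‖ := by
      rw [h4]
      have h7 : 0 < (1 - b ^ 2) * ‖deriv f a‖ := mul_pos h5 hfa0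
      have h8 : 2 * b < 1 + b ^ 2 := by nlinarith [sq_nonneg (1 - b)]
      calc 2 * b * (‖deriv f a‖ * (1 - b ^ 2)) = (2 * b) * ((1 - b ^ 2) * ‖deriv f a‖) := by ring
        _ < (1 + b ^ 2) * ((1 - b ^ 2) * ‖deriv f a‖) := by gcongr
        _ = (1 - (b ^ 2) ^ 2) * ‖deriv f a‖ := by ring
    exact lt_of_mul_lt_mul_left h6 (by positivity)

/-- Maximize `‖f' a‖` over the embeddings, a set bounded by Cauchy's estimate. An ultrafilter limit
of a maximizing sequence has nonzero derivative, hence is injective by Hurwitz, and a value missed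
in the disc would contradict maximality by Koebe's trick. -/
theorem exists_riemann_map {D : Set ℂ} {a p : ℂ} (hD : IsOpen D) (hc : IsPreconnected D)
    (hs : HasSqrts D) (ha : a ∈ D) (hp : p ∉ D) :
    ∃ f : ℂ → ℂ, DifferentiableOn ℂ f D ∧ BijOn f D (Metric.ball 0 1) ∧ f a = 0 := by
  obtain ⟨f₀, hf₀⟩ := exists_isDiscEmbedding hD hs ha hp
  obtain ⟨r, hr, hball⟩ := Metric.nhds_basis_closedBall.mem_iff.1 (hD.mem_nhds ha)
  set V : Set ℝ := {x | ∃ f, IsDiscEmbedding D a f ∧ x = ‖deriv f a‖}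
  have hVb : BddAbove V := by
    refine ⟨1 / r, ?_⟩
    rintro _ ⟨f, hf, rfl⟩
    refine Complex.norm_deriv_le_of_forall_mem_sphere_norm_le hr (DifferentiableOn.diffContOnCl ?_)
      fun z hz => hf.maps z (hball (Metric.sphere_subset_closedBall hz))
    rw [closure_ball _ hr.ne']
    exact hf.diff.mono hball
  have hV₀ : ‖deriv f₀ a‖ ∈ V := ⟨f₀, hf₀, rfl⟩
  obtain ⟨u, -, hu, huV⟩ := exists_seq_tendsto_sSup ⟨_, hV₀⟩ hVb
  choose f hf hfu using huV
  obtain ⟨g, hg⟩ := exists_tendstoLocallyUniformlyOn hD (hyperfilter ℕ) (fun n => (hf n).diff)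
    (fun n => (hf n).maps)
  have hgd : DifferentiableOn ℂ g D :=
    hg.differentiableOn (Eventually.of_forall fun n => (hf n).diff) hD
  have hderiv : ‖deriv g a‖ = sSup V := by
    have h1 := (hg.deriv (Eventually.of_forall fun n => (hf n).diff) hD).tendsto_at ha
    have h2 : Tendsto (fun n => ‖deriv (f n) a‖) (hyperfilter ℕ) (𝓝 (sSup V)) := by
      have h3 := hu.mono_left (show (hyperfilter ℕ : Filter ℕ) ≤ atTop from Nat.hyperfilter_le_atTop)
      exact h3.congr hfu
    exact tendsto_nhds_unique h1.norm h2
  have hga : deriv g a ≠ 0 := by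
    rw [← norm_pos_iff, hderiv]
    refine lt_of_lt_of_le ?_ (le_csSup hVb hV₀)
    exact norm_pos_iff.2 (deriv_ne_zero_of_injOn hD hf₀.diff hf₀.inj ha)
  have hgE : IsDiscEmbedding D a g := by
    refine ⟨hgd, fun z hz => ?_, ?_, ?_⟩
    · exact le_of_tendsto (hg.tendsto_at hz).norm (Eventually.of_forall fun n => (hf n).maps z hz)
    · exact injOn_of_tendstoLocallyUniformlyOn hD hc (fun n => (hf n).diff) (fun n => (hf n).inj) hg
        ha hga
    · refine tendsto_nhds_unique (hg.tendsto_at ha) ?_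
      simp only [(hf _).zero]
      exact tendsto_const_nhds
  refine ⟨g, hgd, ⟨fun z hz => by simpa using hgE.norm_lt_one hD hz, hgE.inj, fun w hw => ?_⟩,
    hgE.zero⟩
  by_contra hwg
  obtain ⟨f', hf', hlt⟩ := hgE.exists_norm_deriv_lt hD hs ha (w := w) (by simpa using hw)
    fun z hz h => hwg ⟨z, hz, h⟩
  rw [hderiv] at hlt
  exact absurd (le_csSup hVb ⟨f', hf', rfl⟩) (not_le.2 hlt)

/-! ### Existence of the hydrodynamic map -/


/-- The Schwarz lemma for `f₁ ∘ f₂⁻¹` gives `‖f₁‖ ≤ ‖f₂‖`. The quotient, extended across `0`, has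
modulus at most `1` and equals `1` at `0`, hence is constant. -/
theorem riemann_map_unique {D : Set ℂ} (hD : IsOpen D) (hc : IsPreconnected D) (h0 : (0 : ℂ) ∈ D)
    {f₁ f₂ : ℂ → ℂ} (hf₁ : DifferentiableOn ℂ f₁ D) (hf₂ : DifferentiableOn ℂ f₂ D)
    (hb₁ : BijOn f₁ D (Metric.ball 0 1)) (hb₂ : BijOn f₂ D (Metric.ball 0 1)) (h₁ : f₁ 0 = 0)
    (h₂ : f₂ 0 = 0) (hd : deriv f₁ 0 = deriv f₂ 0) : EqOn f₁ f₂ D := by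
  have hle : ∀ {f₁ f₂ : ℂ → ℂ}, DifferentiableOn ℂ f₁ D → DifferentiableOn ℂ f₂ D →
      BijOn f₁ D (Metric.ball 0 1) → BijOn f₂ D (Metric.ball 0 1) → f₁ 0 = 0 → f₂ 0 = 0 →
      ∀ w ∈ D, ‖f₁ w‖ ≤ ‖f₂ w‖ := by
    intro f₁ f₂ hf₁ hf₂ hb₁ hb₂ h₁ h₂ w hw
    have hk := differentiableOn_invFunOn hD hf₂ hb₂.injOn
    have hkm : MapsTo (Function.invFunOn f₂ D) (Metric.ball 0 1) D := fun ζ hζ =>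
      Function.invFunOn_mem (by rw [← hb₂.image_eq] at hζ; exact hζ)
    rw [hb₂.image_eq] at hk
    have := Complex.norm_le_norm_of_mapsTo_ball (f := f₁ ∘ Function.invFunOn f₂ D) (R := 1)
      (hf₁.comp hk hkm) (fun ζ hζ => Metric.ball_subset_closedBall (hb₁.mapsTo (hkm hζ)))
      (by
        have : Function.invFunOn f₂ D (f₂ 0) = 0 := hb₂.injOn.leftInvOn_invFunOn h0
        rw [h₂] at this
        rw [Function.comp_apply, this, h₁])
      (z := f₂ w) (by simpa using hb₂.mapsTo hw)
    rwa [Function.comp_apply, hb₂.injOn.leftInvOn_invFunOn hw] at this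
  have hne₂ : ∀ w ∈ D, dslope f₂ 0 w ≠ 0 := by
    intro w hw
    by_cases hw0 : w = 0
    · rw [hw0, dslope_same]
      exact deriv_ne_zero_of_injOn hD hf₂ hb₂.injOn h0
    · rw [dslope_of_ne _ hw0, slope_def_field, h₂]
      refine div_ne_zero ?_ (by simpa using hw0)
      intro h
      exact hw0 (hb₂.injOn hw h0 (by rw [h₂]; simpa using h))
  set q : ℂ → ℂ := fun w => dslope f₁ 0 w / dslope f₂ 0 w
  have hq : DifferentiableOn ℂ q D :=
    ((Complex.differentiableOn_dslope (hD.mem_nhds h0)).2 hf₁).div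
      ((Complex.differentiableOn_dslope (hD.mem_nhds h0)).2 hf₂) hne₂
  have hq0 : q 0 = 1 := by
    have := hne₂ 0 h0
    simp only [q, dslope_same] at this ⊢
    rw [hd, div_self this]
  have hmax : IsMaxOn (norm ∘ q) D 0 := by
    intro w hw
    change ‖q w‖ ≤ ‖q 0‖
    rw [hq0, norm_one]
    by_cases hw0 : w = 0
    · rw [hw0, hq0, norm_one]
    · have := hne₂ w hw
      simp only [q]
      rw [norm_div, div_le_one (norm_pos_iff.2 this), dslope_of_ne _ hw0, dslope_of_ne _ hw0,
        slope_def_field, slope_def_field, h₁, h₂, norm_div, norm_div]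
      gcongr
      simpa using hle hf₁ hf₂ hb₁ hb₂ h₁ h₂ w hw
  have hconst := Complex.eqOn_of_isPreconnected_of_isMaxOn_norm hc hD hq h0 hmax
  intro w hw
  by_cases hw0 : w = 0
  · rw [hw0, h₁, h₂]
  · have h3 : q w = 1 := (hconst hw).trans hq0
    have := hne₂ w hw
    simp only [q] at h3
    rw [div_eq_one_iff_eq this, dslope_of_ne _ hw0, dslope_of_ne _ hw0, slope_def_field,
      slope_def_field, h₁, h₂, sub_zero, sub_zero, sub_zero, div_left_inj' hw0] at h3
    exact h3

theorem conj_deriv_zero {f : ℂ → ℂ} {D : Set ℂ} (hD : D ∈ 𝓝 (0 : ℂ))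
    (hsymm : ∀ w ∈ D, f (conj w) = conj (f w)) : deriv f 0 = conj (deriv f 0) := by
  have h1 : f =ᶠ[𝓝 0] (conj ∘ f ∘ conj) := by
    filter_upwards [hD] with w hw
    simp [hsymm w hw]
  by_cases hf : DifferentiableAt ℂ f 0
  · have h2 : HasDerivAt f (deriv f 0) (conj (0 : ℂ)) := by simpa using hf.hasDerivAt
    have h3 := h2.conj_conj
    simp only [Complex.conj_conj] at h3
    have h4 := h3.congr_of_eventuallyEq h1
    exact h4.deriv
  · rw [deriv_zero_of_not_differentiableAt hf, map_zero]

theorem dslope_conj {f : ℂ → ℂ} {D : Set ℂ} (hD : D ∈ 𝓝 (0 : ℂ))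
    (hsymm : ∀ w ∈ D, f (conj w) = conj (f w)) {w : ℂ} (hw : w ∈ D) :
    dslope f 0 (conj w) = conj (dslope f 0 w) := by
  by_cases hw0 : w = 0
  · rw [hw0, map_zero, dslope_same]
    exact conj_deriv_zero hD hsymm
  · have h0 := hsymm 0 (mem_of_mem_nhds hD)
    rw [map_zero] at h0
    rw [dslope_of_ne _ hw0, dslope_of_ne _ (by simpa using hw0), slope_def_field, slope_def_field,
      hsymm w hw, map_div₀, map_sub, map_sub, map_zero, ← h0]

/-! ### The Joukowsky map on the punctured unit disc -/

/-- The roots of `ξ² - uξ + 1` have product `1`, so one has modulus at most `1`; modulus exactly `1`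
would make `u = ξ + conj ξ` real. -/
theorem exists_joukowsky_preimage {u : ℂ} (hu : 0 < u.im) :
    ∃ ξ : ℂ, ξ ≠ 0 ∧ ‖ξ‖ < 1 ∧ ξ⁻¹ + ξ = u := by
  obtain ⟨d, hd⟩ : ∃ d : ℂ, d ^ 2 = u ^ 2 - 4 := IsAlgClosed.exists_pow_nat_eq _ two_pos
  have hprod : (u + d) / 2 * ((u - d) / 2) = 1 := by linear_combination -(1 / 4 : ℂ) * hd
  have key : ∀ ξ ξ' : ℂ, ξ * ξ' = 1 → ξ + ξ' = u → ‖ξ‖ ≤ 1 →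
      ξ ≠ 0 ∧ ‖ξ‖ < 1 ∧ ξ⁻¹ + ξ = u := by
    intro ξ ξ' hm hs hn
    have hξ : ξ ≠ 0 := left_ne_zero_of_mul_eq_one hm
    have hinv : ξ⁻¹ = ξ' := inv_eq_of_mul_eq_one_right hm
    refine ⟨hξ, lt_of_le_of_ne hn fun h1 => ?_, by rw [hinv, add_comm, hs]⟩
    rw [Complex.inv_eq_conj h1] at hinv
    rw [← hs, ← hinv, Complex.add_im, Complex.conj_im] at hu
    linarith
  rcases le_total ‖(u + d) / 2‖ 1 with h | h
  · exact ⟨_, key _ _ hprod (by ring) h⟩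
  · refine ⟨_, key ((u - d) / 2) ((u + d) / 2) (by rw [mul_comm, hprod]) (by ring) ?_⟩
    have h1 := congrArg norm hprod
    rw [norm_mul, norm_one] at h1
    nlinarith [norm_nonneg ((u - d) / 2)]

theorem joukowsky_im (ξ : ℂ) : (ξ⁻¹ + ξ).im = ξ.im * (1 - (‖ξ‖ ^ 2)⁻¹) := by
  rw [Complex.add_im, Complex.inv_im, Complex.normSq_eq_norm_sq]
  ring

theorem joukowsky_injOn {ξ η : ℂ} (hξ0 : ξ ≠ 0) (hη0 : η ≠ 0) (hξ : ‖ξ‖ < 1) (hη : ‖η‖ < 1)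
    (h : ξ⁻¹ + ξ = η⁻¹ + η) : ξ = η := by
  have h1 : (ξ - η) * (1 - ξ * η) = 0 := by
    field_simp at h
    linear_combination -h
  refine sub_eq_zero.1 ((mul_eq_zero.1 h1).resolve_right fun h2 => ?_)
  have h3 : ‖ξ * η‖ = 1 := by rw [← sub_eq_zero.1 h2, norm_one]
  rw [norm_mul] at h3
  nlinarith [norm_nonneg ξ, norm_nonneg η]

/-- The hull of `ℍ \ Ω`, symmetrized and completed by a real segment. -/
def symmHull (Ω : Set ℂ) (R : ℝ) : Set ℂ := {z | ‖z‖ ≤ R ∧ z ∉ Ω ∧ conj z ∉ Ω}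

/-- The image under `z ↦ 1/z` of the complement of `symmHull Ω R` in the sphere. -/
def invDomain (Ω : Set ℂ) (R : ℝ) : Set ℂ := {w | w = 0 ∨ w⁻¹ ∉ symmHull Ω R}

section InvDomain

variable {Ω : Set ℂ} {R : ℝ}

theorem ofReal_notMem_of_subset (hsub : Ω ⊆ upperHalf) (x : ℝ) : (x : ℂ) ∉ Ω := fun h => by
  have : 0 < (x : ℂ).im := hsub h
  simp at this

theorem isClosed_symmHull (hΩ : IsOpen Ω) : IsClosed (symmHull Ω R) :=
  (isClosed_le continuous_norm continuous_const).inter (hΩ.isClosed_compl.inter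
    (hΩ.isClosed_compl.preimage Complex.continuous_conj))

theorem ofReal_mem_symmHull (hsub : Ω ⊆ upperHalf) {x : ℝ} (hx : |x| ≤ R) :
    (x : ℂ) ∈ symmHull Ω R :=
  ⟨by simpa using hx, ofReal_notMem_of_subset hsub x, by
    rw [Complex.conj_ofReal]; exact ofReal_notMem_of_subset hsub x⟩

theorem ball_subset_invDomain (hR : 0 < R) : Metric.ball 0 R⁻¹ ⊆ invDomain Ω R := by
  intro w hw
  by_cases hw0 : w = 0
  · exact Or.inl hw0
  · refine Or.inr fun h => ?_
    have h1 := h.1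
    rw [norm_inv] at h1
    rw [mem_ball_zero_iff] at hw
    have := (inv_lt_inv₀ (inv_pos.2 hR) (norm_pos_iff.2 hw0)).2 hw
    rw [inv_inv] at this
    linarith

theorem isOpen_invDomain (hΩ : IsOpen Ω) (hR : 0 < R) : IsOpen (invDomain Ω R) := by
  rw [isOpen_iff_mem_nhds]
  intro w hw
  by_cases hw0 : w = 0
  · rw [hw0]
    exact mem_of_superset (Metric.ball_mem_nhds 0 (inv_pos.2 hR)) (ball_subset_invDomain hR)
  · have h1 := (continuousAt_inv₀ hw0).preimage_mem_nhds
      ((isClosed_symmHull (R := R) hΩ).isOpen_compl.mem_nhds (hw.resolve_left hw0))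
    exact mem_of_superset h1 fun v hv => Or.inr hv

theorem conj_mem_invDomain {w : ℂ} (hw : w ∈ invDomain Ω R) : conj w ∈ invDomain Ω R := by
  rcases hw with rfl | hw
  · exact Or.inl (map_zero _)
  · refine Or.inr fun h => hw ?_
    rw [← map_inv₀] at h
    exact ⟨by simpa using h.1, by simpa using h.2.2, h.2.1⟩

theorem inv_mem_invDomain {z : ℂ} (hz : z ∈ Ω) : z⁻¹ ∈ invDomain Ω R :=
  Or.inr fun h => h.2.1 (by rwa [inv_inv])

/-- The domain is the union of a disc about `0`, the inverted `Ω` and its mirror image; the latter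
two both meet the disc. -/
theorem isPreconnected_invDomain (hc : IsPreconnected Ω) (hsub : Ω ⊆ upperHalf)
    (hR : 0 < R) (hfar : ∀ z ∈ upperHalf, R < ‖z‖ → z ∈ Ω) :
    IsPreconnected (invDomain Ω R) := by
  have hne : ∀ z ∈ Ω, z ≠ 0 := fun z hz h0 =>
    ofReal_notMem_of_subset hsub 0 (by simpa [h0] using hz)
  have h1 : IsPreconnected (Inv.inv '' Ω) :=
    hc.image _ fun z hz => (continuousAt_inv₀ (hne z hz)).continuousWithinAt
  have h2 : IsPreconnected (conj '' (Inv.inv '' Ω)) :=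
    h1.image _ Complex.continuous_conj.continuousOn
  set p : ℂ := ((R + 1 : ℝ) : ℂ) * Complex.I
  have hpn : ‖p‖ = R + 1 := by
    simp only [p]
    rw [norm_mul, Complex.norm_I, mul_one, Complex.norm_real, Real.norm_eq_abs,
      abs_of_pos (by linarith)]
  have hp : p ∈ Ω := hfar _ (by simp only [upperHalf, p, mem_ofPred_eq]; simp; linarith)
    (by rw [hpn]; linarith)
  have hpb : p⁻¹ ∈ Metric.ball (0 : ℂ) R⁻¹ := by
    rw [mem_ball_zero_iff, norm_inv, hpn]
    exact (inv_lt_inv₀ (by linarith) hR).2 (by linarith)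
  have h3 := IsPreconnected.union p⁻¹ hpb (mem_image_of_mem _ hp)
    (convex_ball (0 : ℂ) R⁻¹).isPreconnected h1
  have h4 := IsPreconnected.union (conj p⁻¹)
    (Or.inl (by rw [mem_ball_zero_iff, RCLike.norm_conj]; simpa using hpb)) (mem_image_of_mem _ (mem_image_of_mem _ hp)) h3 h2
  convert h4 using 1
  ext w
  constructor
  · rintro (rfl | hw)
    · exact Or.inl (Or.inl (Metric.mem_ball_self (inv_pos.2 hR)))
    · by_cases hwΩ : w⁻¹ ∈ Ω
      · exact Or.inl (Or.inr ⟨_, hwΩ, inv_inv w⟩)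
      by_cases hwΩ' : conj w⁻¹ ∈ Ω
      · refine Or.inr ⟨conj w, ⟨_, hwΩ', ?_⟩, Complex.conj_conj w⟩
        rw [map_inv₀, inv_inv]
      · have hn : R < ‖w⁻¹‖ := by
          by_contra! hle
          exact hw ⟨hle, hwΩ, hwΩ'⟩
        refine Or.inl (Or.inl ?_)
        rw [mem_ball_zero_iff]
        rw [norm_inv] at hn
        have hwpos : 0 < ‖w‖ := inv_pos.1 (hR.trans hn)
        have := (inv_lt_inv₀ (inv_pos.2 hwpos) hR).2 hn
        rwa [inv_inv] at this
  · rintro ((hw | ⟨z, hz, rfl⟩) | ⟨_, ⟨z, hz, rfl⟩, rfl⟩)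
    · exact ball_subset_invDomain hR hw
    · exact inv_mem_invDomain hz
    · exact conj_mem_invDomain (inv_mem_invDomain hz)

/-- The winding number about `q⁻¹` is locally constant for `q` in the connected set `symmHull Ω R`,
and it is zero near `q = 0`, which stands for the point at infinity. -/
theorem noWinding_invDomain (hsub : Ω ⊆ upperHalf) (hR : 0 < R)
    (hQ : IsPreconnected (symmHull Ω R)) : NoWinding (invDomain Ω R) := by
  classical
  intro K hK J hJ z hz
  have hz0 : z ≠ 0 := fun h => hz (Or.inl h)
  have hzQ : z⁻¹ ∈ symmHull Ω R := by
    by_contra h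
    exact hz (Or.inr h)
  set N : ℂ → ℂ := fun q => if q = 0 then 0 else J (fun w => (w - q⁻¹)⁻¹)
  have hloc : ∀ q ∈ symmHull Ω R, ∀ᶠ q' in 𝓝[symmHull Ω R] q, N q = N q' ∧ N q' = N q := by
    intro q hq
    have : ∀ᶠ q' in 𝓝 q, N q' = N q := by
      by_cases hq0 : q = 0
      · have h1 := tendsto_inv₀_nhdsNE_zero.eventually hJ.eventually_winding_eq_zero
        rw [eventually_nhdsWithin_iff] at h1
        rw [hq0]
        filter_upwards [h1] with q' hq'
        by_cases hq'0 : q' = 0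
        · rw [hq'0]
        · simp only [N, hq'0, if_false, if_true]
          exact (hq' hq'0).2
      · have hqK : q⁻¹ ∉ K := fun h => by
          rcases hK h with h2 | h2
          · exact inv_ne_zero hq0 h2
          · rw [inv_inv] at h2; exact h2 hq
        filter_upwards [(continuousAt_inv₀ hq0).eventually (hJ.eventually_winding_eq hqK),
          isOpen_ne.mem_nhds hq0] with q' hq' hne
        have hne' : q' ≠ 0 := hne
        simp only [N, hq0, hne', if_false]
        exact hq'.2
    filter_upwards [nhdsWithin_le_nhds this] with q' h
    exact ⟨h.symm, h⟩
  have h0 : (0 : ℂ) ∈ symmHull Ω R := by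
    simpa using ofReal_mem_symmHull (x := 0) hsub (by simpa using hR.le)
  have := hQ.induction₂' (fun a b => N a = N b) hloc (fun x y z _ _ _ h h' => h.trans h') hzQ h0
  simp only [N, inv_eq_zero, hz0, if_false, if_true, inv_inv] at this
  exact this

end InvDomain

/-- `g` is the Joukowsky map applied to the symmetric Riemann map `F` at `1/z`, scaled and shifted
to the right normalization. It is real at a point of `Ω` only if `F` is, and by symmetry and
injectivity of `F` only if the point is real; so `Im g` has one sign on `Ω`. -/
theorem exists_isHydro {Ω : Set ℂ} {R : ℝ} (hΩ : IsOpen Ω) (hsub : Ω ⊆ upperHalf) (hR : 0 < R)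
    (hfar : ∀ z ∈ upperHalf, R < ‖z‖ → z ∈ Ω) (hc : IsPreconnected Ω)
    (hQ : IsPreconnected (symmHull Ω R)) :
    ∃ g E : ℂ → ℂ, IsHydro Ω g ∧ DifferentiableOn ℂ E (Metric.ball 0 R⁻¹) ∧ E 0 = 0 ∧
      (∀ w ∈ Metric.ball (0 : ℂ) R⁻¹, E (conj w) = conj (E w)) ∧ ∀ z, g z = z + E z⁻¹ := by
  set D := invDomain Ω R
  have hDo : IsOpen D := isOpen_invDomain hΩ hR
  have hDc : IsPreconnected D := isPreconnected_invDomain hc hsub hR hfar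
  have h0D : (0 : ℂ) ∈ D := Or.inl rfl
  have hD0 : D ∈ 𝓝 (0 : ℂ) := hDo.mem_nhds h0D
  have hRD : ((R : ℂ))⁻¹ ∉ D := by
    rintro (h | h)
    · rw [inv_eq_zero, Complex.ofReal_eq_zero] at h
      exact hR.ne' h
    · rw [inv_inv] at h
      exact h (ofReal_mem_symmHull hsub (abs_of_pos hR).le)
  obtain ⟨F₀, hF₀d, hF₀b, hF₀0⟩ := exists_riemann_map hDo hDc
    (fun h hh hne => (noWinding_invDomain hsub hR hQ).exists_sqrt hDo hDc hh hne) h0D hRD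
  have hd₀ : deriv F₀ 0 ≠ 0 := deriv_ne_zero_of_injOn hDo hF₀d hF₀b.injOn h0D
  set c : ℝ := ‖deriv F₀ 0‖
  have hc0 : 0 < c := norm_pos_iff.2 hd₀
  have hcC : (c : ℂ) ≠ 0 := by exact_mod_cast hc0.ne'
  -- The rotation makes `F' 0 = c` positive; uniqueness of the Riemann map then yields `F (conj w) =
  -- conj (F w)`.
  set ω : ℂ := c / deriv F₀ 0
  have hω : ‖ω‖ = 1 := by
    simp only [ω]
    rw [norm_div, Complex.norm_real, norm_norm, div_self hc0.ne']
  have hω0 : ω ≠ 0 := by rw [← norm_pos_iff, hω]; exact one_pos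
  set F : ℂ → ℂ := fun w => ω * F₀ w
  have hFd : DifferentiableOn ℂ F D := hF₀d.const_mul ω
  have hFb : BijOn F D (Metric.ball 0 1) := by
    refine ⟨fun w hw => ?_, fun w hw v hv h => hF₀b.injOn hw hv (mul_left_cancel₀ hω0 h), ?_⟩
    · have := hF₀b.mapsTo hw
      rw [mem_ball_zero_iff] at this ⊢
      rwa [norm_mul, hω, one_mul]
    · intro ζ hζ
      obtain ⟨w, hw, hwζ⟩ := hF₀b.surjOn (show ω⁻¹ * ζ ∈ Metric.ball 0 1 by
        rw [mem_ball_zero_iff] at hζ ⊢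
        rwa [norm_mul, norm_inv, hω, inv_one, one_mul])
      exact ⟨w, hw, by simp only [F]; rw [hwζ, mul_inv_cancel_left₀ hω0]⟩
  have hF0 : F 0 = 0 := by simp only [F]; rw [hF₀0, mul_zero]
  have hFder : deriv F 0 = c := by
    have h1 := ((hF₀d.differentiableAt hD0).hasDerivAt.const_mul ω).deriv
    simp only [F]
    rw [h1]
    simp only [ω]
    field_simp
  have hFsymm : ∀ w ∈ D, F (conj w) = conj (F w) := by
    have hder : ∀ w ∈ D, HasDerivAt (conj ∘ F ∘ conj) (conj (deriv F (conj w))) w := by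
      intro w hw
      have h1 : HasDerivAt F (deriv F (conj w)) (conj w) :=
        (hFd.differentiableAt (hDo.mem_nhds (conj_mem_invDomain hw))).hasDerivAt
      simpa using h1.conj_conj
    have h1 := riemann_map_unique (f₁ := conj ∘ F ∘ conj) hDo hDc h0D
      (fun w hw => (hder w hw).differentiableAt.differentiableWithinAt) hFd
      ⟨fun w hw => by simpa using hFb.mapsTo (conj_mem_invDomain hw), ?_, ?_⟩ hFb
      (by simp [hF0]) hF0 (by rw [(hder 0 h0D).deriv, map_zero, hFder, Complex.conj_ofReal])
    · intro w hw
      have := h1 (conj_mem_invDomain hw)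
      simp only [Function.comp_apply, Complex.conj_conj] at this
      exact this.symm
    · intro w hw v hv h
      simp only [Function.comp_apply] at h
      have h2 := (starRingEnd ℂ).injective h
      have h3 := hFb.injOn (conj_mem_invDomain hw) (conj_mem_invDomain hv) h2
      exact (starRingEnd ℂ).injective h3
    · intro ζ hζ
      obtain ⟨w, hw, hwζ⟩ := hFb.surjOn (show conj ζ ∈ Metric.ball 0 1 by simpa using hζ)
      exact ⟨conj w, conj_mem_invDomain hw, by simp [hwζ]⟩
  have hFne : ∀ w ∈ D, w ≠ 0 → F w ≠ 0 := fun w hw hw0 h =>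
    hw0 (hFb.injOn hw h0D (by rw [h, hF0]))
  have hdsl : ∀ w : ℂ, w ≠ 0 → dslope F 0 w = F w / w := fun w hw => by
    rw [dslope_of_ne _ hw, slope_def_field, hF0, sub_zero, sub_zero]
  have hdsne : ∀ w ∈ D, dslope F 0 w ≠ 0 := by
    intro w hw
    by_cases hw0 : w = 0
    · rw [hw0, dslope_same, hFder]; exact hcC
    · rw [hdsl w hw0]; exact div_ne_zero (hFne w hw hw0) hw0
  -- `M w = w (c / F w + c F w)` with the singularity at `0` removed; subtracting its value `1` and
  -- dividing by `w` leaves the expansion `E`, once `b` is subtracted.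
  set M : ℂ → ℂ := fun w => c / dslope F 0 w + c * w * F w
  have hMd : DifferentiableOn ℂ M D := by
    refine ((differentiableOn_const _).div ((Complex.differentiableOn_dslope hD0).2 hFd) hdsne).add ?_
    exact DifferentiableOn.mul (by fun_prop) hFd
  have hM0 : M 0 = 1 := by
    simp only [M, dslope_same]
    rw [hFder, div_self hcC, mul_zero, zero_mul, add_zero]
  have hMsymm : ∀ w ∈ D, M (conj w) = conj (M w) := by
    intro w hw
    simp only [M]
    rw [dslope_conj hD0 hFsymm hw, hFsymm w hw]
    simp
  set b : ℂ := deriv M 0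
  have hb : b = conj b := conj_deriv_zero hD0 hMsymm
  have hbim : b.im = 0 := Complex.conj_eq_iff_im.1 hb.symm
  set E : ℂ → ℂ := fun w => dslope M 0 w - b
  have hEd : DifferentiableOn ℂ E D := ((Complex.differentiableOn_dslope hD0).2 hMd).sub_const b
  have hE0 : E 0 = 0 := by simp only [E, dslope_same]; exact sub_self _
  have hEsymm : ∀ w ∈ D, E (conj w) = conj (E w) := by
    intro w hw
    simp only [E]
    rw [dslope_conj hD0 hMsymm hw, map_sub, ← hb]
  set g : ℂ → ℂ := fun z => z + E z⁻¹
  have hg : ∀ z : ℂ, z ≠ 0 → z⁻¹ ∈ D → g z = c * ((F z⁻¹)⁻¹ + F z⁻¹) - b := by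
    intro z hz hzD
    have h1 := hFne _ hzD (inv_ne_zero hz)
    simp only [g, E]
    rw [dslope_of_ne _ (inv_ne_zero hz), slope_def_field, hM0]
    simp only [M]
    rw [hdsl _ (inv_ne_zero hz)]
    field_simp
    ring
  have hΩ0 : ∀ z ∈ Ω, z ≠ 0 := fun z hz h0 =>
    ofReal_notMem_of_subset hsub 0 (by simpa [h0] using hz)
  have hgd : DifferentiableOn ℂ g Ω :=
    differentiableOn_id.add (hEd.comp (differentiableOn_inv.mono fun z hz => hΩ0 z hz)
      fun z hz => inv_mem_invDomain hz)
  have hgasymp : ∀ ε > 0, ∃ R' : ℝ, ∀ z : ℂ, R' < ‖z‖ → ‖g z - z‖ < ε := by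
    intro ε hε
    have h1 : Tendsto (fun z : ℂ => E z⁻¹) (cobounded ℂ) (𝓝 0) := by
      have h2 := (hEd.continuousOn.continuousAt hD0).tendsto
      rw [hE0] at h2
      exact h2.comp tendsto_inv₀_cobounded
    have h3 := h1.eventually (Metric.ball_mem_nhds 0 hε)
    rw [← comap_norm_atTop, eventually_comap, eventually_atTop] at h3
    obtain ⟨R', hR'⟩ := h3
    refine ⟨R', fun z hz => ?_⟩
    have := hR' ‖z‖ hz.le z rfl
    simp only [g, add_sub_cancel_left]
    simpa using this
  have hgim : ∀ z : ℂ, z ≠ 0 → z⁻¹ ∈ D → (g z).im = c * ((F z⁻¹).im * (1 - (‖F z⁻¹‖ ^ 2)⁻¹)) := by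
    intro z hz hzD
    rw [hg z hz hzD, Complex.sub_im, hbim, sub_zero, Complex.im_ofReal_mul, joukowsky_im]
  have hFnorm : ∀ w ∈ D, ‖F w‖ < 1 := fun w hw => by simpa using hFb.mapsTo hw
  have hgne : ∀ z ∈ Ω, (g z).im ≠ 0 := by
    intro z hz h
    have hzD : z⁻¹ ∈ D := inv_mem_invDomain hz
    rw [hgim z (hΩ0 z hz) hzD] at h
    have hFpos : 0 < ‖F z⁻¹‖ := norm_pos_iff.2 (hFne _ hzD (inv_ne_zero (hΩ0 z hz)))
    have hF1 := hFnorm _ hzD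
    have h1 : 1 - (‖F z⁻¹‖ ^ 2)⁻¹ ≠ 0 := by
      rw [sub_ne_zero]
      intro h2
      rw [eq_comm, inv_eq_one] at h2
      nlinarith
    have h2 : (F z⁻¹).im = 0 := by
      rcases mul_eq_zero.1 h with h3 | h3
      · exact absurd h3 hc0.ne'
      · exact (mul_eq_zero.1 h3).resolve_right h1
    have h3 : F (conj z⁻¹) = F z⁻¹ := by
      rw [hFsymm _ hzD, Complex.conj_eq_iff_im.2 h2]
    have h4 := hFb.injOn (conj_mem_invDomain hzD) hzD h3
    rw [map_inv₀, inv_inj, Complex.conj_eq_iff_im] at h4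
    have h5 : 0 < z.im := hsub hz
    linarith
  have hgpos : ∀ z ∈ Ω, 0 < (g z).im := by
    obtain ⟨R', hR'⟩ := hgasymp 1 one_pos
    set T : ℝ := |R'| + R + 1
    have hT : 0 < T := by positivity
    have hTn : ‖(T : ℂ) * Complex.I‖ = T := by simp [abs_of_pos hT]
    have hTΩ : (T : ℂ) * Complex.I ∈ Ω := hfar _
      (by simp only [upperHalf, mem_ofPred_eq]; simpa using hT)
      (by rw [hTn]; simp only [T]; linarith [abs_nonneg R'])
    have hTpos : 0 < (g (T * Complex.I)).im := by
      have h1 := hR' (T * Complex.I) (by rw [hTn]; simp only [T]; linarith [le_abs_self R'])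
      have h2 := (Complex.abs_im_le_norm _).trans_lt h1
      rw [Complex.sub_im, abs_lt] at h2
      have h3 : ((T : ℂ) * Complex.I).im = T := by simp
      rw [h3] at h2
      have : 1 ≤ T := by simp only [T]; linarith [abs_nonneg R']
      linarith
    intro z hz
    by_contra! hle
    have hconn := (hc.image _ (Complex.continuous_im.comp_continuousOn hgd.continuousOn)).ordConnected
    obtain ⟨v, hv, hv0⟩ := hconn.out ⟨z, hz, rfl⟩ ⟨_, hTΩ, rfl⟩
      (show (0 : ℝ) ∈ Icc (g z).im (g (T * Complex.I)).im from ⟨hle, hTpos.le⟩)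
    exact hgne v hv hv0
  have hginj : InjOn g Ω := by
    intro z hz v hv h
    have hzD : z⁻¹ ∈ D := inv_mem_invDomain hz
    have hvD : v⁻¹ ∈ D := inv_mem_invDomain hv
    rw [hg z (hΩ0 z hz) hzD, hg v (hΩ0 v hv) hvD, sub_left_inj] at h
    have h1 := joukowsky_injOn (hFne _ hzD (inv_ne_zero (hΩ0 z hz)))
      (hFne _ hvD (inv_ne_zero (hΩ0 v hv))) (hFnorm _ hzD) (hFnorm _ hvD) (mul_left_cancel₀ hcC h)
    exact inv_injective (hFb.injOn hzD hvD h1)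
  have hgsurj : SurjOn g Ω upperHalf := by
    intro u hu
    have hu' : 0 < ((u + b) / c).im := by
      rw [Complex.div_ofReal_im, Complex.add_im, hbim, add_zero]
      exact div_pos hu hc0
    obtain ⟨ξ, hξ0, hξ1, hξ⟩ := exists_joukowsky_preimage hu'
    obtain ⟨w, hw, rfl⟩ := hFb.surjOn (show ξ ∈ Metric.ball 0 1 by simpa using hξ1)
    have hw0 : w ≠ 0 := fun h => hξ0 (by rw [h, hF0])
    have hgu : g w⁻¹ = u := by
      rw [hg _ (inv_ne_zero hw0) (by rwa [inv_inv]), inv_inv, hξ]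
      field_simp
      ring
    refine ⟨w⁻¹, ?_, hgu⟩
    -- The preimage `w⁻¹` of `u` might lie in the mirror image of `Ω` or outside both. The conjugate
    -- point has value `conj u`, which excludes the mirror image, and beyond radius `R` the
    -- remaining points are real.
    have hconjg : g (conj w⁻¹) = conj u := by
      have h1 := hEsymm w hw
      rw [← hgu]
      simp only [g]
      rw [map_add, inv_inv, ← h1, ← map_inv₀, inv_inv]
    have hunotreal : 0 < u.im := hu
    by_contra hwΩ
    have hwΩ' : conj w⁻¹ ∉ Ω := fun h => by
      have := hgpos _ h
      rw [hconjg, Complex.conj_im] at this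
      linarith
    have hn : R < ‖w⁻¹‖ := by
      by_contra! hle
      exact (hw.resolve_left hw0) ⟨hle, hwΩ, hwΩ'⟩
    rcases lt_trichotomy (w⁻¹).im 0 with h | h | h
    · refine hwΩ' (hfar _ ?_ (by simpa using hn))
      change 0 < (conj w⁻¹).im
      rw [Complex.conj_im]; linarith
    · rw [Complex.conj_eq_iff_im.2 h, hgu] at hconjg
      have := Complex.conj_eq_iff_im.1 hconjg.symm
      linarith
    · exact hwΩ (hfar _ h hn)
  refine ⟨g, E, ⟨hΩ, hsub, ⟨R, hfar⟩, hgd, ⟨hgpos, hginj, hgsurj⟩, fun ε hε => ?_⟩,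
    hEd.mono (ball_subset_invDomain hR), hE0,
    fun w hw => hEsymm w (ball_subset_invDomain hR hw), fun z => rfl⟩
  obtain ⟨R', hR'⟩ := hgasymp ε hε
  exact ⟨R', fun z _ hz => hR' z hz⟩

/-! ### The unbounded part of the complement of a compact set -/

/-- The union of the unbounded connected components of `ℍ \ Γ`. -/
def unboundedPart (Γ : Set ℂ) : Set ℂ :=
  {z | z ∈ upperHalf \ Γ ∧ ¬ IsBounded (connectedComponentIn (upperHalf \ Γ) z)}

section unboundedPart

variable {Γ Γ' : Set ℂ} {R : ℝ}

theorem not_isBounded_upperHalf_outside (R : ℝ) :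
    ¬ IsBounded {z : ℂ | 0 < z.im ∧ R < ‖z - (0 : ℝ)‖} := by
  intro h
  obtain ⟨M, hM⟩ := h.exists_norm_le
  have hpos : 0 < max M R + |R| + 1 + |M| := by
    have := neg_abs_le R
    have := le_max_right M R
    have := abs_nonneg M
    linarith
  have hn : ‖((max M R + |R| + 1 + |M| : ℝ) : ℂ) * Complex.I‖ = max M R + |R| + 1 + |M| := by
    rw [norm_mul, Complex.norm_I, mul_one, Complex.norm_real, Real.norm_eq_abs, abs_of_pos hpos]
  have := hM (((max M R + |R| + 1 + |M| : ℝ) : ℂ) * Complex.I) (by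
    rw [mem_ofPred_eq]
    constructor
    · rw [Complex.im_ofReal_mul, Complex.I_im, mul_one]
      exact hpos
    · rw [Complex.ofReal_zero, sub_zero, hn]
      have := le_max_right M R
      have := abs_nonneg M
      have := abs_nonneg R
      linarith)
  rw [hn] at this
  have := le_max_left M R
  have := abs_nonneg M
  have := abs_nonneg R
  linarith

theorem unboundedPart_subset : unboundedPart Γ ⊆ upperHalf := fun _ hz => hz.1.1

theorem disjoint_unboundedPart : Disjoint (unboundedPart Γ) Γ :=
  disjoint_left.2 fun _ hz => hz.1.2

theorem outside_subset_connectedComponentIn (hR : 0 ≤ R) (hΓ : ∀ z ∈ Γ, ‖z‖ ≤ R) {p : ℂ}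
    (hp : p ∈ upperHalf) (hpR : R < ‖p‖) :
    {z : ℂ | 0 < z.im ∧ R < ‖z - (0 : ℝ)‖} ⊆ connectedComponentIn (upperHalf \ Γ) p := by
  refine (isPreconnected_upperHalf_outside 0 R hR).subset_connectedComponentIn ?_ ?_
  · exact ⟨hp, by simpa using hpR⟩
  · rintro z ⟨hz, hzR⟩
    refine ⟨hz, fun h => ?_⟩
    have := hΓ z h
    simp only [Complex.ofReal_zero, sub_zero] at hzR
    linarith

theorem mem_unboundedPart_of_lt_norm (hR : 0 ≤ R) (hΓ : ∀ z ∈ Γ, ‖z‖ ≤ R) {p : ℂ}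
    (hp : p ∈ upperHalf) (hpR : R < ‖p‖) : p ∈ unboundedPart Γ :=
  ⟨⟨hp, fun h => (hΓ p h).not_gt hpR⟩, fun h => not_isBounded_upperHalf_outside R
    (h.subset (outside_subset_connectedComponentIn hR hΓ hp hpR))⟩

/-- There is only one unbounded component, since each one meets the connected region outside a
half-disc containing `Γ`. -/
theorem unboundedPart_eq (hR : 0 ≤ R) (hΓ : ∀ z ∈ Γ, ‖z‖ ≤ R) {p : ℂ}
    (hp : p ∈ upperHalf) (hpR : R < ‖p‖) :
    unboundedPart Γ = connectedComponentIn (upperHalf \ Γ) p := by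
  ext z
  constructor
  · intro hz
    obtain ⟨w, hw, hwR⟩ : ∃ w ∈ connectedComponentIn (upperHalf \ Γ) z, R < ‖w‖ := by
      by_contra! h
      exact hz.2 (isBounded_iff_forall_norm_le.2 ⟨R, h⟩)
    have hwH := connectedComponentIn_subset _ _ hw
    have h1 := outside_subset_connectedComponentIn hR hΓ hp hpR
      (show w ∈ _ from ⟨hwH.1, by simpa using hwR⟩)
    rw [connectedComponentIn_eq h1, ← connectedComponentIn_eq hw]
    exact mem_connectedComponentIn hz.1
  · intro hz
    refine ⟨connectedComponentIn_subset _ _ hz, ?_⟩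
    rw [← connectedComponentIn_eq hz]
    exact (mem_unboundedPart_of_lt_norm hR hΓ hp hpR).2

theorem exists_mem_upperHalf_lt_norm (R : ℝ) : ∃ p ∈ upperHalf, R < ‖p‖ := by
  by_contra! h
  refine not_isBounded_upperHalf_outside 0 (isBounded_iff_forall_norm_le.2 ⟨R, ?_⟩)
  exact fun z hz => h z hz.1

theorem isPreconnected_unboundedPart (hR : 0 ≤ R) (hΓ : ∀ z ∈ Γ, ‖z‖ ≤ R) :
    IsPreconnected (unboundedPart Γ) := by
  obtain ⟨p, hp, hpR⟩ := exists_mem_upperHalf_lt_norm R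
  rw [unboundedPart_eq hR hΓ hp hpR]
  exact isPreconnected_connectedComponentIn

theorem isOpen_unboundedPart (hR : 0 ≤ R) (hΓ : ∀ z ∈ Γ, ‖z‖ ≤ R) (hc : IsClosed Γ) :
    IsOpen (unboundedPart Γ) := by
  obtain ⟨p, hp, hpR⟩ := exists_mem_upperHalf_lt_norm R
  rw [unboundedPart_eq hR hΓ hp hpR]
  exact (isOpen_upperHalf.sdiff hc).connectedComponentIn

theorem subset_unboundedPart {S : Set ℂ} (hS : IsPreconnected S) (hsub : S ⊆ upperHalf \ Γ)
    (hmeet : (S ∩ unboundedPart Γ).Nonempty) : S ⊆ unboundedPart Γ := by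
  obtain ⟨x, hxS, hx⟩ := hmeet
  intro z hz
  refine ⟨hsub hz, ?_⟩
  have := hS.subset_connectedComponentIn hxS hsub hz
  rw [← connectedComponentIn_eq this]
  exact hx.2

theorem unboundedPart_anti (h : Γ ⊆ Γ') : unboundedPart Γ' ⊆ unboundedPart Γ := by
  intro z hz
  refine ⟨⟨hz.1.1, fun hz' => hz.1.2 (h hz')⟩, fun hb => hz.2 (hb.subset ?_)⟩
  exact connectedComponentIn_mono z (sdiff_subset_sdiff_right h)

theorem mem_of_mem_closure_connectedComponentIn {F : Set ℂ} (hF : IsOpen F) {x z : ℂ}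
    (hz : z ∈ closure (connectedComponentIn F x)) (hzF : z ∈ F) :
    z ∈ connectedComponentIn F x := by
  obtain ⟨w, hw, hw'⟩ := mem_closure_iff.1 hz _ hF.connectedComponentIn
    (mem_connectedComponentIn hzF)
  rw [connectedComponentIn_eq hw', ← connectedComponentIn_eq hw]
  exact mem_connectedComponentIn hzF

theorem mem_of_mem_closure_unboundedPart (hR : 0 ≤ R) (hΓ : ∀ z ∈ Γ, ‖z‖ ≤ R)
    (hc : IsClosed Γ) {z : ℂ} (hzH : z ∈ upperHalf) (hz : z ∈ closure (unboundedPart Γ))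
    (hzn : z ∉ unboundedPart Γ) : z ∈ Γ := by
  by_contra h
  obtain ⟨p, hp, hpR⟩ := exists_mem_upperHalf_lt_norm R
  rw [unboundedPart_eq hR hΓ hp hpR] at hz hzn
  exact hzn (mem_of_mem_closure_connectedComponentIn (isOpen_upperHalf.sdiff hc) hz ⟨hzH, h⟩)

theorem conj_mem_symmHull {Ω : Set ℂ} {z : ℂ} (hz : z ∈ symmHull Ω R) : conj z ∈ symmHull Ω R :=
  ⟨by simpa using hz.1, hz.2.2, by simpa using hz.2.1⟩

/-- `Γ` meets the real line, so `Γ ∪ [-R, R]` is connected. A bounded component of `ℍ \ Γ` has a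
frontier point, which must lie in this set, so its closure is attached to it. Points below the real
line follow by conjugation. -/
theorem isPreconnected_symmHull_unboundedPart (hR : 0 < R) (hΓ : ∀ z ∈ Γ, ‖z‖ ≤ R)
    (hc : IsClosed Γ) (hconn : IsPreconnected Γ) (him : ∀ z ∈ Γ, 0 ≤ z.im)
    (hreal : ∃ z ∈ Γ, z.im = 0) : IsPreconnected (symmHull (unboundedPart Γ) R) := by
  set Ω := unboundedPart Γ with hΩdef
  have hsub : Ω ⊆ upperHalf := unboundedPart_subset
  have hlow : ∀ z : ℂ, z.im ≤ 0 → z ∉ Ω := fun z hz h => (hsub h : 0 < z.im).not_ge hz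
  have hmem : ∀ z : ℂ, 0 ≤ z.im → ‖z‖ ≤ R → z ∉ Ω → z ∈ symmHull Ω R := fun z hz hn hzΩ =>
    ⟨hn, hzΩ, hlow _ (by simpa using hz)⟩
  set I : Set ℂ := Complex.ofReal '' Icc (-R) R
  have hI : IsPreconnected I := isPreconnected_Icc.image _ Complex.continuous_ofReal.continuousOn
  have hI' : ∀ z : ℂ, z.im = 0 → ‖z‖ ≤ R → z ∈ I := by
    intro z hz hn
    have hz' : z = (z.re : ℂ) := Complex.ext (by simp) (by simpa using hz)
    refine ⟨z.re, abs_le.1 ?_, hz'.symm⟩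
    exact (Complex.abs_re_le_norm z).trans hn
  have h0I : (0 : ℂ) ∈ I := ⟨0, ⟨by linarith, by linarith⟩, by simp⟩
  have hT : IsPreconnected (Γ ∪ I) := by
    obtain ⟨x, hx, hx0⟩ := hreal
    exact IsPreconnected.union x hx (hI' x hx0 (hΓ x hx)) hconn hI
  have hTsub : Γ ∪ I ⊆ symmHull Ω R := by
    rintro z (hz | ⟨x, hx, rfl⟩)
    · exact hmem z (him z hz) (hΓ z hz) fun h => disjoint_left.1 disjoint_unboundedPart h hz
    · exact hmem _ (by simp) (by simpa using abs_le.2 hx) (hlow _ (by simp))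
  have key : ∀ q ∈ symmHull Ω R, 0 ≤ q.im →
      ∃ S ⊆ symmHull Ω R, (0 : ℂ) ∈ S ∧ q ∈ S ∧ IsPreconnected S := by
    intro q hq hq0
    rcases hq0.eq_or_lt with hq0 | hq0
    · exact ⟨Γ ∪ I, hTsub, Or.inr h0I, Or.inr (hI' q hq0.symm hq.1), hT⟩
    by_cases hqΓ : q ∈ Γ
    · exact ⟨Γ ∪ I, hTsub, Or.inr h0I, Or.inl hqΓ, hT⟩
    set F := upperHalf \ Γ
    have hF : IsOpen F := isOpen_upperHalf.sdiff hc
    set V := connectedComponentIn F q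
    have hqV : q ∈ V := mem_connectedComponentIn ⟨hq0, hqΓ⟩
    have hVF : V ⊆ F := connectedComponentIn_subset _ _
    have hVΩ : Disjoint V Ω := by
      rw [disjoint_left]
      intro z hzV hzΩ
      exact hq.2.1 (subset_unboundedPart isPreconnected_connectedComponentIn hVF
        ⟨z, hzV, hzΩ⟩ hqV)
    have hVR : V ⊆ Metric.closedBall 0 R := by
      intro z hz
      rw [mem_closedBall_zero_iff]
      by_contra! h
      exact disjoint_left.1 hVΩ hz (mem_unboundedPart_of_lt_norm hR.le hΓ (hVF hz).1 h)
    have hclim : closure V ⊆ {z : ℂ | 0 ≤ z.im} :=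
      closure_minimal (fun z hz => (show 0 < z.im from (hVF hz).1).le)
        (isClosed_le continuous_const Complex.continuous_im)
    have hcl : closure V ⊆ symmHull Ω R := by
      intro z hz
      have him : 0 ≤ z.im := hclim hz
      have hn : ‖z‖ ≤ R := by
        simpa using closure_minimal hVR Metric.isClosed_closedBall hz
      exact hmem z him hn fun h => disjoint_left.1
        (hVΩ.closure_left (isOpen_unboundedPart hR.le hΓ hc)) hz h
    obtain ⟨z, hz⟩ : (frontier V).Nonempty := by
      refine nonempty_frontier_iff.2 ⟨⟨q, hqV⟩, fun h => ?_⟩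
      have : (0 : ℂ) ∈ V := h ▸ mem_univ _
      simpa [upperHalf] using (hVF this).1
    rw [hF.connectedComponentIn.frontier_eq] at hz
    have hzT : z ∈ Γ ∪ I := by
      by_contra hzn
      rw [mem_union, not_or] at hzn
      refine hz.2 (mem_of_mem_closure_connectedComponentIn hF hz.1 ⟨?_, hzn.1⟩)
      have hzs := hcl hz.1
      exact lt_of_le_of_ne (hclim hz.1) fun h => hzn.2 (hI' z h.symm hzs.1)
    exact ⟨closure V ∪ (Γ ∪ I), union_subset hcl hTsub, Or.inr (Or.inr h0I),
      Or.inl (subset_closure hqV),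
      IsPreconnected.union z hz.1 hzT isPreconnected_connectedComponentIn.closure hT⟩
  refine isPreconnected_of_forall 0 fun q hq => ?_
  rcases le_total 0 q.im with h | h
  · exact key q hq h
  · obtain ⟨S, hS, h0, hqS, hSc⟩ := key (conj q) (conj_mem_symmHull hq) (by simpa using h)
    refine ⟨conj '' S, ?_, ⟨0, h0, map_zero _⟩, ⟨_, hqS, Complex.conj_conj q⟩,
      hSc.image _ Complex.continuous_conj.continuousOn⟩
    rintro _ ⟨z, hz, rfl⟩
    exact conj_mem_symmHull (hS hz)

end unboundedPart

/-! ### The domains of a growing path -/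

section pathDomain

variable {γ : ℝ≥0 → ℂ}

theorem exists_norm_le_of_le (hγ : Continuous γ) (t : ℝ≥0) : ∃ R > 0, ∀ s ≤ t, ‖γ s‖ ≤ R := by
  have hcomp : IsCompact (γ '' Iic t) := by
    rw [← Icc_bot]
    exact isCompact_Icc.image hγ
  obtain ⟨R, hR⟩ := hcomp.isBounded.exists_norm_le
  exact ⟨max R 1, by positivity, fun s hs => (hR _ ⟨s, hs, rfl⟩).trans (le_max_left _ _)⟩

theorem isClosed_image_Iic (hγ : Continuous γ) (t : ℝ≥0) : IsClosed (γ '' Iic t) := by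
  rw [← Icc_bot]
  exact (isCompact_Icc.image hγ).isClosed

theorem forall_mem_image_Iic {R : ℝ} {t : ℝ≥0} (h : ∀ s ≤ t, ‖γ s‖ ≤ R) :
    ∀ z ∈ γ '' Iic t, ‖z‖ ≤ R := by
  rintro _ ⟨s, hs, rfl⟩
  exact h s hs

theorem pathDomain_subset (γ : ℝ≥0 → ℂ) (t : ℝ≥0) : pathDomain γ t ⊆ upperHalf :=
  unboundedPart_subset

theorem isOpen_pathDomain (hγ : Continuous γ) (t : ℝ≥0) : IsOpen (pathDomain γ t) := by
  obtain ⟨R, hR, h⟩ := exists_norm_le_of_le hγ t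
  exact isOpen_unboundedPart hR.le (forall_mem_image_Iic h) (isClosed_image_Iic hγ t)

theorem isPreconnected_pathDomain (hγ : Continuous γ) (t : ℝ≥0) :
    IsPreconnected (pathDomain γ t) := by
  obtain ⟨R, hR, h⟩ := exists_norm_le_of_le hγ t
  exact isPreconnected_unboundedPart hR.le (forall_mem_image_Iic h)

theorem mem_pathDomain_of_lt_norm {R : ℝ} (hR : 0 ≤ R) {t : ℝ≥0} (h : ∀ s ≤ t, ‖γ s‖ ≤ R) {z : ℂ}
    (hz : z ∈ upperHalf) (hzR : R < ‖z‖) : z ∈ pathDomain γ t :=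
  mem_unboundedPart_of_lt_norm hR (forall_mem_image_Iic h) hz hzR

theorem pathDomain_antitone (γ : ℝ≥0 → ℂ) : Antitone (pathDomain γ) := fun _ _ h =>
  unboundedPart_anti (image_mono (Iic_subset_Iic.2 h))

theorem notMem_pathDomain {s t : ℝ≥0} (h : s ≤ t) : γ s ∉ pathDomain γ t := fun hs =>
  disjoint_left.1 disjoint_unboundedPart hs ⟨s, h, rfl⟩

theorem exists_eq_of_mem_closure_pathDomain (hγ : Continuous γ) {t : ℝ≥0} {z : ℂ}
    (hzH : z ∈ upperHalf) (hz : z ∈ closure (pathDomain γ t)) (hzn : z ∉ pathDomain γ t) :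
    ∃ s ≤ t, γ s = z := by
  obtain ⟨R, hR, h⟩ := exists_norm_le_of_le hγ t
  exact mem_of_mem_closure_unboundedPart hR.le (forall_mem_image_Iic h)
    (isClosed_image_Iic hγ t) hzH hz hzn

theorem upperHalf_diff_pathHull (hγ : Continuous γ) (t : ℝ≥0) :
    upperHalf \ pathHull γ t = pathDomain γ t := by
  ext z
  constructor
  · rintro ⟨hz, hzK⟩
    by_contra h
    exact hzK (subset_closure ⟨hz, h⟩)
  · intro hz
    refine ⟨pathDomain_subset γ t hz, fun h => ?_⟩
    obtain ⟨w, hw, hw'⟩ := mem_closure_iff.1 h _ (isOpen_pathDomain hγ t) hz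
    exact hw'.2 hw

/-- If the path stayed outside `H_a` during `(a, b]`, the connected set `H_a` would avoid `γ[0, b]`,
so `H_a ⊆ H_b`, contrary to strict growth of the hulls. -/
theorem IsGrowingPath.exists_mem_pathDomain (hγ : IsGrowingPath γ) {a b : ℝ≥0} (hab : a < b) :
    ∃ v ∈ Ioc a b, γ v ∈ pathDomain γ a := by
  by_contra! h
  obtain ⟨R, hR, hn⟩ := exists_norm_le_of_le hγ.continuous b
  obtain ⟨p, hp, hpR⟩ := exists_mem_upperHalf_lt_norm R
  have hsub : pathDomain γ a ⊆ pathDomain γ b := by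
    refine subset_unboundedPart (isPreconnected_pathDomain hγ.continuous a) ?_
      ⟨p, mem_pathDomain_of_lt_norm hR.le (fun s hs => hn s (hs.trans hab.le)) hp hpR,
        mem_pathDomain_of_lt_norm hR.le hn hp hpR⟩
    intro z hz
    refine ⟨pathDomain_subset γ a hz, ?_⟩
    rintro ⟨v, hv, rfl⟩
    rcases le_or_gt v a with hva | hva
    · exact notMem_pathDomain hva hz
    · exact h v ⟨hva, hv⟩ hz
  exact (hγ.strictMono_hull hab).not_ge (closure_mono (sdiff_subset_sdiff_right hsub))

theorem IsGrowingPath.exists_mem_pathDomain_of_le (hγ : IsGrowingPath γ) {s a b : ℝ≥0}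
    (hsa : s ≤ a) (hab : a < b) : ∃ v ∈ Ioc a b, γ v ∈ pathDomain γ s := by
  obtain ⟨v, hv, h⟩ := hγ.exists_mem_pathDomain hab
  exact ⟨v, hv, pathDomain_antitone γ hsa h⟩

/-- The local reflection property is chained along `[v, w]`, with visible times serving as
junctions. The radius doubles because discs about points of the path replace the disc about `p`. -/
theorem IsGrowingPath.joinedIn (hγ : IsGrowingPath γ) {s v w : ℝ≥0} (hsv : s ≤ v)
    (hv : γ v ∈ pathDomain γ s) (hw : γ w ∈ pathDomain γ s) (hvw : v ≤ w) {p : ℂ} {ε : ℝ}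
    (hε : 0 < ε) (hball : ∀ u ∈ Icc v w, γ u ∈ Metric.ball p ε) :
    JoinedIn (pathDomain γ s ∩ Metric.ball p (2 * ε)) (γ v) (γ w) := by
  -- The relation concerns visible times near `x` and near `y`, since `γ x` and `γ y` themselves
  -- need not lie in `H_s`.
  set P : ℝ≥0 → ℝ≥0 → Prop := fun x y => ∃ δ > 0, ∀ a ∈ Icc v w, ∀ b ∈ Icc v w,
    dist a x < δ → dist b y < δ → γ a ∈ pathDomain γ s → γ b ∈ pathDomain γ s →
      JoinedIn (pathDomain γ s ∩ Metric.ball p (2 * ε)) (γ a) (γ b) with hP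
  -- Visible times accumulate from the right at each `z < w`; at `z = w` the hypothesis on `γ w` is
  -- what serves.
  have hdense : ∀ z ∈ Icc v w, ∀ δ > 0, ∃ y ∈ Icc v w, dist y z < δ ∧ γ y ∈ pathDomain γ s := by
    intro z hz δ hδ
    rcases hz.2.eq_or_lt with rfl | hzw
    · exact ⟨z, ⟨hvw, le_rfl⟩, by simpa using hδ, hw⟩
    · have hlt : z < min w (z + (δ / 2).toNNReal) :=
        lt_min hzw (lt_add_of_pos_right z (by simpa using hδ))
      obtain ⟨y, hy, hy'⟩ := hγ.exists_mem_pathDomain_of_le (hsv.trans hz.1) hlt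
      refine ⟨y, ⟨hz.1.trans hy.1.le, hy.2.trans (min_le_left _ _)⟩, ?_, hy'⟩
      have h1 : (y : ℝ) ≤ z + δ / 2 := by
        have := NNReal.coe_le_coe.2 (hy.2.trans (min_le_right _ _))
        rwa [NNReal.coe_add, Real.coe_toNNReal _ (by linarith)] at this
      have h2 : (z : ℝ) < y := NNReal.coe_lt_coe.2 hy.1
      rw [NNReal.dist_eq, abs_of_pos (by linarith)]
      linarith
  have hfin : P v w := by
    refine isPreconnected_Icc.induction₂ P ?_ ?_ ?_ (left_mem_Icc.2 hvw) (right_mem_Icc.2 hvw)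
    · intro x hx
      obtain ⟨δ, hδ, h⟩ := hγ.reflects s x (hsv.trans hx.1) ε hε
      filter_upwards [mem_nhdsWithin_of_mem_nhds (Metric.ball_mem_nhds x (half_pos hδ))] with y hy
      refine ⟨δ / 2, half_pos hδ, fun a _ b _ hax hby ha' hb' => ?_⟩
      refine (h a b (by linarith) ?_ ha' hb').mono ?_
      · have := dist_triangle b y x
        rw [Metric.mem_ball] at hy
        linarith
      · refine inter_subset_inter_right _ (Metric.ball_subset_ball' ?_)
        have := hball x hx
        rw [Metric.mem_ball] at this
        linarith
    · rintro x y z hx hy hz ⟨δ₁, h₁, H₁⟩ ⟨δ₂, h₂, H₂⟩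
      refine ⟨min δ₁ δ₂, lt_min h₁ h₂, fun a ha b hb hax hbz ha' hb' => ?_⟩
      obtain ⟨c, hc, hcy, hc'⟩ := hdense y hy (min δ₁ δ₂) (lt_min h₁ h₂)
      exact (H₁ a ha c hc (hax.trans_le (min_le_left _ _)) (hcy.trans_le (min_le_left _ _))
        ha' hc').trans (H₂ c hc b hb (hcy.trans_le (min_le_right _ _))
          (hbz.trans_le (min_le_right _ _)) hc' hb')
    · rintro x y hx hy ⟨δ, hδ, H⟩
      exact ⟨δ, hδ, fun a ha b hb hax hby ha' hb' => (H b hb a ha hby hax hb' ha').symm⟩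
  obtain ⟨δ, hδ, H⟩ := hfin
  exact H v (left_mem_Icc.2 hvw) w (right_mem_Icc.2 hvw) (by simpa using hδ) (by simpa using hδ)
    hv hw

theorem exists_isHydro_pathDomain (hγ : IsGrowingPath γ) {t : ℝ≥0} {R : ℝ} (hR : 0 < R)
    (h : ∀ s ≤ t, ‖γ s‖ ≤ R) : ∃ g E, IsHydro (pathDomain γ t) g ∧
      DifferentiableOn ℂ E (Metric.ball 0 R⁻¹) ∧ E 0 = 0 ∧
      (∀ w ∈ Metric.ball (0 : ℂ) R⁻¹, E (conj w) = conj (E w)) ∧ ∀ z, g z = z + E z⁻¹ := by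
  refine exists_isHydro (isOpen_pathDomain hγ.continuous t) (pathDomain_subset γ t) hR
    (fun z hz hzR => mem_pathDomain_of_lt_norm hR.le h hz hzR)
    (isPreconnected_pathDomain hγ.continuous t) ?_
  refine isPreconnected_symmHull_unboundedPart hR (forall_mem_image_Iic h)
    (isClosed_image_Iic hγ.continuous t)
    (isPreconnected_Iic.image _ hγ.continuous.continuousOn) ?_ ?_
  · rintro _ ⟨s, -, rfl⟩
    exact hγ.im_nonneg s
  · exact ⟨γ 0, ⟨0, mem_Iic.2 zero_le, rfl⟩, hγ.start_real⟩

end pathDomain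

/-! ### Expansions at infinity -/

/-- The Taylor series is averaged with its conjugate, which has the same sum by symmetry. -/
theorem hasSum_re_taylor {E : ℂ → ℂ} {ρ : ℝ} (hE : DifferentiableOn ℂ E (Metric.ball 0 ρ))
    (hconj : ∀ w ∈ Metric.ball (0 : ℂ) ρ, E (conj w) = conj (E w)) {w : ℂ}
    (hw : w ∈ Metric.ball (0 : ℂ) ρ) :
    HasSum (fun n : ℕ => ((((n.factorial : ℂ)⁻¹ * iteratedDeriv n E 0).re : ℝ) : ℂ) * w ^ n)
      (E w) := by
  have hser : ∀ w ∈ Metric.ball (0 : ℂ) ρ,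
      HasSum (fun n : ℕ => ((n.factorial : ℂ)⁻¹ * iteratedDeriv n E 0) * w ^ n) (E w) := by
    intro w hw
    refine (Complex.hasSum_taylorSeries_on_ball hE hw).congr_fun ?_
    intro n
    rw [sub_zero]
    simp only [smul_eq_mul]
    ring
  have hw' : conj w ∈ Metric.ball (0 : ℂ) ρ := by
    rwa [mem_ball_zero_iff, RCLike.norm_conj, ← mem_ball_zero_iff]
  have h1 := hser w hw
  have h2 := (hser _ hw').map (starRingEnd ℂ) Complex.continuous_conj
  rw [hconj w hw, Complex.conj_conj] at h2
  have h3 := (h1.add h2).mul_left (2⁻¹ : ℂ)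
  have h4 : (2⁻¹ : ℂ) * (E w + E w) = E w := by ring
  rw [h4] at h3
  refine h3.congr_fun fun n => ?_
  simp only [Function.comp_apply, map_mul, map_pow, Complex.conj_conj]
  rw [Complex.re_eq_add_conj]
  simp only [map_mul]
  ring

/-- Capacity becomes a limit of values of `g`, which shows that it is unique and transfers
inequalities between imaginary parts. Convergence at the single point `iρ` already bounds the
coefficients geometrically. -/
theorem tendsto_of_hasSum_inv {g : ℂ → ℂ} {a : ℕ → ℝ} {R : ℝ}
    (h : ∀ z ∈ upperHalf, R < ‖z‖ →
      HasSum (fun n : ℕ => (a (n + 1) : ℂ) / z ^ (n + 1)) (g z - z)) :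
    Tendsto (fun y : ℝ => y * (y - (g (y * Complex.I)).im)) atTop (𝓝 (a 1)) := by
  set ρ := |R| + 1
  have hρ : 0 < ρ := by positivity
  have hmem : ∀ y : ℝ, ρ ≤ y → (y : ℂ) * Complex.I ∈ upperHalf ∧ ‖(y : ℂ) * Complex.I‖ = y ∧
      R < ‖(y : ℂ) * Complex.I‖ := by
    intro y hy
    have hn : ‖(y : ℂ) * Complex.I‖ = y := by
      rw [norm_mul, Complex.norm_I, mul_one, Complex.norm_real, Real.norm_eq_abs,
        abs_of_pos (hρ.trans_le hy)]
    refine ⟨?_, hn, ?_⟩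
    · change 0 < ((y : ℂ) * Complex.I).im
      rw [Complex.im_ofReal_mul, Complex.I_im, mul_one]
      exact hρ.trans_le hy
    · rw [hn]
      have := le_abs_self R
      simp only [ρ] at hy
      linarith
  obtain ⟨hρ1, hρ2, hρ3⟩ := hmem ρ le_rfl
  obtain ⟨C, hC⟩ : ∃ C : ℝ, ∀ n : ℕ, |a (n + 1)| ≤ C * ρ ^ (n + 1) := by
    have := (h _ hρ1 hρ3).summable.tendsto_atTop_zero.norm.bddAbove_range
    obtain ⟨C, hC⟩ := this
    refine ⟨C, fun n => ?_⟩
    have := hC ⟨n, rfl⟩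
    simp only [norm_div, norm_pow, Complex.norm_real, Real.norm_eq_abs] at this
    rw [hρ2, div_le_iff₀ (by positivity)] at this
    exact this
  have hC0 : 0 ≤ C := by
    have := (abs_nonneg _).trans (hC 0)
    exact nonneg_of_mul_nonneg_left this (by positivity)
  have key : ∀ y : ℝ, 2 * ρ ≤ y →
      ‖y * (y - (g (y * Complex.I)).im) - a 1‖ ≤ 2 * C * ρ ^ 2 * y⁻¹ := by
    intro y hy
    have hy0 : 0 < y := by linarith
    obtain ⟨h1, h2, h3⟩ := hmem y (by linarith)
    set z : ℂ := y * Complex.I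
    have hz0 : z ≠ 0 := by
      intro h0
      rw [h0, norm_zero] at h2
      linarith
    have hs := h z h1 h3
    have hs2 := (hasSum_nat_add_iff' 1).2 hs
    have hq : ρ / y ≤ 1 / 2 := by
      rw [div_le_div_iff₀ hy0 two_pos]
      linarith
    have hq0 : 0 ≤ ρ / y := by positivity
    have hgeo : HasSum (fun n : ℕ => C * (ρ / y) ^ 2 * (ρ / y) ^ n)
        (C * (ρ / y) ^ 2 * (1 - ρ / y)⁻¹) :=
      (hasSum_geometric_of_lt_one hq0 (by linarith)).mul_left _
    have hb := hs2.norm_le_of_bounded hgeo fun n => by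
      rw [norm_div, norm_pow, Complex.norm_real, Real.norm_eq_abs, h2,
        div_le_iff₀ (by positivity)]
      refine (hC (n + 1)).trans (le_of_eq ?_)
      rw [mul_assoc C, ← pow_add, mul_assoc, div_pow, add_comm 2 n,
        div_mul_cancel₀ _ (by positivity)]
    have hb2 : ‖g z - z - a 1 / z‖ ≤ 2 * C * ρ ^ 2 / y ^ 2 := by
      calc ‖g z - z - a 1 / z‖ = ‖g z - z - ∑ i ∈ Finset.range 1, (a (i + 1) : ℂ) / z ^ (i + 1)‖ := by
            simp
        _ ≤ _ := hb
        _ ≤ C * (ρ / y) ^ 2 * 2 := by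
            gcongr
            rw [inv_le_comm₀ (by linarith) two_pos]
            linarith
        _ = _ := by field_simp
    have him : (a 1 / z).im = -(a 1 / y) := by
      have : (a 1 : ℂ) / z = ((-(a 1 / y) : ℝ) : ℂ) * Complex.I := by
        simp only [z]
        have : (y : ℂ) ≠ 0 := by exact_mod_cast hy0.ne'
        push_cast
        field_simp
        simp
      rw [this, Complex.im_ofReal_mul, Complex.I_im, mul_one]
    have hzi : z.im = y := by
      simp [z]
    have heq : y * (y - (g z).im) - a 1 = -y * (g z - z - a 1 / z).im := by
      rw [Complex.sub_im, Complex.sub_im, him, hzi]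
      field_simp
      ring
    rw [heq, norm_mul, norm_neg, Real.norm_eq_abs, Real.norm_eq_abs, abs_of_pos hy0]
    calc y * |(g z - z - a 1 / z).im| ≤ y * (2 * C * ρ ^ 2 / y ^ 2) := by
          gcongr
          exact (Complex.abs_im_le_norm _).trans hb2
      _ = _ := by field_simp
  rw [tendsto_iff_norm_sub_tendsto_zero]
  refine squeeze_zero' (Eventually.of_forall fun _ => norm_nonneg _)
    ((eventually_ge_atTop (2 * ρ)).mono key) ?_
  have := (tendsto_inv_atTop_zero (𝕜 := ℝ)).const_mul (2 * C * ρ ^ 2)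
  rwa [mul_zero] at this

/-- A holomorphic function that is real on the real line, has nonnegative imaginary part below it
and whose derivative at `0` vanishes is zero. -/
theorem eventually_eq_zero_of_im_nonneg {F : ℂ → ℂ} {ρ : ℝ} (hρ : 0 < ρ)
    (hF : DifferentiableOn ℂ F (Metric.ball 0 ρ)) (h0 : F 0 = 0)
    (hconj : ∀ w ∈ Metric.ball (0 : ℂ) ρ, F (conj w) = conj (F w))
    (him : ∀ w ∈ Metric.ball (0 : ℂ) ρ, w.im < 0 → 0 ≤ (F w).im)
    (hd : (deriv F 0).re = 0) : ∀ᶠ w in 𝓝 0, F w = 0 := by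
  set σ := ρ / 2
  have hσ : 0 < σ := half_pos hρ
  have hball : Metric.ball (0 : ℂ) ρ ∈ 𝓝 (0 : ℂ) := Metric.ball_mem_nhds _ hρ
  -- On `|w| = σ` the factor `1 - w²/σ²` turns `F w / w` into `-(2 Im w / σ²) i F w`, whose real
  -- part is at most `0` by the sign condition. As `Re Φ` is `0` at the centre, `exp Φ` has maximal
  -- modulus there and is constant.
  set Φ : ℂ → ℂ := fun w => dslope F 0 w * (1 - w ^ 2 / σ ^ 2)
  have hΦ : DifferentiableOn ℂ Φ (Metric.ball 0 ρ) :=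
    ((Complex.differentiableOn_dslope hball).2 hF).mul (by fun_prop)
  have hΦ0 : Φ 0 = deriv F 0 := by simp [Φ]
  have hreal : ∀ w ∈ Metric.ball (0 : ℂ) ρ, (F w).im * w.im ≤ 0 := by
    intro w hw
    rcases lt_trichotomy w.im 0 with h | h | h
    · exact mul_nonpos_of_nonneg_of_nonpos (him w hw h) h.le
    · rw [h, mul_zero]
    · have := him (conj w) (by rwa [mem_ball_zero_iff, RCLike.norm_conj, ← mem_ball_zero_iff])
        (by simpa using h)
      rw [hconj w hw, Complex.conj_im] at this
      exact mul_nonpos_of_nonpos_of_nonneg (by linarith) h.le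
  have hsph : ∀ w ∈ Metric.sphere (0 : ℂ) σ, (Φ w).re ≤ 0 := by
    intro w hw
    have hwn : ‖w‖ = σ := by simpa using hw
    have hw0 : w ≠ 0 := by
      intro h
      rw [h, norm_zero] at hwn
      exact hσ.ne hwn
    have hwb : w ∈ Metric.ball (0 : ℂ) ρ := by
      rw [mem_ball_zero_iff, hwn]
      exact half_lt_self hρ
    have hσC : (σ : ℂ) ^ 2 = w * conj w := by
      rw [Complex.mul_conj, Complex.normSq_eq_norm_sq, hwn]
      push_cast
      rfl
    have hcw : conj w ≠ 0 := by simpa using hw0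
    have h1 : Φ w = ((-(2 * w.im) / σ ^ 2 : ℝ) : ℂ) * (Complex.I * F w) := by
      simp only [Φ]
      rw [dslope_of_ne _ hw0, slope_def_field, h0]
      push_cast
      rw [hσC]
      have h2 : conj w - w = -(2 * w.im) * Complex.I := by
        apply Complex.ext <;> simp
        ring
      simp only [sub_zero]
      field_simp
      linear_combination F w * h2
    rw [h1, Complex.re_ofReal_mul]
    have h3 : (Complex.I * F w).re = -(F w).im := by simp
    rw [h3]
    have := hreal w hwb
    have : -(2 * w.im) / σ ^ 2 * -(F w).im = 2 * ((F w).im * w.im) / σ ^ 2 := by ring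
    rw [this]
    exact div_nonpos_of_nonpos_of_nonneg (by linarith) (by positivity)
  have hexp : DifferentiableOn ℂ (fun w => Complex.exp (Φ w)) (Metric.ball 0 ρ) := hΦ.cexp
  have hsub : Metric.closedBall (0 : ℂ) σ ⊆ Metric.ball 0 ρ :=
    Metric.closedBall_subset_ball (half_lt_self hρ)
  have hmax : IsMaxOn (norm ∘ fun w => Complex.exp (Φ w)) (Metric.ball 0 σ) 0 := by
    intro w hw
    change ‖Complex.exp (Φ w)‖ ≤ ‖Complex.exp (Φ 0)‖
    have h1 : ‖Complex.exp (Φ 0)‖ = 1 := by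
      rw [Complex.norm_exp, hΦ0, hd, Real.exp_zero]
    rw [h1]
    refine Complex.norm_le_of_forall_mem_frontier_norm_le (U := Metric.ball 0 σ)
      (f := fun w => Complex.exp (Φ w)) Metric.isBounded_ball ?_ ?_ (subset_closure hw)
    · refine (hexp.mono ?_).diffContOnCl
      exact Metric.closure_ball_subset_closedBall.trans hsub
    · intro z hz
      rw [frontier_ball _ hσ.ne'] at hz
      rw [Complex.norm_exp, Real.exp_le_one_iff]
      exact hsph z hz
  have hconst := Complex.eqOn_of_isPreconnected_of_isMaxOn_norm
    (convex_ball (0 : ℂ) σ).isPreconnected Metric.isOpen_ball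
    (hexp.mono (Metric.ball_subset_closedBall.trans hsub)) (Metric.mem_ball_self hσ) hmax
  have hcont : ContinuousAt Φ 0 := (hΦ.differentiableAt hball).continuousAt
  have hΦev : ∀ᶠ w in 𝓝 0, Φ w = Φ 0 := by
    filter_upwards [Metric.ball_mem_nhds (0 : ℂ) hσ,
      hcont (Metric.ball_mem_nhds (Φ 0) one_pos)] with w hw hw1
    have h1 : Complex.exp (Φ w - Φ 0) = 1 := by
      have := hconst hw
      simp only [Function.const_apply] at this
      rw [Complex.exp_sub, this, div_self (Complex.exp_ne_zero _)]
    have h2 : |(Φ w - Φ 0).im| < 1 := by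
      refine (Complex.abs_im_le_norm _).trans_lt ?_
      simpa [dist_eq_norm] using hw1
    have h3 := abs_lt.1 h2
    have h4 := Complex.log_exp (x := Φ w - Φ 0) (by linarith [Real.pi_gt_three])
      (by linarith [Real.pi_gt_three])
    rw [h1, Complex.log_one] at h4
    exact (sub_eq_zero.1 h4.symm)
  -- `Φ` is constant near `0` and real on the real axis, so its imaginary part vanishes too.
  have hκ : Φ 0 = 0 := by
    refine Complex.ext ?_ ?_
    · rw [hΦ0, hd, Complex.zero_re]
    obtain ⟨δ, hδ, hball'⟩ := Metric.eventually_nhds_iff.1 hΦev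
    set x : ℝ := min (δ / 2) (σ / 2)
    have hx : 0 < x := lt_min (half_pos hδ) (half_pos hσ)
    have hxσ : x < σ := (min_le_right _ _).trans_lt (half_lt_self hσ)
    have hx0 : (x : ℂ) ≠ 0 := by exact_mod_cast hx.ne'
    have hxn : ‖(x : ℂ)‖ = x := by rw [Complex.norm_real, Real.norm_eq_abs, abs_of_pos hx]
    have h1 := hball' (y := (x : ℂ)) (by
      rw [dist_zero_right, hxn]
      exact (min_le_left _ _).trans_lt (half_lt_self hδ))
    have h2 := hconj x (by
      rw [mem_ball_zero_iff, hxn]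
      exact hxσ.trans (half_lt_self hρ))
    rw [Complex.conj_ofReal] at h2
    rw [← h1]
    simp only [Φ]
    rw [dslope_of_ne _ hx0, slope_def_field, h0]
    have h3 : F x = ((F x).re : ℂ) := (Complex.conj_eq_iff_re.1 h2.symm).symm
    rw [h3]
    have : ((F x).re - 0 : ℂ) / (x - 0) * (1 - x ^ 2 / σ ^ 2) =
        (((F x).re / x * (1 - x ^ 2 / σ ^ 2) : ℝ) : ℂ) := by
      push_cast
      ring
    rw [this, Complex.ofReal_im, Complex.zero_im]
  filter_upwards [hΦev, Metric.ball_mem_nhds (0 : ℂ) hσ] with w hw hwσ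
  by_cases hw0 : w = 0
  · rw [hw0, h0]
  rw [hκ] at hw
  simp only [Φ] at hw
  rcases mul_eq_zero.1 hw with h | h
  · rw [dslope_of_ne _ hw0, slope_def_field, h0] at h
    have := (div_eq_zero_iff.1 h).resolve_right (by simpa using hw0)
    simpa using this
  · exfalso
    have hσC : (σ : ℂ) ^ 2 ≠ 0 := by
      have : (σ : ℂ) ≠ 0 := by exact_mod_cast hσ.ne'
      positivity
    rw [sub_eq_zero, eq_comm, div_eq_one_iff_eq hσC] at h
    have := congrArg norm h
    rw [norm_pow, norm_pow, Complex.norm_real, Real.norm_eq_abs, abs_of_pos hσ] at this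
    have h2 : ‖w‖ < σ := by simpa using hwσ
    have := (sq_lt_sq₀ (norm_nonneg w) hσ.le).2 h2
    linarith

/-! ### The capacity of the hulls of a path -/

theorem IsHydro.isHydrodynamicMap {Ω K : Set ℂ} {g : ℂ → ℂ} (h : IsHydro Ω g)
    (hK : upperHalf \ K = Ω) : IsHydrodynamicMap K g := by
  subst hK
  refine ⟨h.diff, h.bij, ?_⟩
  rw [Metric.tendsto_nhds]
  intro ε hε
  obtain ⟨R, hR⟩ := h.asymp ε hε
  rw [eventually_inf_principal]
  filter_upwards [(isBounded_def.1 (Metric.isBounded_closedBall (x := (0 : ℂ)) (r := R)))]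
    with z hz hzΩ
  rw [dist_zero_right]
  refine hR z hzΩ ?_
  simpa using hz

theorem IsHydrodynamicMap.isHydro {Ω K : Set ℂ} {g : ℂ → ℂ} (h : IsHydrodynamicMap K g)
    (hK : upperHalf \ K = Ω) (hΩ : IsOpen Ω)
    (hfar : ∃ R : ℝ, ∀ z ∈ upperHalf, R < ‖z‖ → z ∈ Ω) : IsHydro Ω g := by
  subst hK
  refine ⟨hΩ, sdiff_subset, hfar, h.1, h.2.1, fun ε hε => ?_⟩
  have := Metric.tendsto_nhds.1 h.2.2 ε hε
  rw [eventually_inf_principal] at this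
  obtain ⟨R, -, hR⟩ := (Filter.hasBasis_cobounded_norm (E := ℂ)).eventually_iff.1 this
  refine ⟨R, fun z hz hzR => ?_⟩
  simpa using hR (show R ≤ ‖z‖ from hzR.le) hz

theorem tendsto_of_hasHullCapacity {K : Set ℂ} {c : ℝ} (h : HasHullCapacity K c)
    (hfar : ∃ R : ℝ, ∀ z ∈ upperHalf, R < ‖z‖ → z ∈ upperHalf \ K) :
    Tendsto (fun y : ℝ => y * (y - (hydroMap K (y * Complex.I)).im)) atTop (𝓝 c) := by
  obtain ⟨a, ⟨R, hR⟩, rfl⟩ := h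
  obtain ⟨R', hR'⟩ := hfar
  exact tendsto_of_hasSum_inv (R := max R R') fun z hz hzR =>
    hR z (hR' z hz ((le_max_right _ _).trans_lt hzR)) ((le_max_left _ _).trans_lt hzR)

namespace IsGrowingPath

variable {γ : ℝ≥0 → ℂ}

theorem exists_far (hγ : IsGrowingPath γ) (t : ℝ≥0) :
    ∃ R : ℝ, ∀ z ∈ upperHalf, R < ‖z‖ → z ∈ pathDomain γ t := by
  obtain ⟨R, hR, h⟩ := exists_norm_le_of_le hγ.continuous t
  exact ⟨R, fun z hz hzR => mem_pathDomain_of_lt_norm hR.le h hz hzR⟩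

theorem isHydrodynamicMap (hγ : IsGrowingPath γ) (t : ℝ≥0) :
    IsHydrodynamicMap (pathHull γ t) (hydroMap (pathHull γ t)) := by
  obtain ⟨R, hR, h⟩ := exists_norm_le_of_le hγ.continuous t
  obtain ⟨g, -, hg, -⟩ := exists_isHydro_pathDomain hγ hR h
  exact Classical.epsilon_spec ⟨g, hg.isHydrodynamicMap (upperHalf_diff_pathHull hγ.continuous t)⟩

theorem isHydro (hγ : IsGrowingPath γ) (t : ℝ≥0) :
    IsHydro (pathDomain γ t) (hydroMap (pathHull γ t)) :=
  (hγ.isHydrodynamicMap t).isHydro (upperHalf_diff_pathHull hγ.continuous t)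
    (isOpen_pathDomain hγ.continuous t) (hγ.exists_far t)

theorem exists_expansion (hγ : IsGrowingPath γ) {t : ℝ≥0} {R : ℝ} (hR : 0 < R)
    (h : ∀ s ≤ t, ‖γ s‖ ≤ R) : ∃ E : ℂ → ℂ,
      DifferentiableOn ℂ E (Metric.ball 0 R⁻¹) ∧ E 0 = 0 ∧
      (∀ w ∈ Metric.ball (0 : ℂ) R⁻¹, E (conj w) = conj (E w)) ∧
      (∀ z ∈ pathDomain γ t, hydroMap (pathHull γ t) z = z + E z⁻¹) ∧
      HasHullCapacity (pathHull γ t) (deriv E 0).re := by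
  obtain ⟨g, E, hg, hE, hE0, hEc, hgE⟩ := exists_isHydro_pathDomain hγ hR h
  have heq : ∀ z ∈ pathDomain γ t, hydroMap (pathHull γ t) z = z + E z⁻¹ := fun z hz => by
    rw [(hγ.isHydro t).eqOn hg hz, hgE]
  refine ⟨E, hE, hE0, hEc, heq, fun n => ((n.factorial : ℂ)⁻¹ * iteratedDeriv n E 0).re,
    ⟨R, fun z hz hzR => ?_⟩, by simp⟩
  rw [upperHalf_diff_pathHull hγ.continuous] at hz
  have hzb : z⁻¹ ∈ Metric.ball (0 : ℂ) R⁻¹ := by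
    rw [mem_ball_zero_iff, norm_inv]
    exact (inv_lt_inv₀ (hR.trans hzR) hR).2 hzR
  have hs := (hasSum_nat_add_iff' 1).2 (hasSum_re_taylor hE hEc hzb)
  rw [heq z hz, add_sub_cancel_left]
  rw [Finset.sum_range_one, iteratedDeriv_zero, hE0, mul_zero, Complex.zero_re,
    Complex.ofReal_zero, zero_mul, sub_zero] at hs
  exact hs.congr_fun fun n => by rw [inv_pow, div_eq_mul_inv]

theorem hasHullCapacity (hγ : IsGrowingPath γ) (t : ℝ≥0) :
    HasHullCapacity (pathHull γ t) (hullCapacity (pathHull γ t)) := by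
  obtain ⟨R, hR, h⟩ := exists_norm_le_of_le hγ.continuous t
  obtain ⟨E, -, -, -, -, hE⟩ := hγ.exists_expansion hR h
  exact Classical.epsilon_spec ⟨_, hE⟩

theorem tendsto_capacity (hγ : IsGrowingPath γ) {t : ℝ≥0} {c : ℝ}
    (hc : HasHullCapacity (pathHull γ t) c) :
    Tendsto (fun y : ℝ => y * (y - (hydroMap (pathHull γ t) (y * Complex.I)).im)) atTop
      (𝓝 c) := by
  refine tendsto_of_hasHullCapacity hc ?_
  rw [upperHalf_diff_pathHull hγ.continuous]
  exact hγ.exists_far t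

theorem hullCapacity_eq (hγ : IsGrowingPath γ) {t : ℝ≥0} {c : ℝ}
    (hc : HasHullCapacity (pathHull γ t) c) : hullCapacity (pathHull γ t) = c :=
  tendsto_nhds_unique (hγ.tendsto_capacity (hγ.hasHullCapacity t)) (hγ.tendsto_capacity hc)

theorem hullCapacity_mono_and_le (hγ : IsGrowingPath γ) {s t : ℝ≥0} (hst : s ≤ t) {x r : ℝ}
    (hr : 0 < r)
    (h : ∀ w ∈ upperHalf, r < ‖w - x‖ → w ∈ hydroMap (pathHull γ s) '' pathDomain γ t) :
    hullCapacity (pathHull γ s) ≤ hullCapacity (pathHull γ t) ∧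
      hullCapacity (pathHull γ t) ≤ hullCapacity (pathHull γ s) + r ^ 2 :=
  (hγ.isHydro s).capacity_le (hγ.isHydro t) (pathDomain_antitone γ hst)
    (hγ.tendsto_capacity (hγ.hasHullCapacity s)) (hγ.tendsto_capacity (hγ.hasHullCapacity t)) hr h

theorem im_hydroMap_le (hγ : IsGrowingPath γ) {s t : ℝ≥0} (hst : s ≤ t) {z : ℂ}
    (hz : z ∈ pathDomain γ t) :
    (hydroMap (pathHull γ t) z).im ≤ (hydroMap (pathHull γ s) z).im := by
  have hsub := pathDomain_antitone γ hst
  have := ((hγ.isHydro s).comp_inv (hγ.isHydro t) hsub).im_le (mem_image_of_mem _ hz)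
  rwa [Function.comp_apply, (hγ.isHydro s).inv_apply (hsub hz)] at this

/-! ### Strict monotonicity of the capacity -/

theorem hullCapacity_mono (hγ : IsGrowingPath γ) :
    Monotone fun t => hullCapacity (pathHull γ t) := by
  intro s t hst
  refine le_of_tendsto_of_tendsto (hγ.tendsto_capacity (hγ.hasHullCapacity s))
    (hγ.tendsto_capacity (hγ.hasHullCapacity t)) ?_
  obtain ⟨R, hR⟩ := hγ.exists_far t
  filter_upwards [eventually_gt_atTop R, eventually_gt_atTop 0] with y hy hy0
  have hmem : (y : ℂ) * Complex.I ∈ pathDomain γ t := by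
    refine hR _ ?_ ?_
    · change 0 < ((y : ℂ) * Complex.I).im
      rwa [Complex.im_ofReal_mul, Complex.I_im, mul_one]
    · rwa [norm_mul, Complex.norm_I, mul_one, Complex.norm_real, Real.norm_eq_abs, abs_of_pos hy0]
  have := hγ.im_hydroMap_le hst hmem
  gcongr

/-- With equal capacities the difference of the two expansions has zero first coefficient and a
definite sign, so it vanishes near infinity. By the identity theorem `g_s = g_t` on `H_t`;
surjectivity of `g_t` and injectivity of `g_s` give `H_s ⊆ H_t`, against strict growth. -/
theorem hullCapacity_strictMono (hγ : IsGrowingPath γ) :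
    StrictMono fun t => hullCapacity (pathHull γ t) := by
  intro s t hst
  refine lt_of_le_of_ne (hγ.hullCapacity_mono hst.le) fun heq => ?_
  change hullCapacity (pathHull γ s) = hullCapacity (pathHull γ t) at heq
  obtain ⟨R, hR, h⟩ := exists_norm_le_of_le hγ.continuous t
  obtain ⟨E, hE, hE0, hEc, hEg, hcap⟩ := hγ.exists_expansion hR h
  obtain ⟨E', hE', hE0', hEc', hEg', hcap'⟩ :=
    hγ.exists_expansion hR fun u (hu : u ≤ s) => h u (hu.trans hst.le)
  rw [hγ.hullCapacity_eq hcap, hγ.hullCapacity_eq hcap'] at heq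
  have hb : Metric.ball (0 : ℂ) R⁻¹ ∈ 𝓝 (0 : ℂ) := Metric.ball_mem_nhds _ (inv_pos.2 hR)
  have hsub := pathDomain_antitone γ hst.le
  have hz : ∀ᶠ w in 𝓝 0, E' w - E w = 0 := by
    refine eventually_eq_zero_of_im_nonneg (F := fun w => E' w - E w) (inv_pos.2 hR)
      (hE'.sub hE) (by simp [hE0, hE0']) ?_ ?_ ?_
    · intro w hw
      rw [hEc w hw, hEc' w hw, map_sub]
    · intro w hw hwim
      have hw0 : w ≠ 0 := by
        rintro rfl
        simp at hwim
      have hmem : w⁻¹ ∈ pathDomain γ t := by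
        refine mem_pathDomain_of_lt_norm hR.le h ?_ ?_
        · change 0 < (w⁻¹).im
          rw [Complex.inv_im]
          exact div_pos (by linarith) (Complex.normSq_pos.2 hw0)
        · rw [norm_inv]
          exact (lt_inv_comm₀ hR (norm_pos_iff.2 hw0)).2 (by simpa using hw)
      have := hγ.im_hydroMap_le hst.le hmem
      rw [hEg _ hmem, hEg' _ (hsub hmem), inv_inv] at this
      simp only [Complex.add_im, Complex.sub_im] at this ⊢
      linarith
    · have h1 := hE.differentiableAt hb
      have h2 := hE'.differentiableAt hb
      rw [deriv_fun_sub h2 h1, Complex.sub_re, heq, sub_self]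
  have hfar : ∀ᶠ z in cobounded ℂ, E' z⁻¹ - E z⁻¹ = 0 := by
    exact (tendsto_inv₀_cobounded (α := ℂ)).eventually hz
  obtain ⟨R₁, -, hR₁⟩ := (Filter.hasBasis_cobounded_norm (E := ℂ)).eventually_iff.1 hfar
  have hgeq : EqOn (hydroMap (pathHull γ s)) (hydroMap (pathHull γ t)) (pathDomain γ t) := by
    obtain ⟨p, hp, hpR⟩ := exists_mem_upperHalf_lt_norm (max R R₁)
    have hpt := mem_pathDomain_of_lt_norm hR.le h hp ((le_max_left _ _).trans_lt hpR)
    have hopen := isOpen_pathDomain hγ.continuous t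
    refine (((hγ.isHydro s).diff.mono hsub).analyticOnNhd hopen).eqOn_of_preconnected_of_eventuallyEq
      ((hγ.isHydro t).diff.analyticOnNhd hopen) (isPreconnected_pathDomain hγ.continuous t) hpt ?_
    filter_upwards [hopen.mem_nhds hpt,
      (isOpen_lt continuous_const continuous_norm).mem_nhds
        (show p ∈ {z : ℂ | R₁ < ‖z‖} from (le_max_right _ _).trans_lt hpR)] with z hz hzR
    rw [hEg z hz, hEg' z (hsub hz)]
    have hzR' : R₁ < ‖z‖ := hzR
    have := hR₁ (show R₁ ≤ ‖z‖ from hzR'.le)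
    rw [sub_eq_zero.1 this]
  have hsub' : pathDomain γ s ⊆ pathDomain γ t := by
    intro z hz
    obtain ⟨w, hw, hwz⟩ := (hγ.isHydro t).bij.surjOn ((hγ.isHydro s).im_pos hz)
    rw [← hgeq hw] at hwz
    rwa [← (hγ.isHydro s).bij.injOn (hsub hw) hz hwz]
  exact (hγ.strictMono_hull hst).not_ge (closure_mono (sdiff_subset_sdiff_right hsub'))

theorem pathDomain_zero (hγ : IsGrowingPath γ) : pathDomain γ 0 = upperHalf := by
  refine (pathDomain_subset γ 0).antisymm ?_
  obtain ⟨R, hR⟩ := hγ.exists_far 0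
  obtain ⟨p, hp, hpR⟩ := exists_mem_upperHalf_lt_norm R
  refine subset_unboundedPart convex_upperHalf.isPreconnected (fun z hz => ⟨hz, ?_⟩)
    ⟨p, hp, hR p hp hpR⟩
  rintro ⟨s, hs, rfl⟩
  have hs0 : s = 0 := le_antisymm hs zero_le
  rw [hs0] at hz
  exact (show 0 < (γ 0).im from hz).ne' hγ.start_real

theorem hullCapacity_zero (hγ : IsGrowingPath γ) : hullCapacity (pathHull γ 0) = 0 := by
  refine tendsto_nhds_unique (hγ.tendsto_capacity (hγ.hasHullCapacity 0)) ?_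
  refine tendsto_const_nhds.congr' ?_
  filter_upwards [eventually_gt_atTop 0] with y hy
  have h := hγ.isHydro 0
  rw [hγ.pathDomain_zero] at h
  rw [h.eq_self (by
    change 0 < ((y : ℂ) * Complex.I).im
    rwa [Complex.im_ofReal_mul, Complex.I_im, mul_one]), Complex.im_ofReal_mul, Complex.I_im,
    mul_one, sub_self, mul_zero]

end IsGrowingPath

/-! ### The image of the tip -/

namespace IsGrowingPath

variable {γ : ℝ≥0 → ℂ}

/-- Crosscuts of small diameter have small images, uniformly on bounded time intervals. -/
theorem exists_norm_sub_le (hγ : IsGrowingPath γ) (T : ℝ≥0) {η : ℝ} (hη : 0 < η) :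
    ∃ ε > 0, ∀ t ≤ T, ∀ u ≤ T, ∀ a b, JoinedIn (pathDomain γ t ∩ Metric.ball (γ u) ε) a b →
      ‖hydroMap (pathHull γ t) a - hydroMap (pathHull γ t) b‖ ≤ η := by
  obtain ⟨R, hR, h⟩ := exists_norm_le_of_le hγ.continuous T
  obtain ⟨ε, hε, H⟩ := exists_small_image (max R 1) η (le_max_right _ _) hη
  refine ⟨ε, hε, fun t ht u hu a b hab => ?_⟩
  refine H _ _ (γ u) (hγ.isHydro t) (fun z hz hzR => mem_pathDomain_of_lt_norm hR.le
    (fun s hs => h s (hs.trans ht)) hz ((le_max_left _ _).trans_lt hzR))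
    ((h u hu).trans (le_max_left _ _)) (range hab.somePath) ?_
    (isPreconnected_range hab.somePath.continuous) a ⟨0, hab.somePath.source⟩ b
    ⟨1, hab.somePath.target⟩
  rintro _ ⟨x, rfl⟩
  exact hab.somePath_mem x

theorem frequently_mem_pathDomain (hγ : IsGrowingPath γ) (t : ℝ≥0) :
    ∃ᶠ s in 𝓝[>] t, γ s ∈ pathDomain γ t := by
  rw [frequently_iff]
  intro U hU
  obtain ⟨b, hb, hbU⟩ := mem_nhdsGT_iff_exists_Ioc_subset.1 hU
  obtain ⟨v, hv, hv'⟩ := hγ.exists_mem_pathDomain hb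
  exact ⟨v, hbU hv, hv'⟩

theorem tipNhd_subset (γ : ℝ≥0 → ℂ) (t : ℝ≥0) (ε : ℝ) :
    tipNhd γ t ε ⊆ pathDomain γ t ∩ Metric.ball (γ t) ε := by
  intro z hz
  obtain ⟨s, hs⟩ := Frequently.exists hz
  exact hs.target_mem

theorem tipNhd_mono (γ : ℝ≥0 → ℂ) (t : ℝ≥0) : Monotone (tipNhd γ t) := fun _ _ h _ hz =>
  Frequently.mono hz fun _ hs => hs.mono (inter_subset_inter_right _ (Metric.ball_subset_ball h))

theorem hasBasis_tipFilter (γ : ℝ≥0 → ℂ) (t : ℝ≥0) :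
    (tipFilter γ t).HasBasis (fun ε : ℝ => 0 < ε) (tipNhd γ t) := by
  refine hasBasis_biInf_principal (S := Ioi (0 : ℝ)) ?_ ⟨1, mem_Ioi.2 one_pos⟩
  intro a ha b hb
  exact ⟨min a b, lt_min (show 0 < a from ha) hb, tipNhd_mono γ t (min_le_left _ _),
    tipNhd_mono γ t (min_le_right _ _)⟩

theorem tipNhd_nonempty (hγ : IsGrowingPath γ) (t : ℝ≥0) {ε : ℝ} (hε : 0 < ε) :
    (tipNhd γ t ε).Nonempty := by
  obtain ⟨δ, hδ, h⟩ := hγ.reflects t t le_rfl ε hε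
  have hnear : ∀ᶠ s in 𝓝[>] t, dist s t < δ :=
    mem_nhdsWithin_of_mem_nhds (Metric.ball_mem_nhds t hδ)
  obtain ⟨v, hv, hvδ⟩ := ((hγ.frequently_mem_pathDomain t).and_eventually hnear).exists
  refine ⟨γ v, ?_⟩
  exact ((hγ.frequently_mem_pathDomain t).and_eventually hnear).mono
    fun s hs => h s v hs.2 hvδ hs.1 hv

theorem tipFilter_neBot (hγ : IsGrowingPath γ) (t : ℝ≥0) : (tipFilter γ t).NeBot :=
  (hasBasis_tipFilter γ t).neBot_iff.2 fun hε => hγ.tipNhd_nonempty t hε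

/-- Both points are joined to path points at times just after `t`, and the reflection property at
time `t` joins those to each other. -/
theorem joinedIn_of_mem_tipNhd (hγ : IsGrowingPath γ) {t : ℝ≥0} {ε : ℝ} (hε : 0 < ε) {z z' : ℂ}
    (hz : z ∈ tipNhd γ t ε) (hz' : z' ∈ tipNhd γ t ε) :
    JoinedIn (pathDomain γ t ∩ Metric.ball (γ t) ε) z z' := by
  obtain ⟨δ, hδ, h⟩ := hγ.reflects t t le_rfl ε hε
  have hnear : ∀ᶠ s in 𝓝[>] t, dist s t < δ :=
    mem_nhdsWithin_of_mem_nhds (Metric.ball_mem_nhds t hδ)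
  obtain ⟨v, hv, hvδ⟩ := (Frequently.and_eventually hz hnear).exists
  obtain ⟨w, hw, hwδ⟩ := (Frequently.and_eventually hz' hnear).exists
  exact hv.symm.trans ((h v w hvδ hwδ hv.source_mem.1 hw.source_mem.1).trans hw)

theorem tipFilter_le_nhds (γ : ℝ≥0 → ℂ) (t : ℝ≥0) : tipFilter γ t ≤ 𝓝 (γ t) := by
  refine ((hasBasis_tipFilter γ t).le_basis_iff Metric.nhds_basis_ball).2 fun ε hε => ?_
  exact ⟨ε, hε, (tipNhd_subset γ t ε).trans inter_subset_right⟩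

/-- Small tip neighbourhoods have small images, so the image filter is Cauchy. Were its limit `L` in
the open half-plane, `z = g⁻¹ (g z)` would tend to a point of `H_t`, whereas it tends to `γ t ∉
H_t`. -/
theorem exists_hasTipValue (hγ : IsGrowingPath γ) (t : ℝ≥0) : ∃ u, HasTipValue γ t u := by
  set g := hydroMap (pathHull γ t)
  have hg : IsHydro (pathDomain γ t) g := hγ.isHydro t
  have := hγ.tipFilter_neBot t
  have hC : Cauchy (map g (tipFilter γ t)) := by
    rw [Metric.cauchy_iff]
    refine ⟨inferInstance, fun η hη => ?_⟩
    obtain ⟨ε, hε, H⟩ := hγ.exists_norm_sub_le t (half_pos hη)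
    refine ⟨g '' tipNhd γ t ε, image_mem_map ((hasBasis_tipFilter γ t).mem_of_mem hε), ?_⟩
    rintro _ ⟨z, hz, rfl⟩ _ ⟨z', hz', rfl⟩
    rw [dist_eq_norm]
    have := H t le_rfl t le_rfl z z' (hγ.joinedIn_of_mem_tipNhd hε hz hz')
    linarith
  obtain ⟨L, hL⟩ := CompleteSpace.complete hC
  have hL' : Tendsto g (tipFilter γ t) (𝓝 L) := hL
  have hmem : ∀ᶠ z in tipFilter γ t, z ∈ pathDomain γ t :=
    mem_of_superset ((hasBasis_tipFilter γ t).mem_of_mem one_pos)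
      fun z hz => (tipNhd_subset γ t 1 hz).1
  have hL0 : 0 ≤ L.im := ge_of_tendsto ((Complex.continuous_im.tendsto L).comp hL')
    (hmem.mono fun z hz => (hg.im_pos hz).le)
  rcases hL0.eq_or_lt with hL0 | hL0
  · refine ⟨L.re, hγ.tipFilter_neBot t, ?_⟩
    have : ((L.re : ℝ) : ℂ) = L := Complex.ext (by simp) (by simpa using hL0)
    rwa [this]
  · exfalso
    have hcont : ContinuousAt (Function.invFunOn g (pathDomain γ t)) L :=
      (hg.inv_diff.differentiableAt (isOpen_upperHalf.mem_nhds hL0)).continuousAt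
    have h1 := hcont.tendsto.comp hL'
    have h2 : Tendsto (fun z => z) (tipFilter γ t) (𝓝 (Function.invFunOn g (pathDomain γ t) L)) :=
      h1.congr' (hmem.mono fun z hz => hg.inv_apply hz)
    have h3 := tendsto_nhds_unique h2 (tipFilter_le_nhds γ t)
    exact notMem_pathDomain le_rfl (h3 ▸ hg.inv_mem hL0)

theorem hasTipValue (hγ : IsGrowingPath γ) (t : ℝ≥0) : HasTipValue γ t (drivingFunction γ t) :=
  Classical.epsilon_spec (hγ.exists_hasTipValue t)

/-! ### Continuity -/

/-- `γ v` is joined to an earlier visible `γ s'` and on to a point `z` of the tip neighbourhood, all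
inside one small disc; then `z` tends to the tip. -/
theorem norm_sub_drivingFunction_le (hγ : IsGrowingPath γ) {T : ℝ≥0} {η ε : ℝ} (hε : 0 < ε)
    (H : ∀ t ≤ T, ∀ u ≤ T, ∀ a b, JoinedIn (pathDomain γ t ∩ Metric.ball (γ u) ε) a b →
      ‖hydroMap (pathHull γ t) a - hydroMap (pathHull γ t) b‖ ≤ η) {s v : ℝ≥0} (hsv : s < v)
    (hsT : s ≤ T) (hv : γ v ∈ pathDomain γ s)
    (hball : ∀ u ∈ Icc s v, γ u ∈ Metric.ball (γ s) (ε / 2)) :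
    ‖hydroMap (pathHull γ s) (γ v) - drivingFunction γ s‖ ≤ η := by
  have := hγ.tipFilter_neBot s
  have hlim := ((hγ.hasTipValue s).2.const_sub (hydroMap (pathHull γ s) (γ v))).norm
  refine le_of_tendsto hlim ?_
  filter_upwards [(hasBasis_tipFilter γ s).mem_of_mem hε] with z hz
  obtain ⟨s', hs', hs'v⟩ := (Frequently.and_eventually hz (Ioc_mem_nhdsGT hsv)).exists
  have := hγ.joinedIn hs'v.1.le hs'.source_mem.1 hv hs'v.2 (half_pos hε)
    fun u hu => hball u ⟨hs'v.1.le.trans hu.1, hu.2⟩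
  rw [mul_div_cancel₀ _ two_ne_zero] at this
  exact H s hsT s hsT _ _ (this.symm.trans hs')

/-- The open set `g_s(H_t)` reaches infinity, and a boundary point of it in the half-plane is the
image of some `γ u` with `s < u ≤ t`, hence within `η` of `U_s`. The connected region beyond
distance `η` therefore lies in it. -/
theorem mem_image_of_lt_norm_sub (hγ : IsGrowingPath γ) {T : ℝ≥0} {η ε : ℝ} (hη : 0 < η)
    (hε : 0 < ε)
    (H : ∀ t ≤ T, ∀ u ≤ T, ∀ a b, JoinedIn (pathDomain γ t ∩ Metric.ball (γ u) ε) a b →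
      ‖hydroMap (pathHull γ t) a - hydroMap (pathHull γ t) b‖ ≤ η) {s t : ℝ≥0} (hst : s ≤ t)
    (hsT : s ≤ T) (hball : ∀ u ∈ Icc s t, γ u ∈ Metric.ball (γ s) (ε / 2)) {w : ℂ}
    (hw : w ∈ upperHalf) (hwη : η < ‖w - drivingFunction γ s‖) :
    w ∈ hydroMap (pathHull γ s) '' pathDomain γ t := by
  have hs := hγ.isHydro s
  have ht := hγ.isHydro t
  have hsub := pathDomain_antitone γ hst
  set g := hydroMap (pathHull γ s)
  have hW := isPreconnected_upperHalf_outside (drivingFunction γ s) η hη.le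
  refine hW.subset_of_closure_inter_subset (hs.isOpen_image ht.isOpen hsub) ?_ ?_ ⟨hw, hwη⟩
  · obtain ⟨R, hR⟩ := (hs.comp_inv ht hsub).far
    obtain ⟨p, hp, hpR⟩ := exists_mem_upperHalf_lt_norm (max R (η + |drivingFunction γ s|))
    refine ⟨p, ⟨hp, ?_⟩, hR p hp ((le_max_left _ _).trans_lt hpR)⟩
    have h1 := norm_sub_norm_le p (drivingFunction γ s : ℂ)
    rw [Complex.norm_real, Real.norm_eq_abs] at h1
    have h2 := (le_max_right _ _).trans_lt hpR
    linarith
  · rintro w ⟨hwc, hwH, hwη⟩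
    have hcont : ContinuousAt (Function.invFunOn g (pathDomain γ s)) w :=
      (hs.inv_diff.differentiableAt (isOpen_upperHalf.mem_nhds hwH)).continuousAt
    have hcl : Function.invFunOn g (pathDomain γ s) w ∈ closure (pathDomain γ t) := by
      have h1 := hcont.continuousWithinAt.mem_closure_image hwc
      refine closure_mono ?_ h1
      rintro _ ⟨_, ⟨z, hz, rfl⟩, rfl⟩
      rwa [hs.inv_apply (hsub hz)]
    have hzs := hs.inv_mem hwH
    by_cases hz : Function.invFunOn g (pathDomain γ s) w ∈ pathDomain γ t
    · exact ⟨_, hz, hs.apply_inv hwH⟩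
    · exfalso
      obtain ⟨u, hu, hγu⟩ := exists_eq_of_mem_closure_pathDomain hγ.continuous
        (pathDomain_subset γ s hzs) hcl hz
      rw [← hγu] at hzs
      have hsu : s < u := lt_of_not_ge fun h => notMem_pathDomain h hzs
      have h2 := hγ.norm_sub_drivingFunction_le hε H hsu hsT hzs
        fun x hx => hball x ⟨hx.1, hx.2.trans hu⟩
      rw [hγu, show hydroMap (pathHull γ s) = g from rfl, hs.apply_inv hwH] at h2
      linarith

/-- For the driving function, take a point `γ v` visible in `H_t` with `v` just after `t`. Its
`g_s`-image is within `η` of `U_s`, so its image under `g_t = (g_t ∘ g_s⁻¹) ∘ g_s` is within `50η`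
of `U_s`; it is also within `η` of `U_t`. The time `t'` leaves room for `v`. -/
theorem abs_sub_le_of_small (hγ : IsGrowingPath γ) {T : ℝ≥0} {η ε : ℝ} (hη : 0 < η) (hε : 0 < ε)
    (H : ∀ t ≤ T, ∀ u ≤ T, ∀ a b, JoinedIn (pathDomain γ t ∩ Metric.ball (γ u) ε) a b →
      ‖hydroMap (pathHull γ t) a - hydroMap (pathHull γ t) b‖ ≤ η) {s t t' : ℝ≥0} (hst : s ≤ t)
    (htt' : t < t') (htT : t ≤ T)
    (hball : ∀ u ∈ Icc s t', ∀ v ∈ Icc s t', γ u ∈ Metric.ball (γ v) (ε / 2)) :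
    |hullCapacity (pathHull γ t) - hullCapacity (pathHull γ s)| ≤ η ^ 2 ∧
      |drivingFunction γ t - drivingFunction γ s| ≤ 51 * η := by
  have hs := hγ.isHydro s
  have ht := hγ.isHydro t
  have hsub := pathDomain_antitone γ hst
  have hfar : ∀ w ∈ upperHalf, η < ‖w - drivingFunction γ s‖ →
      w ∈ hydroMap (pathHull γ s) '' pathDomain γ t := fun w hw hwη =>
    hγ.mem_image_of_lt_norm_sub hη hε H hst (hst.trans htT)
      (fun u hu => hball u ⟨hu.1, hu.2.trans htt'.le⟩ s ⟨le_rfl, hst.trans htt'.le⟩) hw hwη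
  constructor
  · obtain ⟨h1, h2⟩ := hγ.hullCapacity_mono_and_le hst hη hfar
    rw [abs_of_nonneg (by linarith)]
    linarith
  · obtain ⟨v, hv, hvt⟩ := hγ.exists_mem_pathDomain htt'
    have h1 := hγ.norm_sub_drivingFunction_le hε H (hst.trans_lt hv.1) (hst.trans htT) (hsub hvt)
      fun u hu => hball u ⟨hu.1, hu.2.trans hv.2⟩ s ⟨le_rfl, hst.trans htt'.le⟩
    have h2 := hγ.norm_sub_drivingFunction_le hε H hv.1 htT hvt
      fun u hu => hball u ⟨hst.trans hu.1, hu.2.trans hv.2⟩ t ⟨hst, htt'.le⟩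
    have h3 := (hs.comp_inv ht hsub).norm_sub_le hη hfar (mem_image_of_mem _ hvt)
      (h1.trans (by linarith))
    rw [Function.comp_apply, hs.inv_apply (hsub hvt)] at h3
    have h4 : ‖((drivingFunction γ t - drivingFunction γ s : ℝ) : ℂ)‖ ≤ 51 * η := by
      calc ‖((drivingFunction γ t - drivingFunction γ s : ℝ) : ℂ)‖
          = ‖(hydroMap (pathHull γ t) (γ v) - drivingFunction γ s) -
              (hydroMap (pathHull γ t) (γ v) - drivingFunction γ t)‖ := by
            push_cast
            congr 1
            ring
        _ ≤ 50 * η + η := (norm_sub_le _ _).trans (add_le_add h3 h2)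
        _ = 51 * η := by ring
    rwa [Complex.norm_real, Real.norm_eq_abs] at h4

theorem eventually_abs_sub_le (hγ : IsGrowingPath γ) (t₀ : ℝ≥0) {η : ℝ} (hη : 0 < η) :
    ∀ᶠ t in 𝓝 t₀, |hullCapacity (pathHull γ t) - hullCapacity (pathHull γ t₀)| ≤ η ^ 2 ∧
      |drivingFunction γ t - drivingFunction γ t₀| ≤ 51 * η := by
  -- One `ε` serves all starting times up to `t₀ + 1`; to the left of `t₀` the comparison starts at
  -- `t` instead of `t₀`.
  obtain ⟨ε, hε, H⟩ := hγ.exists_norm_sub_le (t₀ + 1) hη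
  obtain ⟨ρ, hρ, hcont⟩ := Metric.continuousAt_iff.1 (hγ.continuous.continuousAt (x := t₀))
    (ε / 4) (by positivity)
  set N := Metric.ball t₀ (min ρ 1)
  have hN : N ∈ 𝓝 t₀ := Metric.ball_mem_nhds _ (lt_min hρ one_pos)
  have hNT : ∀ t ∈ N, t ≤ t₀ + 1 := by
    intro t ht
    have h1 : dist t t₀ < 1 := lt_of_lt_of_le ht (min_le_right _ _)
    rw [NNReal.dist_eq] at h1
    have := (abs_lt.1 h1).2
    rw [← NNReal.coe_le_coe]
    push_cast
    linarith
  have hNord : ∀ s ∈ N, ∀ t ∈ N, ∀ u ∈ Icc s t, ∀ v ∈ Icc s t,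
      γ u ∈ Metric.ball (γ v) (ε / 2) := by
    intro s hs t ht
    have hmem : ∀ u ∈ Icc s t, dist (γ u) (γ t₀) < ε / 4 := by
      intro u hu
      refine hcont ?_
      have h1 : dist s t₀ < ρ := lt_of_lt_of_le hs (min_le_left _ _)
      have h2 : dist t t₀ < ρ := lt_of_lt_of_le ht (min_le_left _ _)
      have h3 : (s : ℝ) ≤ u := NNReal.coe_le_coe.2 hu.1
      have h4 : (u : ℝ) ≤ t := NNReal.coe_le_coe.2 hu.2
      rw [NNReal.dist_eq, abs_lt] at *
      constructor <;> linarith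
    intro u hu v hv
    rw [Metric.mem_ball]
    have := dist_triangle_right (γ u) (γ v) (γ t₀)
    linarith [hmem u hu, hmem v hv]
  have hright : ∀ t ∈ N, ∃ t' ∈ N, t < t' := by
    intro t ht
    have h1 : N ∈ 𝓝[>] t := mem_nhdsWithin_of_mem_nhds (Metric.isOpen_ball.mem_nhds ht)
    obtain ⟨t', h2, h3⟩ := (Filter.inter_mem h1 self_mem_nhdsWithin |> Filter.nonempty_of_mem)
    exact ⟨t', h2, h3⟩
  filter_upwards [hN] with t ht
  have ht₀ : t₀ ∈ N := mem_of_mem_nhds hN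
  rcases le_total t₀ t with h | h
  · obtain ⟨t', ht', htt'⟩ := hright t ht
    exact hγ.abs_sub_le_of_small hη hε H h htt' (hNT t ht) (hNord t₀ ht₀ t' ht')
  · obtain ⟨t', ht', htt'⟩ := hright t₀ ht₀
    have := hγ.abs_sub_le_of_small hη hε H h htt' (hNT t₀ ht₀) (hNord t ht t' ht')
    rwa [abs_sub_comm, abs_sub_comm (drivingFunction γ t)]

theorem continuous_hullCapacity (hγ : IsGrowingPath γ) :
    Continuous fun t => hullCapacity (pathHull γ t) := by
  rw [continuous_iff_continuousAt]
  intro t₀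
  rw [Metric.continuousAt_iff']
  intro η hη
  have h1 : 0 < √(η / 2) := Real.sqrt_pos.2 (half_pos hη)
  filter_upwards [hγ.eventually_abs_sub_le t₀ h1] with t ht
  rw [Real.dist_eq]
  have := ht.1
  rw [Real.sq_sqrt (half_pos hη).le] at this
  linarith

theorem continuous_drivingFunction (hγ : IsGrowingPath γ) : Continuous (drivingFunction γ) := by
  rw [continuous_iff_continuousAt]
  intro t₀
  rw [Metric.continuousAt_iff']
  intro η hη
  -- The denominator `52` makes the bound `51 η / 52` strictly less than `η`.
  filter_upwards [hγ.eventually_abs_sub_le t₀ (show 0 < η / 52 by positivity)] with t ht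
  rw [Real.dist_eq]
  linarith [ht.2]

/-! ### Reparameterization by capacity -/

/-- Half the capacity is a strictly increasing function onto `[0, ∞)`, by the intermediate value
theorem; `φ` is its inverse. -/
theorem exists_orderIso_hullCapacity (hγ : IsGrowingPath γ) :
    ∃ φ : ℝ≥0 ≃o ℝ≥0, ∀ t : ℝ≥0, hullCapacity (pathHull γ (φ t)) = 2 * (t : ℝ) := by
  have hnonneg : ∀ t, 0 ≤ hullCapacity (pathHull γ t) := fun t =>
    hγ.hullCapacity_zero.symm.le.trans (hγ.hullCapacity_mono zero_le)
  set f : ℝ≥0 → ℝ≥0 := fun t => (hullCapacity (pathHull γ t) / 2).toNNReal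
  have hf : ∀ t, (f t : ℝ) = hullCapacity (pathHull γ t) / 2 := fun t =>
    Real.coe_toNNReal _ (div_nonneg (hnonneg t) two_pos.le)
  have hmono : StrictMono f := by
    intro s t hst
    rw [← NNReal.coe_lt_coe, hf, hf]
    have := hγ.hullCapacity_strictMono hst
    simp only at this
    linarith
  have hcont : Continuous f := 
    continuous_real_toNNReal.comp (hγ.continuous_hullCapacity.div_const 2)
  have hsurj : Function.Surjective f := by
    intro y
    obtain ⟨b, hb⟩ := (hγ.capacity_tendsto.eventually_ge_atTop (2 * (y : ℝ))).exists
    have hf0 : f 0 ≤ y := by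
      rw [← NNReal.coe_le_coe, hf, hγ.hullCapacity_zero]
      simp
    have hfb : y ≤ f b := by
      rw [← NNReal.coe_le_coe, hf]
      linarith
    obtain ⟨x, -, hx⟩ := intermediate_value_Icc (zero_le (a := b)) hcont.continuousOn ⟨hf0, hfb⟩
    exact ⟨x, hx⟩
  refine ⟨(hmono.orderIsoOfSurjective f hsurj).symm, fun t => ?_⟩
  have h1 : f ((hmono.orderIsoOfSurjective f hsurj).symm t) = t :=
    (hmono.orderIsoOfSurjective f hsurj).apply_symm_apply t
  have h2 := hf ((hmono.orderIsoOfSurjective f hsurj).symm t)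
  rw [h1] at h2
  linarith

end IsGrowingPath

theorem pathHull_comp_orderIso (γ : ℝ≥0 → ℂ) (φ : ℝ≥0 ≃o ℝ≥0) (t : ℝ≥0) :
    pathHull (γ ∘ φ) t = pathHull γ (φ t) := by
  have h : (γ ∘ φ) '' Iic t = γ '' Iic (φ t) := by
    rw [image_comp, OrderIso.image_Iic]
  simp only [pathHull, pathDomain, h]

theorem mainTheorem3 (γ : ℝ≥0 → ℂ) (hγ : IsGrowingPath γ) :
    -- the maps `g_t`, the capacities `a₁(K_t)` and the values `U_t = g_t(γ t)` exist
    (∀ t, IsHydrodynamicMap (pathHull γ t) (hydroMap (pathHull γ t)) ∧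
      HasHullCapacity (pathHull γ t) (hullCapacity (pathHull γ t)) ∧
      HasTipValue γ t (drivingFunction γ t)) ∧
    -- capacity and driving function are continuous
    Continuous (fun t => hullCapacity (pathHull γ t)) ∧
    Continuous (drivingFunction γ) ∧
    -- there is a reparameterization by capacity
    ∃ φ : ℝ≥0 ≃o ℝ≥0, ∀ t : ℝ≥0, hullCapacity (pathHull (γ ∘ φ) t) = 2 * (t : ℝ) := by
  refine ⟨fun t => ⟨hγ.isHydrodynamicMap t, hγ.hasHullCapacity t, hγ.hasTipValue t⟩,
    hγ.continuous_hullCapacity, hγ.continuous_drivingFunction, ?_⟩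
  obtain ⟨φ, hφ⟩ := hγ.exists_orderIso_hullCapacity
  exact ⟨φ, fun t => by rw [pathHull_comp_orderIso, hφ]⟩
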